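/- Let $\Bbbk$ be a field. Quivers are finite and paths are composed from left to right. For a quiver $Q$ let $J_Q\subseteq \Bbbk Q$ be the ideal generated by the arrows; an ideal $I$ of $\Bbbk Q$ is admissible if $J_Q^m\subseteq I\subseteq J_Q^2$ for some $m\ge 2$. For a bound quiver algebra $\Lambda=\Bbbk Q/I$ with $I$ admissible, $\mathrm{mod}\,\Lambda$ denotes the finitely generated right modules, $\Omega_\Lambda(M)$ the kernel of a projective cover of $M$, and $\Lambda_0$ the direct sum of the simple $\Lambda$-modules, one from each isomorphism class. Let $K_0(\Lambda)$ be the abelian group generated by the symbols $[M]$, $M\in\mathrm{mod}\,\Lambda$, with relations $[M]=[M']+[M'']$ if $M\cong M'\oplus M''$, and $[P]=0$ for $P$ projective; let $\bar\Omega_\Lambda$ be the endomorphism of $K_0(\Lambda)$ with $\bar\Omega_\Lambda[M]=[\Omega_\Lambda(M)]$. For a subgroup $D\subseteq K_0(\Lambda)$ let $\eta(D)\in\mathbb N\cup\{\infty\}$ be the least $k$ such that $\bar\Omega_\Lambda$ is injective on $\bar\Omega_\Lambda^{\,m}(D)$ for all $m\ge k$, and call $D$ syzygy finite if $\bar\Omega_\Lambda^{\,n}(D)$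 is finitely generated for some $n\ge 0$. Put $\phi(M)=\eta(\langle\mathrm{add}\,M\rangle)$, where $\langle\mathrm{add}\,M\rangle$ is generated by the classes of the indecomposable direct summands of $M$, and $\phi\dim(\Lambda)=\sup_{M\in \mathrm{mod}\,\Lambda}\phi(M)$. Let $A=\Bbbk Q_A/I_A$, $B=\Bbbk Q_B/I_B$ and $C=\Bbbk\Gamma/I_C$ be bound quiver algebras ($I_A,I_B,I_C$ admissible) such that * (H1) the vertex set of $\Gamma$ is the disjoint union of those of $Q_A$ and $Q_B$; * (H2) the arrows of $\Gamma$ are those of $Q_A$, those of $Q_B$, arrows $\alpha_j$ ($j\in \mathcal J$) from vertices of $Q_A$ to vertices of $Q_B$, and arrows $\beta_k$ ($k\in \mathcal K$) from vertices of $Q_B$ to vertices of $Q_A$; * (H3) $I_C$ contains $I_A$, $I_B$ and all products $\alpha\alpha_j$, $\beta\beta_k$, $\alpha_j\beta_k$, $\beta_k\alpha_j$ with $\alpha$ an arrow of $Q_A$ and $\beta$ an arrow of $Q_B$; moreover $I_C\cap \Bbbk Q_A=I_A$ and $I_C\cap\Bbbk Q_B=I_B$, i.e. $A$ and $B$ are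 the diagonal corners of $C$. Then $A$- and $B$-modules are $C$-modules (extension by zero); let $\Pi_A:\mathrm{mod}\,C\to\mathrm{mod}\,A$ and $\Pi_B:\mathrm{mod}\,C\to\mathrm{mod}\,B$ be the restrictions of representations. Let $\mathcal O\subseteq K_0(C)$ be the subgroup generated by the classes of all direct summands of the $A$-modules $\Omega_A^n(\Pi_A(\Omega_C(B_0)))$ and of the $B$-modules $\Omega_B^n(\Pi_B(\Omega_C(A_0)))$, $n\ge 0$. Assume * (H4) $\mathcal O$ is syzygy finite. If $\phi\dim(A)<\infty$ and $\phi\dim(B)<\infty$, then $\phi\dim(C)<\infty$, and $$\phi\dim(C)\ \le\ \sup\{\eta(D): D\subseteq\mathcal O \text{ a finitely generated subgroup}\}+\max(\phi\dim(A),\phi\dim(B))+2 .$$ -/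

import Mathlib

universe u

/-! ## Path algebras, admissible ideals -/

section PathAlgebra

open Quiver

/-- The path algebra `kQ` of a quiver `Q` with finite vertex set `V`: the component at `(v, w)` is
`e_v (kQ) e_w`, the vector space with basis the paths from `v` to `w`. -/
def PathAlgebra (k : Type u) [Field k] (V : Type u) [Quiver.{u} V] : Type u :=
  ∀ v w : V, Path v w →₀ k

variable {k : Type u} [Field k] {V : Type u} [Quiver.{u} V]

noncomputable instance : AddCommGroup (PathAlgebra k V) :=
  inferInstanceAs (AddCommGroup (∀ v w : V, Path v w →₀ k))

noncomputable instance : Module k (PathAlgebra k V) :=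
  inferInstanceAs (Module k (∀ v w : V, Path v w →₀ k))

namespace PathAlgebra

/-- Bilinear extension of the composition of paths, paths being composed from left to right. -/
noncomputable def conv (k : Type u) [Field k] {V : Type u} [Quiver.{u} V] (x y z : V) :
    (Path x y →₀ k) →ₗ[k] (Path y z →₀ k) →ₗ[k] (Path x z →₀ k) :=
  Finsupp.linearCombination k fun p => Finsupp.lmapDomain k k fun q => p.comp q

theorem conv_single {x y z : V} (p : Path x y) (q : Path y z) (a b : k) :
    conv k x y z (Finsupp.single p a) (Finsupp.single q b) =
      Finsupp.single (p.comp q) (a * b) := by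
  simp [conv, Finsupp.mapDomain_single]

theorem conv_assoc {x y z w : V} (f : Path x y →₀ k) (g : Path y z →₀ k) (h : Path z w →₀ k) :
    conv k x z w (conv k x y z f g) h = conv k x y w f (conv k y z w g h) := by
  induction f using Finsupp.induction_linear with
  | zero => simp
  | add f₁ f₂ h₁ h₂ => simp only [map_add, LinearMap.add_apply, h₁, h₂]
  | single p a =>
    induction g using Finsupp.induction_linear with
    | zero => simp
    | add f₁ f₂ h₁ h₂ => simp only [map_add, LinearMap.add_apply, h₁, h₂]
    | single q b =>
      induction h using Finsupp.induction_linear with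
      | zero => simp
      | add f₁ f₂ h₁ h₂ => simp only [map_add, h₁, h₂]
      | single r c => simp only [conv_single, Path.comp_assoc, mul_assoc]

theorem nil_conv {x y : V} (f : Path x y →₀ k) :
    conv k x x y (Finsupp.single Path.nil 1) f = f := by
  induction f using Finsupp.induction_linear with
  | zero => simp
  | add f₁ f₂ h₁ h₂ => simp only [map_add, h₁, h₂]
  | single p a => simp only [conv_single, Path.nil_comp, one_mul]

theorem conv_nil {x y : V} (f : Path x y →₀ k) :
    conv k x y y f (Finsupp.single Path.nil 1) = f := by
  induction f using Finsupp.induction_linear with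
  | zero => simp
  | add f₁ f₂ h₁ h₂ => simp only [map_add, LinearMap.add_apply, h₁, h₂]
  | single p a => simp only [conv_single, Path.comp_nil, mul_one]

/-- A path, as an element of the path algebra. -/
noncomputable def ofPath (k : Type u) [Field k] {x y : V} (p : Path x y) : PathAlgebra k V :=
  open Classical in
  (Pi.single x (Pi.single y (Finsupp.single p 1)) : ∀ v w : V, Path v w →₀ k)

/-- An arrow, as an element of the path algebra. -/
noncomputable def ofArrow (k : Type u) [Field k] {x y : V} (a : x ⟶ y) : PathAlgebra k V :=
  ofPath k a.toPath

theorem add_apply (f g : PathAlgebra k V) (x y : V) : (f + g) x y = f x y + g x y := rfl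

theorem zero_apply (x y : V) : (0 : PathAlgebra k V) x y = 0 := rfl

theorem smul_apply (c : k) (f : PathAlgebra k V) (x y : V) : (c • f) x y = c • f x y := rfl

theorem ext' {f g : PathAlgebra k V} (h : ∀ x y, f x y = g x y) : f = g :=
  funext fun x => funext fun y => h x y

noncomputable instance : One (PathAlgebra k V) :=
  open Classical in
  ⟨fun x => (Pi.single x (Finsupp.single Path.nil 1) : ∀ w : V, Path x w →₀ k)⟩

open Classical in
theorem one_apply (x y : V) : (1 : PathAlgebra k V) x y =
    (Pi.single x (Finsupp.single Path.nil 1) : ∀ w : V, Path x w →₀ k) y := rfl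

variable [Fintype V]

noncomputable instance : Mul (PathAlgebra k V) :=
  ⟨fun f g x z => ∑ y : V, conv k x y z (f x y) (g y z)⟩

theorem mul_apply (f g : PathAlgebra k V) (x z : V) :
    (f * g) x z = ∑ y : V, conv k x y z (f x y) (g y z) := rfl

protected theorem one_mul' (f : PathAlgebra k V) : 1 * f = f := by
  classical
  refine ext' fun x z => ?_
  rw [mul_apply, Finset.sum_eq_single x]
  · rw [one_apply, Pi.single_eq_same, nil_conv]
  · intro y _ hy
    rw [one_apply, Pi.single_eq_of_ne hy, map_zero, LinearMap.zero_apply]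
  · simp

protected theorem mul_one' (f : PathAlgebra k V) : f * 1 = f := by
  classical
  refine ext' fun x z => ?_
  rw [mul_apply, Finset.sum_eq_single z]
  · rw [one_apply, Pi.single_eq_same, conv_nil]
  · intro y _ hy
    rw [one_apply, Pi.single_eq_of_ne hy.symm, map_zero]
  · simp

protected theorem mul_assoc' (f g h : PathAlgebra k V) : f * g * h = f * (g * h) := by
  refine ext' fun x z => ?_
  simp only [mul_apply, map_sum, LinearMap.sum_apply, conv_assoc]
  exact Finset.sum_comm

noncomputable instance : Ring (PathAlgebra k V) where
  __ := (inferInstance : AddCommGroup (PathAlgebra k V))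
  one_mul := PathAlgebra.one_mul'
  mul_one := PathAlgebra.mul_one'
  mul_assoc := PathAlgebra.mul_assoc'
  left_distrib f g h := ext' fun x z => by
    simp only [mul_apply, add_apply, map_add, Finset.sum_add_distrib]
  right_distrib f g h := ext' fun x z => by
    simp only [mul_apply, add_apply, map_add, LinearMap.add_apply, Finset.sum_add_distrib]
  zero_mul f := ext' fun x z => by
    simp only [mul_apply, zero_apply, map_zero, LinearMap.zero_apply, Finset.sum_const_zero]
  mul_zero f := ext' fun x z => by
    simp only [mul_apply, zero_apply, map_zero, Finset.sum_const_zero]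

noncomputable instance : Algebra k (PathAlgebra k V) :=
  Algebra.ofModule
    (fun c f g => ext' fun x z => by
      simp only [mul_apply, smul_apply, map_smul, LinearMap.smul_apply, Finset.smul_sum])
    (fun c f g => ext' fun x z => by
      simp only [mul_apply, smul_apply, map_smul, Finset.smul_sum])

end PathAlgebra

/-- Every path occurring in `f` has length at least `n`; equivalently, `f` lies in the `n`-th power
of the ideal generated by the arrows. -/
def PathAlgebra.LengthGE (n : ℕ) (f : PathAlgebra k V) : Prop :=
  ∀ (x y : V) (p : Path x y), f x y p ≠ 0 → n ≤ p.length

/-- `I` is an admissible ideal: `J ^ m ⊆ I ⊆ J ^ 2` for some `m ≥ 2`, where `J` is the ideal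
generated by the arrows. -/
class IsAdmissible [Fintype V] (I : Ideal (PathAlgebra k V)) : Prop where
  pow_le : ∃ m : ℕ, 2 ≤ m ∧ ∀ f : PathAlgebra k V, f.LengthGE m → f ∈ I
  le_sq : ∀ f ∈ I, f.LengthGE 2

theorem finite_paths_length [Finite V] [∀ x y : V, Finite (x ⟶ y)] (n : ℕ) (x y : V) :
    {p : Path x y | p.length = n}.Finite := by
  induction n generalizing y with
  | zero =>
    refine Set.Subsingleton.finite fun p hp q hq => ?_
    cases p with
    | cons p a => simp at hp
    | nil =>
      cases q with
      | cons q b => simp at hq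
      | nil => rfl
  | succ n ih =>
    have : ∀ z : V, Finite {p : Path x z | p.length = n} := fun z => (ih z).to_subtype
    refine (Set.finite_range
      (fun t : (Σ z : V, {p : Path x z | p.length = n} × (z ⟶ y)) =>
        (t.2.1.1.cons t.2.2 : Path x y))).subset ?_
    intro p hp
    cases p with
    | nil => simp at hp
    | cons q a => exact ⟨⟨_, ⟨q, by simpa using hp⟩, a⟩, rfl⟩

theorem finite_paths_length_lt [Finite V] [∀ x y : V, Finite (x ⟶ y)] (n : ℕ) (x y : V) :
    Finite {p : Path x y // p.length < n} := by
  have : {p : Path x y | p.length < n} = ⋃ i : Fin n, {p : Path x y | p.length = i} := by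
    ext p
    simp only [Set.mem_ofPred_eq, Set.mem_iUnion]
    exact ⟨fun h => ⟨⟨_, h⟩, rfl⟩, fun ⟨i, h⟩ => h ▸ i.2⟩
  exact Set.Finite.to_subtype
    (s := {p : Path x y | p.length < n}) (this ▸ Set.finite_iUnion fun i =>
      finite_paths_length i x y)

/-- A bound quiver algebra is finite dimensional. -/
instance boundQuiverAlgebra_finite [Fintype V] [∀ x y : V, Finite (x ⟶ y)]
    (I : Ideal (PathAlgebra k V)) [I.IsTwoSided] [hI : IsAdmissible I] :
    Module.Finite k (PathAlgebra k V ⧸ I) := by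
  obtain ⟨m, -, hm⟩ := hI.pow_le
  have := fun x y : V => finite_paths_length_lt m x y
  let F : (∀ x y : V, {p : Path x y // p.length < m} →₀ k) →ₗ[k] PathAlgebra k V :=
    { toFun := fun g x y => Finsupp.lmapDomain k k Subtype.val (g x y)
      map_add' := fun g h => PathAlgebra.ext' fun x y =>
        map_add (Finsupp.lmapDomain k k Subtype.val) (g x y) (h x y)
      map_smul' := fun c g => PathAlgebra.ext' fun x y =>
        map_smul (Finsupp.lmapDomain k k Subtype.val) c (g x y) }
  refine Module.Finite.of_surjective ((Ideal.Quotient.mkₐ k I).toLinearMap ∘ₗ F) fun a => ?_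
  obtain ⟨f, rfl⟩ := Ideal.Quotient.mk_surjective a
  refine ⟨fun x y => (f x y).subtypeDomain fun p => p.length < m, ?_⟩
  refine Ideal.Quotient.eq.2 (neg_mem_iff.1 (hm _ fun x y p hp => ?_))
  by_contra hlt
  refine hp ?_
  have hlt : p.length < m := not_le.1 hlt
  have key : Finsupp.mapDomain Subtype.val
      ((f x y).subtypeDomain fun p : Path x y => p.length < m) p = f x y p :=
    (Finsupp.mapDomain_apply Subtype.val_injective _ (⟨p, hlt⟩ : {p : Path x y // p.length < m}))
  have h2 : (-(F (fun x y => (f x y).subtypeDomain fun p => p.length < m) - f)) x y p =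
      -(Finsupp.mapDomain Subtype.val
        ((f x y).subtypeDomain fun p : Path x y => p.length < m) p - f x y p) := rfl
  exact h2.trans (by rw [key]; simp)

/-- A bound quiver algebra is right noetherian. -/
instance boundQuiverAlgebra_noetherian [Fintype V] [∀ x y : V, Finite (x ⟶ y)]
    (I : Ideal (PathAlgebra k V)) [I.IsTwoSided] [IsAdmissible I] :
    IsNoetherianRing (PathAlgebra k V ⧸ I)ᵐᵒᵖ :=
  isNoetherian_of_tower k inferInstance

end PathAlgebra

/-! ## Syzygies, the group `K₀` and the Igusa-Todorov function, for left modules over a ring -/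

section IgusaTodorov

variable {R : Type u} [Ring R]

/-- `N` is (isomorphic to) the syzygy `Ω(M)`, the kernel of a projective cover of `M`. -/
def IsSyzygy (M N : FGModuleCat.{u} R) : Prop :=
  ∃ (P : FGModuleCat.{u} R) (f : P →ₗ[R] M), Module.Projective R P ∧ Function.Surjective f ∧
    (∀ U : Submodule R P, U ⊔ LinearMap.ker f = ⊤ → U = ⊤) ∧
    Nonempty (N ≃ₗ[R] LinearMap.ker f)

/-- `N` is (isomorphic to) the iterated syzygy `Ωⁿ(M)`. -/
def IsIterSyzygy : ℕ → FGModuleCat.{u} R → FGModuleCat.{u} R → Prop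
  | 0, M, N => Nonempty (N ≃ₗ[R] M)
  | n + 1, M, N => ∃ L : FGModuleCat.{u} R, IsIterSyzygy n M L ∧ IsSyzygy L N

/-- `N` is (isomorphic to) a direct summand of `M`. -/
def IsSummand (N M : FGModuleCat.{u} R) : Prop :=
  ∃ N' : FGModuleCat.{u} R, Nonempty (M ≃ₗ[R] N × N')

/-- `M` is an indecomposable module. -/
def IsIndecomposable (M : FGModuleCat.{u} R) : Prop :=
  Nontrivial M ∧ ∀ X Y : FGModuleCat.{u} R, Nonempty (M ≃ₗ[R] X × Y) →
    Subsingleton X ∨ Subsingleton Y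

/-- `M` is the direct sum of all simple modules, one from each isomorphism class. -/
def IsSumOfSimples (M : FGModuleCat.{u} R) : Prop :=
  ∃ (n : ℕ) (S : Fin n → FGModuleCat.{u} R),
    (∀ i, IsSimpleModule R (S i)) ∧
    (∀ i j, Nonempty (S i ≃ₗ[R] S j) → i = j) ∧
    (∀ T : FGModuleCat.{u} R, IsSimpleModule R T → ∃ i, Nonempty (T ≃ₗ[R] S i)) ∧
    Nonempty (M ≃ₗ[R] ∀ i, S i)

variable (R) in
/-- The relations `[M] - [M'] - [M'']` for `M ≅ M' ⊕ M''` and `[P]` for `P` projective. -/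
def K0Rel : AddSubgroup (FreeAbelianGroup (FGModuleCat.{u} R)) :=
  AddSubgroup.closure
    ({x | ∃ M M' M'' : FGModuleCat.{u} R, Nonempty (M ≃ₗ[R] M' × M'') ∧
        x = FreeAbelianGroup.of M - FreeAbelianGroup.of M' - FreeAbelianGroup.of M''} ∪
      {x | ∃ P : FGModuleCat.{u} R, Module.Projective R P ∧ x = FreeAbelianGroup.of P})

variable (R) in
/-- The Igusa-Todorov group `K₀`. -/
abbrev K0 : Type (u + 1) := FreeAbelianGroup (FGModuleCat.{u} R) ⧸ K0Rel R

/-- The class `[M]` in `K₀`. -/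
def K0.mk (M : FGModuleCat.{u} R) : K0 R := QuotientAddGroup.mk (FreeAbelianGroup.of M)

theorem K0.mk_prod {M M' M'' : FGModuleCat.{u} R} (e : Nonempty (M ≃ₗ[R] M' × M'')) :
    K0.mk M = K0.mk M' + K0.mk M'' := by
  have h : FreeAbelianGroup.of M - FreeAbelianGroup.of M' - FreeAbelianGroup.of M'' ∈ K0Rel R :=
    AddSubgroup.subset_closure (Or.inl ⟨M, M', M'', e, rfl⟩)
  have h' := (QuotientAddGroup.eq_zero_iff _).2 h
  rw [QuotientAddGroup.mk_sub, QuotientAddGroup.mk_sub, sub_sub, sub_eq_zero] at h'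
  exact h'

theorem K0.mk_projective {P : FGModuleCat.{u} R} (hP : Module.Projective R P) :
    K0.mk P = 0 :=
  (QuotientAddGroup.eq_zero_iff _).2 (AddSubgroup.subset_closure (Or.inr ⟨P, hP, rfl⟩))

theorem K0.mk_congr {M N : FGModuleCat.{u} R} (e : M ≃ₗ[R] N) : K0.mk M = K0.mk N := by
  have h := K0.mk_prod (M := M) (M' := N) (M'' := FGModuleCat.of R PUnit.{u + 1})
    ⟨e.trans (LinearEquiv.prodUnique (R := R) (M := N) (M₂ := PUnit.{u + 1})).symm⟩
  rw [h, K0.mk_projective (P := FGModuleCat.of R PUnit.{u + 1})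
    (inferInstanceAs (Module.Projective R PUnit.{u + 1})), add_zero]

/-- Schanuel's lemma. -/
theorem schanuel {M P Q : Type u} [AddCommGroup M] [AddCommGroup P] [AddCommGroup Q]
    [Module R M] [Module R P] [Module R Q] [Module.Projective R P] [Module.Projective R Q]
    (f : P →ₗ[R] M) (g : Q →ₗ[R] M) (hf : Function.Surjective f) (hg : Function.Surjective g) :
    Nonempty ((LinearMap.ker f × Q) ≃ₗ[R] (LinearMap.ker g × P)) := by
  obtain ⟨s, hs⟩ := Module.projective_lifting_property g f hg
  obtain ⟨t, ht⟩ := Module.projective_lifting_property f g hf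
  have hs' : ∀ p, g (s p) = f p := fun p => LinearMap.congr_fun hs p
  have ht' : ∀ q, f (t q) = g q := fun q => LinearMap.congr_fun ht q
  -- both sides are isomorphic to the fibre product, via explicit mutually inverse formulas
  refine ⟨LinearEquiv.ofLinearMap
    (LinearMap.prod
      (LinearMap.codRestrict _
        (LinearMap.snd R _ _ - s ∘ₗ ((LinearMap.ker f).subtype ∘ₗ LinearMap.fst R _ _ +
          t ∘ₗ LinearMap.snd R _ _)) fun x => ?_)
      ((LinearMap.ker f).subtype ∘ₗ LinearMap.fst R _ _ + t ∘ₗ LinearMap.snd R _ _))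
    (LinearMap.prod
      (LinearMap.codRestrict _
        (LinearMap.snd R _ _ - t ∘ₗ ((LinearMap.ker g).subtype ∘ₗ LinearMap.fst R _ _ +
          s ∘ₗ LinearMap.snd R _ _)) fun x => ?_)
      ((LinearMap.ker g).subtype ∘ₗ LinearMap.fst R _ _ + s ∘ₗ LinearMap.snd R _ _)) ?_ ?_⟩
  · have h1 : f x.1 = 0 := x.1.2
    simp [LinearMap.mem_ker, hs', ht', h1]
  · have h1 : g x.1 = 0 := x.1.2
    simp [LinearMap.mem_ker, hs', ht', h1]
  · ext x <;> simp
  · ext x <;> simp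

section Omega

theorem exists_presentation (M : FGModuleCat.{u} R) :
    ∃ (P : FGModuleCat.{u} R) (f : P →ₗ[R] M), Module.Projective R P ∧ Function.Surjective f := by
  obtain ⟨n, f, hf⟩ := Module.Finite.exists_fin' R M
  exact ⟨FGModuleCat.of R (Fin n → R), f, inferInstanceAs (Module.Projective R (Fin n → R)), hf⟩

variable [IsNoetherianRing R]

/-- The kernel of a map between finitely generated modules. -/
def kerFG {P M : FGModuleCat.{u} R} (f : P →ₗ[R] M) : FGModuleCat.{u} R :=
  FGModuleCat.of R (LinearMap.ker f)

/-- The class of the kernel of a projective presentation depends only on the module. -/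
theorem K0.mk_ker_eq {P Q M : FGModuleCat.{u} R} (hP : Module.Projective R P)
    (hQ : Module.Projective R Q) (f : P →ₗ[R] M) (g : Q →ₗ[R] M) (hf : Function.Surjective f)
    (hg : Function.Surjective g) : K0.mk (kerFG f) = K0.mk (kerFG g) := by
  obtain ⟨e⟩ := schanuel f g hf hg
  have h1 := K0.mk_prod (M := FGModuleCat.of R (LinearMap.ker f × Q)) (M' := kerFG f) (M'' := Q)
    ⟨LinearEquiv.refl _ _⟩
  have h2 := K0.mk_prod (M := FGModuleCat.of R (LinearMap.ker f × Q)) (M' := kerFG g) (M'' := P)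
    ⟨e⟩
  rw [K0.mk_projective hQ, add_zero] at h1
  rw [K0.mk_projective hP, add_zero] at h2
  exact h1.symm.trans h2

/-- The class in `K₀` of the kernel of a projective presentation of `M`. -/
noncomputable def omegaClass (M : FGModuleCat.{u} R) : K0 R :=
  K0.mk (kerFG (exists_presentation M).choose_spec.choose)

theorem omegaClass_eq {P M : FGModuleCat.{u} R} (hP : Module.Projective R P) (f : P →ₗ[R] M)
    (hf : Function.Surjective f) : omegaClass M = K0.mk (kerFG f) :=
  K0.mk_ker_eq (exists_presentation M).choose_spec.choose_spec.1 hP _ f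
    (exists_presentation M).choose_spec.choose_spec.2 hf

theorem omegaClass_prod {M M' M'' : FGModuleCat.{u} R} (e : M ≃ₗ[R] M' × M'') :
    omegaClass M = omegaClass M' + omegaClass M'' := by
  obtain ⟨P, f, hP, hf⟩ := exists_presentation M'
  obtain ⟨Q, g, hQ, hg⟩ := exists_presentation M''
  let F : FGModuleCat.of R (P × Q) →ₗ[R] M := e.symm.toLinearMap ∘ₗ f.prodMap g
  have hF : Function.Surjective F := e.symm.surjective.comp (Function.Surjective.prodMap hf hg)
  rw [omegaClass_eq hP f hf, omegaClass_eq hQ g hg,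
    omegaClass_eq (P := FGModuleCat.of R (P × Q))
      (inferInstanceAs (Module.Projective R (P × Q))) F hF]
  refine K0.mk_prod ⟨?_⟩
  have h : LinearMap.ker F = (LinearMap.ker f).prod (LinearMap.ker g) := by
    ext x
    simp [F, LinearMap.mem_ker]
  refine (LinearEquiv.ofEq _ _ h).trans
    { toFun := fun x => (⟨x.1.1, x.2.1⟩, ⟨x.1.2, x.2.2⟩)
      invFun := fun y => ⟨(y.1.1, y.2.1), y.1.2, y.2.2⟩
      map_add' := fun _ _ => rfl
      map_smul' := fun _ _ => rfl
      left_inv := fun _ => rfl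
      right_inv := fun _ => rfl }

variable (R) in
/-- The endomorphism `Ω̄` of `K₀` with `Ω̄[M] = [Ω(M)]`, see `omegaBar_of_isSyzygy`. As projective
modules vanish in `K₀`, any projective presentation of `M` may be used to compute it. -/
noncomputable def omegaBar : K0 R →+ K0 R :=
  QuotientAddGroup.lift (K0Rel R) (FreeAbelianGroup.lift omegaClass) <| by
    refine (AddSubgroup.closure_le _).2 ?_
    rintro x (⟨M, M', M'', ⟨e⟩, rfl⟩ | ⟨P, hP, rfl⟩)
    · show FreeAbelianGroup.lift omegaClass _ = 0
      rw [map_sub, map_sub, FreeAbelianGroup.lift_apply_of, FreeAbelianGroup.lift_apply_of,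
        FreeAbelianGroup.lift_apply_of, omegaClass_prod e]
      abel
    · show FreeAbelianGroup.lift omegaClass _ = 0
      rw [FreeAbelianGroup.lift_apply_of,
        omegaClass_eq hP (LinearMap.id : P →ₗ[R] P) Function.surjective_id]
      refine K0.mk_projective ?_
      have : Subsingleton (LinearMap.ker (LinearMap.id : P →ₗ[R] P)) := by
        rw [LinearMap.ker_id]; infer_instance
      exact Module.Projective.of_free (R := R) (P := LinearMap.ker (LinearMap.id : P →ₗ[R] P))

theorem omegaBar_of_isSyzygy {M N : FGModuleCat.{u} R} (h : IsSyzygy M N) :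
    omegaBar R (K0.mk M) = K0.mk N := by
  obtain ⟨P, f, hP, hf, -, ⟨e⟩⟩ := h
  have h1 : omegaBar R (K0.mk M) = omegaClass M := FreeAbelianGroup.lift_apply_of _ _
  rw [h1, omegaClass_eq hP f hf]
  exact (K0.mk_congr (M := N) (N := kerFG f) e).symm

/-- `η_f(X)`: the least `k` such that `f` restricted to `f ^ m (X)` is injective for all `m ≥ k`
(and `⊤` if there is no such `k`). -/
noncomputable def eta {G : Type*} [AddCommGroup G] (f : G →+ G) (X : AddSubgroup G) : ℕ∞ :=
  ⨅ (k : ℕ) (_ : ∀ m : ℕ, k ≤ m → Set.InjOn f (f^[m] '' (X : Set G))), (k : ℕ∞)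

/-- `⟨add M⟩`: the subgroup of `K₀` generated by the classes of the indecomposable direct summands
of `M`. -/
def addSpan (M : FGModuleCat.{u} R) : AddSubgroup (K0 R) :=
  AddSubgroup.closure {x | ∃ N : FGModuleCat.{u} R, IsIndecomposable N ∧ IsSummand N M ∧
    x = K0.mk N}

/-- The Igusa-Todorov function `φ`. -/
noncomputable def igusaTodorovPhi (M : FGModuleCat.{u} R) : ℕ∞ := eta (omegaBar R) (addSpan M)

variable (R) in
/-- The `φ`-dimension, the supremum of `φ(M)` over the finitely generated left `R`-modules `M`. -/
noncomputable def phiDim : ℕ∞ := ⨆ M : FGModuleCat.{u} R, igusaTodorovPhi M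

/-- A subgroup `G` of `K₀` is syzygy finite if `Ω̄ⁿ(G)` is finitely generated for some `n ≥ 0`. -/
def SyzygyFinite (G : AddSubgroup (K0 R)) : Prop :=
  ∃ n : ℕ, ((AddSubgroup.map (omegaBar R))^[n] G).FG

end Omega

end IgusaTodorov

/-! ## The glued quiver and the square algebra -/

section Glue

open Quiver

/-- The vertices of the quiver obtained from two quivers by adding the arrows `X v w` from the
vertex `v` of the first to the vertex `w` of the second quiver, and the arrows `Y w v` back. -/
inductive Glue {VA VB : Type u} (X : VA → VB → Type u) (Y : VB → VA → Type u) : Type u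
  | inA (v : VA) : Glue X Y
  | inB (w : VB) : Glue X Y

variable {VA VB : Type u} [Quiver.{u} VA] [Quiver.{u} VB]
  {X : VA → VB → Type u} {Y : VB → VA → Type u}

namespace Glue

instance : Quiver.{u} (Glue X Y) where
  Hom
    | inA v, inA v' => v ⟶ v'
    | inA v, inB w => X v w
    | inB w, inA v => Y w v
    | inB w, inB w' => w ⟶ w'

/-- The vertex set is the disjoint union. -/
def equivSum : Glue X Y ≃ VA ⊕ VB where
  toFun
    | inA v => Sum.inl v
    | inB w => Sum.inr w
  invFun
    | Sum.inl v => inA v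
    | Sum.inr w => inB w
  left_inv s := by cases s <;> rfl
  right_inv s := by cases s <;> rfl

instance [Fintype VA] [Fintype VB] : Fintype (Glue X Y) := Fintype.ofEquiv _ equivSum.symm

instance [∀ v v' : VA, Finite (v ⟶ v')] [∀ w w' : VB, Finite (w ⟶ w')]
    [∀ v w, Finite (X v w)] [∀ w v, Finite (Y w v)] : ∀ s t : Glue X Y, Finite (s ⟶ t)
  | inA v, inA v' => inferInstanceAs (Finite (v ⟶ v'))
  | inA v, inB w => inferInstanceAs (Finite (X v w))
  | inB w, inA v => inferInstanceAs (Finite (Y w v))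
  | inB w, inB w' => inferInstanceAs (Finite (w ⟶ w'))

variable (X Y) in
/-- The inclusion of the first quiver. -/
def quiverA : VA ⥤q Glue X Y where
  obj := inA
  map a := a

variable (X Y) in
/-- The inclusion of the second quiver. -/
def quiverB : VB ⥤q Glue X Y where
  obj := inB
  map a := a

/-- A connecting arrow `α` from the first to the second quiver. -/
def alpha {v : VA} {w : VB} (a : X v w) : (inA v : Glue X Y) ⟶ inB w := a

/-- A connecting arrow `β` from the second to the first quiver. -/
def beta {w : VB} {v : VA} (b : Y w v) : (inB w : Glue X Y) ⟶ inA v := b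

variable (k : Type u) [Field k]

variable (X Y) in
/-- A path of `Q_A`, as a path of `Γ`. -/
def pathA {v v' : VA} (p : Path v v') : Path (inA v : Glue X Y) (inA v') :=
  (quiverA X Y).mapPath p

variable (X Y) in
/-- A path of `Q_B`, as a path of `Γ`. -/
def pathB {w w' : VB} (p : Path w w') : Path (inB w : Glue X Y) (inB w') :=
  (quiverB X Y).mapPath p

variable (X Y) in
/-- The inclusion `kQ_A → kΓ`. -/
noncomputable def inclA : PathAlgebra k VA →ₗ[k] PathAlgebra k (Glue X Y) where
  toFun f
    | inA v, inA v' => Finsupp.mapDomain (pathA X Y) (f v v')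
    | inA _, inB _ => 0
    | inB _, inA _ => 0
    | inB _, inB _ => 0
  map_add' f g := PathAlgebra.ext' fun
    | inA v, inA v' => Finsupp.mapDomain_add (f := pathA X Y) (v₁ := f v v') (v₂ := g v v')
    | inA v, inB w => (add_zero (0 : Path (inA v : Glue X Y) (inB w) →₀ k)).symm
    | inB w, inA v => (add_zero (0 : Path (inB w : Glue X Y) (inA v) →₀ k)).symm
    | inB w, inB w' => (add_zero (0 : Path (inB w : Glue X Y) (inB w') →₀ k)).symm
  map_smul' c f := PathAlgebra.ext' fun
    | inA v, inA v' => Finsupp.mapDomain_smul c (f v v')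
    | inA v, inB w => (smul_zero (A := Path (inA v : Glue X Y) (inB w) →₀ k) c).symm
    | inB w, inA v => (smul_zero (A := Path (inB w : Glue X Y) (inA v) →₀ k) c).symm
    | inB w, inB w' => (smul_zero (A := Path (inB w : Glue X Y) (inB w') →₀ k) c).symm

variable (X Y) in
/-- The inclusion `kQ_B → kΓ`. -/
noncomputable def inclB : PathAlgebra k VB →ₗ[k] PathAlgebra k (Glue X Y) where
  toFun f
    | inA _, inA _ => 0
    | inA _, inB _ => 0
    | inB _, inA _ => 0
    | inB w, inB w' => Finsupp.mapDomain (pathB X Y) (f w w')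
  map_add' f g := PathAlgebra.ext' fun
    | inA v, inA v' => (add_zero (0 : Path (inA v : Glue X Y) (inA v') →₀ k)).symm
    | inA v, inB w => (add_zero (0 : Path (inA v : Glue X Y) (inB w) →₀ k)).symm
    | inB w, inA v => (add_zero (0 : Path (inB w : Glue X Y) (inA v) →₀ k)).symm
    | inB w, inB w' => Finsupp.mapDomain_add (f := pathB X Y) (v₁ := f w w') (v₂ := g w w')
  map_smul' c f := PathAlgebra.ext' fun
    | inA v, inA v' => (smul_zero (A := Path (inA v : Glue X Y) (inA v') →₀ k) c).symm
    | inA v, inB w => (smul_zero (A := Path (inA v : Glue X Y) (inB w) →₀ k) c).symm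
    | inB w, inA v => (smul_zero (A := Path (inB w : Glue X Y) (inA v) →₀ k) c).symm
    | inB w, inB w' => Finsupp.mapDomain_smul c (f w w')

end Glue

variable {k : Type u} [Field k] [Fintype VA] [Fintype VB]

open Glue PathAlgebra in
/-- The conditions on the ideal `I_C` of `kΓ`: it contains `I_A`, `I_B` and the products `αα_j`,
`ββ_k`, `α_jβ_k`, `β_kα_j` (with `α`, `β` arrows of `Q_A`, `Q_B` and `α_j`, `β_k` connecting
arrows), and it meets `kQ_A` and `kQ_B` in `I_A` and `I_B`, so that `A` and `B` are the diagonal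
corners of `C`. -/
structure IsSquareIdeal (IA : Ideal (PathAlgebra k VA)) (IB : Ideal (PathAlgebra k VB))
    (IC : Ideal (PathAlgebra k (Glue X Y))) : Prop where
  mem_A : ∀ f, inclA X Y k f ∈ IC ↔ f ∈ IA
  mem_B : ∀ f, inclB X Y k f ∈ IC ↔ f ∈ IB
  arrow_alpha : ∀ {v v' : VA} {w : VB} (a : v ⟶ v') (x : X v' w),
    ofArrow k ((quiverA X Y).map a) * ofArrow k (alpha x) ∈ IC
  arrow_beta : ∀ {w w' : VB} {v : VA} (b : w ⟶ w') (y : Y w' v),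
    ofArrow k ((quiverB X Y).map b) * ofArrow k (beta y) ∈ IC
  alpha_beta : ∀ {v v' : VA} {w : VB} (x : X v w) (y : Y w v'),
    ofArrow k (alpha (Y := Y) x) * ofArrow k (beta y) ∈ IC
  beta_alpha : ∀ {w w' : VB} {v : VA} (y : Y w v) (x : X v w'),
    ofArrow k (beta (X := X) y) * ofArrow k (alpha x) ∈ IC

end Glue

/-! ## Restriction to a corner, extension by zero, and the subgroup `𝒪` -/

section Orbits

open MulOpposite

variable {S A S' B C : Type u} [Ring S] [Ring A] [Ring S'] [Ring B] [Ring C]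

/-- `N ≅ Π(M)` for a right `C`-module `M`: here `A` is a quotient of `S` by `π`, the map
`θ : S → C` is additive (and multiplicative, but not unital, in the application, with `θ 1 = e` the
idempotent of `A`), and `Π(M) = Me` with `A` acting through `θ`. For bound quiver algebras this is
the restriction of representations. -/
def IsRestriction (π : S →+* A) (θ : S →+ C) (M : FGModuleCat.{u} Cᵐᵒᵖ)
    (N : FGModuleCat.{u} Aᵐᵒᵖ) : Prop :=
  ∃ f : N →+ M, Function.Injective f ∧ Set.range f = {x : M | op (θ 1) • x = x} ∧
    ∀ (a : S) (n : N), f (op (π a) • n) = op (θ a) • f n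

/-- `M` is the `A`-module `N` viewed as a `C`-module: `N ≅ Π(M)` and `Me = M`. -/
def IsExtensionByZero (π : S →+* A) (θ : S →+ C) (N : FGModuleCat.{u} Aᵐᵒᵖ)
    (M : FGModuleCat.{u} Cᵐᵒᵖ) : Prop :=
  IsRestriction π θ M N ∧ ∀ x : M, op (θ 1) • x = x

/-- The classes in `K₀(C)` of the modules in `add Orb_{Ω_A}(Π_A(Ω_C(B₀)))`: direct summands `N` of
some `W = Ω_Aⁿ(Π_A(Ω_C(B₀)))`, where `B₀` is the sum of all simple `B`-modules. -/
def orbitClasses (πA : S →+* A) (θA : S →+ C) (πB : S' →+* B) (θB : S' →+ C) :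
    Set (K0 Cᵐᵒᵖ) :=
  {x | ∃ (B₀ : FGModuleCat.{u} Bᵐᵒᵖ) (B₀' U : FGModuleCat.{u} Cᵐᵒᵖ)
      (Z W N : FGModuleCat.{u} Aᵐᵒᵖ) (N' : FGModuleCat.{u} Cᵐᵒᵖ) (n : ℕ),
    IsSumOfSimples B₀ ∧ IsExtensionByZero πB θB B₀ B₀' ∧ IsSyzygy B₀' U ∧
    IsRestriction πA θA U Z ∧ IsIterSyzygy n Z W ∧ IsSummand N W ∧
    IsExtensionByZero πA θA N N' ∧ x = K0.mk N'}

end Orbits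

section SquareAlgebra

variable {k : Type u} [Field k] {VA VB : Type u} [Quiver.{u} VA] [Quiver.{u} VB]
  [Fintype VA] [Fintype VB] {X : VA → VB → Type u} {Y : VB → VA → Type u}

/-- The map `kQ_A → C`. -/
noncomputable def cornerA (IC : Ideal (PathAlgebra k (Glue X Y))) [IC.IsTwoSided] :
    PathAlgebra k VA →+ PathAlgebra k (Glue X Y) ⧸ IC :=
  (Ideal.Quotient.mk IC).toAddMonoidHom.comp (Glue.inclA X Y k).toAddMonoidHom

/-- The map `kQ_B → C`. -/
noncomputable def cornerB (IC : Ideal (PathAlgebra k (Glue X Y))) [IC.IsTwoSided] :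
    PathAlgebra k VB →+ PathAlgebra k (Glue X Y) ⧸ IC :=
  (Ideal.Quotient.mk IC).toAddMonoidHom.comp (Glue.inclB X Y k).toAddMonoidHom

/-- The subgroup `𝒪` of `K₀(C)` generated by `add Orb_{Ω_A}(Π_A(Ω_C(B₀)))` and
`add Orb_{Ω_B}(Π_B(Ω_C(A₀)))`. -/
noncomputable def orbitSubgroup (IA : Ideal (PathAlgebra k VA)) [IA.IsTwoSided]
    (IB : Ideal (PathAlgebra k VB)) [IB.IsTwoSided] (IC : Ideal (PathAlgebra k (Glue X Y)))
    [IC.IsTwoSided] : AddSubgroup (K0 (PathAlgebra k (Glue X Y) ⧸ IC)ᵐᵒᵖ) :=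
  AddSubgroup.closure
    (orbitClasses (Ideal.Quotient.mk IA) (cornerA IC) (Ideal.Quotient.mk IB) (cornerB IC) ∪
      orbitClasses (Ideal.Quotient.mk IB) (cornerB IC) (Ideal.Quotient.mk IA) (cornerA IC))

end SquareAlgebra

/-!
The algebra `C` is a ring with two complementary corners `A` and `B` such that every path of
positive length followed by a crossing between the two quivers vanishes. In terms of left modules
over the opposite rings (`IsSquareRing`), the off-diagonal parts of the ring kill the radical of
every module. Hence every submodule of the radical of a module, in particular every syzygy, is the
direct sum of an `A`-module and a `B`-module (`IsSquareRing.exists_omegaBar_eq`). For an `A`-module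
`X` this gives `Ω_C(X) = Ω_A(X) ⊕ Π_B(P)`, where `P` is the projective cover of `X` over `C`
(`IsSquareRing.exists_isSyzygy_infl`).

Let `E ⊆ K₀(C)` be generated by the classes of all `Ω_A^t(Π_A(P_w))` and `Ω_B^t(Π_B(P_v))`, with `w`
a vertex of `B`, `v` a vertex of `A` and `P` the projective `C`-modules at these vertices
(`orbitSpan`). These modules are direct summands of the modules that define `𝒪`, so `E ⊆ 𝒪`. Up to
finitely many elements, `E` is generated by its image under `Ω̄_C`; as `𝒪` is syzygy finite, `E` is
finitely generated (`IsSquareRing.fg_orbitSpan`). It is also stable under `Ω̄_C`, so `η(E)` is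
finite, and it is one of the terms of the supremum in the theorem.

Modulo `E`, the endomorphism `Ω̄_C` acts on `A`-modules as `Ω̄_A` does. Restriction to `A` does not
kill all projective modules, but it is well defined as a map from `K₀(C)` to the quotient of `K₀(A)`
by the subgroup `E_A` of the classes of `Ω_A^t(Π_A(P_w))` (`resHom`). So if `Ω̄_C^m y = 0` and
`Ω̄_C y = a + b` with parts `a` and `b` from `A` and `B`, then `Ω̄_A^m a` lies in `E_A`. This subgroup
is finitely generated and stable under `Ω̄_A`, whose restriction to it satisfies a monic polynomial
by the Cayley-Hamilton theorem. With `n = φdim A`, so that elements killed by some power of `Ω̄_A` are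
killed by the `n`-th, it follows that a nonzero multiple of `Ω̄_A^n a` already lies in `E_A`
(`exists_zsmul_iterate_mem`). A further syzygy is well defined as a map from `K₀(A)` to `K₀(C) / E`
(`omegaInfl`) and brings this back to `C`. The same applies to `b`, and altogether a nonzero
multiple of `Ω̄_C^(n + 2) y` lies in `E`, for `n = max (φdim A) (φdim B)`. After `η(E)` more steps
`Ω̄_C` is injective there. Finally `K₀(C)` is torsion free by the Krull-Schmidt theorem
(`K0.eq_zero_of_smul_eq_zero`), so the multiple does not matter.
-/

/-! ### The group `K₀` and the function `η` -/

section K0General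

variable {R : Type u} [Ring R]

theorem K0.mk_of_prod (M N : FGModuleCat.{u} R) :
    K0.mk (FGModuleCat.of R (M × N)) = K0.mk M + K0.mk N :=
  K0.mk_prod ⟨LinearEquiv.refl _ _⟩

theorem K0.mk_of_subsingleton (M : FGModuleCat.{u} R) [Subsingleton M] : K0.mk M = 0 :=
  K0.mk_projective (Module.Projective.of_free (R := R) (P := M))

/-- A function on modules that is additive on direct sums of two modules is additive on finite
products. -/
theorem map_pi_of_additive {G : Type*} [AddCommGroup G] (F : FGModuleCat.{u} R → G)
    (hF : ∀ M M' M'' : FGModuleCat.{u} R, Nonempty (M ≃ₗ[R] M' × M'') → F M = F M' + F M'')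
    {n : ℕ} (M : Fin n → FGModuleCat.{u} R) :
    F (FGModuleCat.of R (∀ i, M i)) = ∑ i, F (M i) := by
  induction n with
  | zero =>
    rw [Finset.univ_eq_empty, Finset.sum_empty]
    have : Unique (FGModuleCat.of R (∀ i, M i)) := inferInstanceAs (Unique (∀ i, M i))
    have := hF (FGModuleCat.of R (∀ i, M i)) (FGModuleCat.of R (∀ i, M i))
      (FGModuleCat.of R (∀ i, M i)) ⟨(LinearEquiv.prodUnique (R := R)).symm⟩
    rwa [left_eq_add] at this
  | succ n ih =>
    rw [Fin.sum_univ_succ, ← ih]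
    exact hF _ _ (FGModuleCat.of R (∀ i : Fin n, M i.succ))
      ⟨(Fin.consLinearEquiv R fun i => M i).symm⟩

theorem K0.exists_eq_sub (x : K0 R) : ∃ M M' : FGModuleCat.{u} R, x = K0.mk M - K0.mk M' := by
  obtain ⟨x, rfl⟩ := QuotientAddGroup.mk_surjective x
  have h0 : K0.mk (FGModuleCat.of R PUnit.{u + 1}) = 0 :=
    have : Subsingleton (FGModuleCat.of R PUnit.{u + 1}) :=
      inferInstanceAs (Subsingleton PUnit.{u + 1})
    K0.mk_of_subsingleton _
  induction x using FreeAbelianGroup.induction_on with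
  | zero => exact ⟨FGModuleCat.of R PUnit, FGModuleCat.of R PUnit, by simp⟩
  | of M => exact ⟨M, FGModuleCat.of R PUnit, by rw [h0, sub_zero]; rfl⟩
  | neg M _ => exact ⟨FGModuleCat.of R PUnit, M, by rw [h0, zero_sub]; rfl⟩
  | add x y hx hy =>
    obtain ⟨M, M', h⟩ := hx
    obtain ⟨N, N', h'⟩ := hy
    refine ⟨FGModuleCat.of R (M × N), FGModuleCat.of R (M' × N'), ?_⟩
    rw [QuotientAddGroup.mk_add, h, h', K0.mk_of_prod, K0.mk_of_prod]
    abel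

/-- The homomorphism out of `K₀` induced by a function on modules which is additive on direct sums
and kills projective modules. -/
def K0.lift {G : Type*} [AddCommGroup G] (F : FGModuleCat.{u} R → G)
    (hprod : ∀ M M' M'' : FGModuleCat.{u} R, Nonempty (M ≃ₗ[R] M' × M'') → F M = F M' + F M'')
    (hproj : ∀ P : FGModuleCat.{u} R, Module.Projective R P → F P = 0) : K0 R →+ G :=
  QuotientAddGroup.lift (K0Rel R) (FreeAbelianGroup.lift F) <| by
    refine (AddSubgroup.closure_le _).2 ?_
    rintro x (⟨M, M', M'', e, rfl⟩ | ⟨P, hP, rfl⟩)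
    · show FreeAbelianGroup.lift F _ = 0
      rw [map_sub, map_sub, FreeAbelianGroup.lift_apply_of, FreeAbelianGroup.lift_apply_of,
        FreeAbelianGroup.lift_apply_of, hprod _ _ _ e]
      abel
    · show FreeAbelianGroup.lift F _ = 0
      rw [FreeAbelianGroup.lift_apply_of, hproj P hP]

theorem K0.lift_mk {G : Type*} [AddCommGroup G] (F : FGModuleCat.{u} R → G)
    (hprod : ∀ M M' M'' : FGModuleCat.{u} R, Nonempty (M ≃ₗ[R] M' × M'') → F M = F M' + F M'')
    (hproj : ∀ P : FGModuleCat.{u} R, Module.Projective R P → F P = 0) (M : FGModuleCat.{u} R) :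
    K0.lift F hprod hproj (K0.mk M) = F M :=
  FreeAbelianGroup.lift_apply_of _ _

end K0General

section Eta

variable {G : Type*} [AddCommGroup G] (f : G →+ G) (X : AddSubgroup G)

theorem eta_le_iff (n : ℕ) :
    eta f X ≤ n ↔ ∀ m : ℕ, n ≤ m → ∀ x ∈ X, f^[m + 1] x = 0 → f^[m] x = 0 := by
  have key : ∀ m : ℕ, Set.InjOn f (f^[m] '' (X : Set G)) ↔
      ∀ x ∈ X, f^[m + 1] x = 0 → f^[m] x = 0 := by
    intro m
    constructor
    · intro h x hx h0
      refine h ⟨x, hx, rfl⟩ ⟨0, X.zero_mem, iterate_map_zero f m⟩ ?_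
      rw [← Function.iterate_succ_apply' f m x, h0, map_zero]
    · rintro h _ ⟨x, hx, rfl⟩ _ ⟨y, hy, rfl⟩ hxy
      rw [← sub_eq_zero, ← iterate_map_sub]
      refine h _ (X.sub_mem hx hy) ?_
      rw [iterate_map_sub, Function.iterate_succ_apply', Function.iterate_succ_apply', hxy,
        sub_self]
  simp only [← key]
  constructor
  · intro h
    by_contra hcon
    push Not at hcon
    obtain ⟨m, hnm, hm⟩ := hcon
    have : ((n + 1 : ℕ) : ℕ∞) ≤ eta f X := by
      refine le_iInf₂ fun k hk => ?_
      have : ¬ k ≤ m := fun hkm => hm (hk m hkm)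
      exact_mod_cast (by omega : n + 1 ≤ k)
    have := this.trans h
    have : n + 1 ≤ n := by exact_mod_cast this
    omega
  · exact fun h => iInf₂_le n h

/-- An endomorphism that maps a finitely generated subgroup to itself has finite `η` there: the
kernels of its powers on this subgroup form an ascending chain in a noetherian `ℤ`-module. -/
theorem eta_lt_top (hX : X.FG) (hf : ∀ x ∈ X, f x ∈ X) : eta f X < ⊤ := by
  have : Module.Finite ℤ X :=
    Module.Finite.iff_addGroup_fg.2 ((AddGroup.fg_iff_addSubgroup_fg X).2 hX)
  let F : Module.End ℤ X := ((f.comp X.subtype).codRestrict X fun x => hf x x.2).toIntLinearMap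
  have hF : ∀ (m : ℕ) (x : X), ((F ^ m) x : G) = f^[m] x := by
    intro m x
    induction m with
    | zero => rfl
    | succ m ih => rw [pow_succ', Function.iterate_succ_apply', ← ih]; rfl
  obtain ⟨n, hn⟩ := monotone_stabilizes_iff_noetherian.2 (inferInstanceAs (IsNoetherian ℤ X))
    F.iterateKer
  refine lt_of_le_of_lt ((eta_le_iff f X n).2 fun m hm x hx h0 => ?_) (ENat.natCast_lt_top n)
  have h1 : (⟨x, hx⟩ : X) ∈ LinearMap.ker (F ^ (m + 1)) := by
    rw [LinearMap.mem_ker]; exact Subtype.ext ((hF _ _).trans h0)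
  have h2 : LinearMap.ker (F ^ (m + 1)) = LinearMap.ker (F ^ m) :=
    (hn (m + 1) (by omega)).symm.trans (hn m hm)
  rw [h2, LinearMap.mem_ker] at h1
  rw [← hF m ⟨x, hx⟩, h1]; rfl

end Eta

section Decomposition

/-- A retract is complemented by the kernel of the retraction. -/
def prodKerEquiv {R M N : Type*} [Ring R] [AddCommGroup M] [AddCommGroup N] [Module R M]
    [Module R N] (i : N →ₗ[R] M) (p : M →ₗ[R] N) (h : ∀ x, p (i x) = x) :
    M ≃ₗ[R] N × LinearMap.ker p :=
  LinearEquiv.ofLinearMap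
    (LinearMap.prod p (LinearMap.codRestrict _ (LinearMap.id - i ∘ₗ p) fun x => by simp [h]))
    (LinearMap.coprod i (LinearMap.ker p).subtype)
    (by
      refine LinearMap.ext fun x => ?_
      have h2 : p x.2 = 0 := x.2.2
      exact Prod.ext (by simp [h]) (Subtype.ext (by simp [h])))
    (by ext x; simp)

variable {R : Type u} [Ring R]

theorem IsSummand.refl (M : FGModuleCat.{u} R) : IsSummand M M :=
  ⟨FGModuleCat.of R PUnit.{u + 1}, ⟨(LinearEquiv.prodUnique (R := R) (M := M)
    (M₂ := PUnit.{u + 1})).symm⟩⟩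

theorem IsSummand.trans {M N L : FGModuleCat.{u} R} (h : IsSummand M N) (h' : IsSummand N L) :
    IsSummand M L := by
  obtain ⟨M', ⟨e⟩⟩ := h
  obtain ⟨N', ⟨e'⟩⟩ := h'
  exact ⟨FGModuleCat.of R (M' × N'),
    ⟨e'.trans ((e.prodCongr (LinearEquiv.refl R N')).trans (LinearEquiv.prodAssoc R M M' N'))⟩⟩

theorem isSummand_left {M N L : FGModuleCat.{u} R} (e : L ≃ₗ[R] M × N) : IsSummand M L := ⟨N, ⟨e⟩⟩

theorem isSummand_right {M N L : FGModuleCat.{u} R} (e : L ≃ₗ[R] M × N) : IsSummand N L :=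
  ⟨M, ⟨e.trans (LinearEquiv.prodComm R M N)⟩⟩

variable [IsNoetherianRing R]

theorem isSummand_of_leftInverse {M N : FGModuleCat.{u} R} (i : N →ₗ[R] M) (p : M →ₗ[R] N)
    (h : ∀ x, p (i x) = x) : IsSummand N M :=
  ⟨kerFG p, ⟨prodKerEquiv i p h⟩⟩

variable [IsArtinianRing R]

theorem FGModuleCat.length_ne_top (M : FGModuleCat.{u} R) : Module.length R M ≠ ⊤ :=
  Module.length_ne_top

/-- By induction on the length, every module is a direct sum of indecomposable modules. -/
theorem mk_mem_addSpan {M L : FGModuleCat.{u} R} (h : IsSummand M L) : K0.mk M ∈ addSpan L := by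
  obtain ⟨n, hn⟩ := ENat.ne_top_iff_exists.1 M.length_ne_top
  induction n using Nat.strong_induction_on generalizing M with
  | _ n ih =>
    by_cases hi : IsIndecomposable M
    · exact AddSubgroup.subset_closure ⟨M, hi, h, rfl⟩
    rcases subsingleton_or_nontrivial M with h0 | h0
    · rw [K0.mk_of_subsingleton M]; exact zero_mem _
    simp only [IsIndecomposable, h0, true_and, not_forall, not_or,
      not_subsingleton_iff_nontrivial] at hi
    obtain ⟨X, Y, ⟨e⟩, hX, hY⟩ := hi
    rw [K0.mk_prod ⟨e⟩]
    have hlen : Module.length R X + Module.length R Y = n := by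
      rw [hn, e.length_eq, Module.length_prod]
    obtain ⟨a, ha⟩ := ENat.ne_top_iff_exists.1 X.length_ne_top
    obtain ⟨b, hb⟩ := ENat.ne_top_iff_exists.1 Y.length_ne_top
    have ha0 : 0 < Module.length R X := Module.length_pos
    have hb0 : 0 < Module.length R Y := Module.length_pos
    rw [← ha] at ha0 hlen
    rw [← hb] at hb0 hlen
    norm_cast at ha0 hb0 hlen
    exact add_mem (ih a (by omega) ((isSummand_left e).trans h) ha)
      (ih b (by omega) ((isSummand_right e).trans h) hb)

/-- `φdim R ≤ n` means that `Ω̄` is injective on the whole of `Ω̄ ^ m (K₀)` for all `m ≥ n`. -/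
theorem phiDim_le_iff (n : ℕ) : phiDim R ≤ n ↔
    ∀ m : ℕ, n ≤ m → ∀ x : K0 R, (omegaBar R)^[m + 1] x = 0 → (omegaBar R)^[m] x = 0 := by
  constructor
  · intro h m hm x hx
    obtain ⟨M, M', rfl⟩ := K0.exists_eq_sub x
    have h1 : igusaTodorovPhi (FGModuleCat.of R (M × M')) ≤ n :=
      (le_iSup igusaTodorovPhi (FGModuleCat.of R (M × M'))).trans h
    refine (eta_le_iff _ _ n).1 h1 m hm _ (sub_mem ?_ ?_) hx
    · exact mk_mem_addSpan (isSummand_left (LinearEquiv.refl R _))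
    · exact mk_mem_addSpan (isSummand_right (LinearEquiv.refl R _))
  · exact fun h => iSup_le fun M => (eta_le_iff _ _ n).2 fun m hm x _ => h m hm x

theorem K0.closure_indecomposable :
    AddSubgroup.closure {x : K0 R | ∃ N, IsIndecomposable N ∧ x = K0.mk N} = ⊤ := by
  refine eq_top_iff.2 fun x _ => ?_
  obtain ⟨M, M', rfl⟩ := K0.exists_eq_sub x
  have : ∀ M : FGModuleCat.{u} R, addSpan M ≤
      AddSubgroup.closure {x : K0 R | ∃ N, IsIndecomposable N ∧ x = K0.mk N} := fun M =>
    AddSubgroup.closure_mono fun x ⟨N, hN, _, h⟩ => ⟨N, hN, h⟩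
  exact sub_mem (this M (mk_mem_addSpan (IsSummand.refl M)))
    (this M' (mk_mem_addSpan (IsSummand.refl M')))

end Decomposition

/-! ### The Krull-Schmidt theorem and torsion-freeness of `K₀` -/

section TorsionFree

variable {R : Type u} [Ring R]

/-- Fitting's lemma: the endomorphism ring of an indecomposable module of finite length is local. -/
theorem IsIndecomposable.isLocalRing_end [IsNoetherianRing R] [IsArtinianRing R]
    {N : FGModuleCat.{u} R} (hN : IsIndecomposable N) : IsLocalRing (Module.End R N) := by
  have : Nontrivial N := hN.1
  have key : ∀ f : Module.End R N, IsNilpotent f ∨ IsUnit f := by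
    intro f
    obtain ⟨n, hn⟩ := Filter.eventually_atTop.1 (LinearMap.eventually_isCompl_ker_pow_range_pow f)
    have hc := hn (n + 1) (by omega)
    let e := (Submodule.prodEquivOfIsCompl _ _ hc).symm
    rcases hN.2 (FGModuleCat.of R (LinearMap.ker (f ^ (n + 1))))
      (FGModuleCat.of R (LinearMap.range (f ^ (n + 1)))) ⟨e⟩ with h | h
    · right
      have h1 : LinearMap.ker (f ^ (n + 1)) = ⊥ := Submodule.subsingleton_iff_eq_bot.1 h
      have h2 : Function.Injective (f ^ (n + 1) : Module.End R N) := LinearMap.ker_eq_bot.1 h1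
      have h3 : Function.Injective f := by
        rw [pow_succ] at h2
        exact Function.Injective.of_comp (f := ⇑(f ^ n)) h2
      exact (Module.End.isUnit_iff f).2 (IsArtinian.bijective_of_injective_endomorphism f h3)
    · left
      have h1 : LinearMap.range (f ^ (n + 1)) = ⊥ := Submodule.subsingleton_iff_eq_bot.1 h
      exact ⟨n + 1, LinearMap.range_eq_bot.1 h1⟩
  refine IsLocalRing.of_isUnit_or_isUnit_of_isUnit_add fun a b hab => ?_
  rcases key (hab.unit⁻¹.1 * a) with h | h
  · right
    have h1 : hab.unit⁻¹.1 * b = 1 - hab.unit⁻¹.1 * a := by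
      rw [eq_sub_iff_add_eq, ← mul_add, add_comm b a]
      exact hab.val_inv_mul
    have h2 : IsUnit (hab.unit⁻¹.1 * b) := h1 ▸ h.isUnit_one_sub
    exact (Units.isUnit_units_mul _ _).1 h2
  · left
    exact (Units.isUnit_units_mul _ _).1 h

/-- Local rings are Dedekind finite. -/
theorem isUnit_of_isLocalRing_of_mul_eq_one {E : Type*} [Ring E] [IsLocalRing E] {a b : E}
    (h : a * b = 1) : IsUnit a ∧ IsUnit b := by
  have hx : b * a * (b * a) = b * a := by rw [mul_assoc, ← mul_assoc a, h, one_mul]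
  have h1 : b * a = 1 := by
    rcases IsLocalRing.isUnit_or_isUnit_of_add_one (add_sub_cancel (b * a) 1) with h1 | h1
    · exact h1.mul_left_cancel (by rw [hx, mul_one])
    · have h2 : b * a = 0 := h1.mul_left_cancel (by rw [sub_mul, one_mul, hx, sub_self, mul_zero])
      have h3 : a * (b * a) * b = 1 := by rw [mul_assoc, mul_assoc, h, mul_one, h]
      rw [h2, mul_zero, zero_mul] at h3
      exact absurd h3 zero_ne_one
  exact ⟨⟨⟨a, b, h, h1⟩, rfl⟩, ⟨⟨b, a, h1, h⟩, rfl⟩⟩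

section Multiplicity

variable (N : FGModuleCat.{u} R) [IsLocalRing (Module.End R N)]

/-- The homomorphisms `M → N` that are not split epimorphisms, for a module `N` with local
endomorphism ring. They form a submodule over the endomorphism ring of `N`. -/
def radHom (M : FGModuleCat.{u} R) : Submodule (Module.End R N) (M →ₗ[R] N) where
  carrier := {f | ∀ g : N →ₗ[R] M, ¬ IsUnit (f ∘ₗ g : Module.End R N)}
  zero_mem' g := by
    rw [LinearMap.zero_comp]; exact not_isUnit_zero
  add_mem' {a b} ha hb g h := by
    rw [LinearMap.add_comp] at h
    exact (IsLocalRing.isUnit_or_isUnit_of_isUnit_add h).elim (ha g) (hb g)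
  smul_mem' c f hf g h := by
    have h' : IsUnit (c * (f ∘ₗ g : Module.End R N)) := h
    refine hf g (isUnit_of_isLocalRing_of_mul_eq_one (a := h'.unit⁻¹.1 * c) ?_).2
    rw [mul_assoc]
    exact h'.val_inv_mul

/-- The multiplicity of `N` as a direct summand of `M`, for `N` with local endomorphism ring: the
dimension of `Hom(M, N) / rad(M, N)` over the residue division ring of `End N`, written as a length
over `End N`. -/
noncomputable def summandMultiplicity (M : FGModuleCat.{u} R) : ℕ∞ :=
  Module.length (Module.End R N) ((M →ₗ[R] N) ⧸ radHom N M)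

theorem summandMultiplicity_prod {M M' M'' : FGModuleCat.{u} R} (e : M ≃ₗ[R] M' × M'') :
    summandMultiplicity N M = summandMultiplicity N M' + summandMultiplicity N M'' := by
  obtain ⟨i, j, p, q, hij, hpi, hqj, hpj, hqi⟩ : ∃ (i : M' →ₗ[R] M) (j : M'' →ₗ[R] M)
      (p : M →ₗ[R] M') (q : M →ₗ[R] M''), i ∘ₗ p + j ∘ₗ q = LinearMap.id ∧ p ∘ₗ i = LinearMap.id ∧
        q ∘ₗ j = LinearMap.id ∧ p ∘ₗ j = 0 ∧ q ∘ₗ i = 0 := by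
    refine ⟨e.symm.toLinearMap ∘ₗ LinearMap.inl R M' M'', e.symm.toLinearMap ∘ₗ
      LinearMap.inr R M' M'', LinearMap.fst R M' M'' ∘ₗ e.toLinearMap,
      LinearMap.snd R M' M'' ∘ₗ e.toLinearMap, ?_, ?_, ?_, ?_, ?_⟩
    · ext x
      have : e.symm ((e x).1, 0) + e.symm (0, (e x).2) = x := by
        rw [← map_add]; simp
      simpa using this
    all_goals ext x; simp
  let Φ : (M →ₗ[R] N) →ₗ[Module.End R N]
      ((M' →ₗ[R] N) ⧸ radHom N M') × ((M'' →ₗ[R] N) ⧸ radHom N M'') :=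
    { toFun := fun f => (Submodule.Quotient.mk (f ∘ₗ i), Submodule.Quotient.mk (f ∘ₗ j))
      map_add' := fun f g => rfl
      map_smul' := fun c f => rfl }
  have hΦ : Function.Surjective Φ := by
    rintro ⟨a, b⟩
    obtain ⟨a, rfl⟩ := Submodule.Quotient.mk_surjective _ a
    obtain ⟨b, rfl⟩ := Submodule.Quotient.mk_surjective _ b
    refine ⟨a ∘ₗ p + b ∘ₗ q, Prod.ext ?_ ?_⟩
    · show Submodule.Quotient.mk ((a ∘ₗ p + b ∘ₗ q) ∘ₗ i) = Submodule.Quotient.mk a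
      rw [LinearMap.add_comp, LinearMap.comp_assoc, LinearMap.comp_assoc, hpi, hqi,
        LinearMap.comp_id, LinearMap.comp_zero, add_zero]
    · show Submodule.Quotient.mk ((a ∘ₗ p + b ∘ₗ q) ∘ₗ j) = Submodule.Quotient.mk b
      rw [LinearMap.add_comp, LinearMap.comp_assoc, LinearMap.comp_assoc, hpj, hqj,
        LinearMap.comp_id, LinearMap.comp_zero, zero_add]
  have hker : LinearMap.ker Φ = radHom N M := by
    ext f
    have h1 : f ∈ LinearMap.ker Φ ↔ f ∘ₗ i ∈ radHom N M' ∧ f ∘ₗ j ∈ radHom N M'' := by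
      rw [LinearMap.mem_ker]
      exact Prod.ext_iff.trans
        (and_congr (Submodule.Quotient.mk_eq_zero _) (Submodule.Quotient.mk_eq_zero _))
    rw [h1]
    constructor
    · rintro ⟨h, h'⟩ g hg
      have : (f ∘ₗ g : Module.End R N) = (f ∘ₗ i) ∘ₗ (p ∘ₗ g) + (f ∘ₗ j) ∘ₗ (q ∘ₗ g) := by
        refine LinearMap.ext fun x => ?_
        have h3 := congrArg f (LinearMap.congr_fun hij (g x))
        rw [LinearMap.add_apply, map_add] at h3
        exact h3.symm
      rw [this] at hg
      exact (IsLocalRing.isUnit_or_isUnit_of_isUnit_add hg).elim (h _) (h' _)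
    · exact fun h => ⟨fun g => h (i ∘ₗ g), fun g => h (j ∘ₗ g)⟩
  rw [summandMultiplicity, summandMultiplicity, summandMultiplicity, ← Module.length_prod]
  exact ((Submodule.quotEquivOfEq _ _ hker.symm).trans
    (Φ.quotKerEquivOfSurjective hΦ)).length_eq

theorem summandMultiplicity_eq_zero [IsNoetherianRing R] {M : FGModuleCat.{u} R}
    (h : ¬ IsSummand N M) :
    summandMultiplicity N M = 0 := by
  have h1 : radHom N M = ⊤ := by
    refine eq_top_iff.2 fun f _ g hg => h ?_
    refine isSummand_of_leftInverse g (hg.unit⁻¹.1 ∘ₗ f) fun x => ?_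
    exact LinearMap.congr_fun hg.val_inv_mul x
  rw [summandMultiplicity, h1]
  exact Module.length_eq_zero

/-- The submodule `radHom N N` is the unique maximal left ideal of the local ring `End N`. -/
theorem summandMultiplicity_self : summandMultiplicity N N = 1 := by
  rw [summandMultiplicity, Module.length_eq_one_iff, isSimpleModule_iff_isCoatom]
  refine ⟨fun h => ?_, fun S hS => ?_⟩
  · have h1 : (LinearMap.id : N →ₗ[R] N) ∈ radHom N N := h ▸ Submodule.mem_top
    exact h1 LinearMap.id isUnit_one
  · obtain ⟨f, hfS, hf⟩ := Set.exists_of_ssubset hS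
    obtain ⟨g, hg⟩ : ∃ g : N →ₗ[R] N, IsUnit (f ∘ₗ g : Module.End R N) := by
      by_contra hcon
      exact hf fun g hg => hcon ⟨g, hg⟩
    have hu : IsUnit (f : Module.End R N) :=
      (isUnit_of_isLocalRing_of_mul_eq_one (a := (f : Module.End R N))
        (b := (g : Module.End R N) * hg.unit⁻¹.1)
        (by rw [← mul_assoc]; exact hg.mul_val_inv)).1
    refine eq_top_iff.2 fun t _ => ?_
    have : t = ((t : Module.End R N) * hu.unit⁻¹.1) • f := by
      show (t : Module.End R N) = (t : Module.End R N) * hu.unit⁻¹.1 * (f : Module.End R N)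
      rw [mul_assoc, hu.val_inv_mul, mul_one]
    rw [this]
    exact S.smul_mem _ hfS

end Multiplicity

theorem IsIndecomposable.nonempty_equiv {N M : FGModuleCat.{u} R} (hM : IsIndecomposable M)
    (hN : Nontrivial N) (h : IsSummand N M) : Nonempty (M ≃ₗ[R] N) := by
  obtain ⟨L, ⟨e⟩⟩ := h
  rcases hM.2 N L ⟨e⟩ with h1 | h1
  · exact absurd h1 (not_subsingleton_iff_nontrivial.2 hN)
  · have : Unique L := ⟨⟨0⟩, fun x => Subsingleton.elim _ _⟩
    exact ⟨e.trans LinearEquiv.prodUnique⟩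

theorem IsSummand.projective {N M : FGModuleCat.{u} R} (h : IsSummand N M)
    (hM : Module.Projective R M) : Module.Projective R N := by
  obtain ⟨L, ⟨e⟩⟩ := h
  refine Module.Projective.of_split (e.symm.toLinearMap ∘ₗ LinearMap.inl R N L)
    (LinearMap.fst R N L ∘ₗ e.toLinearMap) ?_
  ext x; simp

variable [IsNoetherianRing R] [IsArtinianRing R]

theorem summandMultiplicity_ne_top (N : FGModuleCat.{u} R) [IsLocalRing (Module.End R N)]
    (M : FGModuleCat.{u} R) : summandMultiplicity N M ≠ ⊤ := by
  have hN : Nontrivial N := by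
    by_contra h
    rw [not_nontrivial_iff_subsingleton] at h
    exact zero_ne_one (α := Module.End R N) (LinearMap.ext fun x => Subsingleton.elim _ _)
  obtain ⟨n, hn⟩ := ENat.ne_top_iff_exists.1 M.length_ne_top
  induction n using Nat.strong_induction_on generalizing M with
  | _ n ih =>
    by_cases h : IsSummand N M
    · obtain ⟨L, ⟨e⟩⟩ := h
      have hlen : Module.length R N + Module.length R L = n := by
        rw [hn, e.length_eq, Module.length_prod]
      obtain ⟨a, ha⟩ := ENat.ne_top_iff_exists.1 N.length_ne_top
      obtain ⟨b, hb⟩ := ENat.ne_top_iff_exists.1 L.length_ne_top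
      have ha0 : 0 < Module.length R N := Module.length_pos
      rw [← ha] at ha0 hlen
      rw [← hb] at hlen
      norm_cast at ha0 hlen
      rw [summandMultiplicity_prod N e, summandMultiplicity_self]
      exact WithTop.add_ne_top.2 ⟨ENat.one_ne_top, ih b (by omega) L hb⟩
    · rw [summandMultiplicity_eq_zero N h]; exact ENat.zero_ne_top

/-- The multiplicity of a non-projective indecomposable module `N` as a homomorphism on `K₀`. -/
noncomputable def K0.coeff (N : FGModuleCat.{u} R) (hN : IsIndecomposable N)
    (hP : ¬ Module.Projective R N) : K0 R →+ ℤ :=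
  have := hN.isLocalRing_end
  K0.lift (fun M => ((summandMultiplicity N M).toNat : ℤ))
    (fun M M' M'' ⟨e⟩ => by
      rw [summandMultiplicity_prod N e, ENat.toNat_add (summandMultiplicity_ne_top N M')
        (summandMultiplicity_ne_top N M'')]
      push_cast; rfl)
    (fun P hPP => by
      rw [summandMultiplicity_eq_zero N fun h => hP (h.projective hPP)]; rfl)

theorem K0.coeff_self (N : FGModuleCat.{u} R) (hN : IsIndecomposable N)
    (hP : ¬ Module.Projective R N) : K0.coeff N hN hP (K0.mk N) = 1 := by
  have := hN.isLocalRing_end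
  rw [K0.coeff, K0.lift_mk, summandMultiplicity_self]; rfl

theorem K0.coeff_of_not_equiv (N : FGModuleCat.{u} R) (hN : IsIndecomposable N)
    (hP : ¬ Module.Projective R N) {M : FGModuleCat.{u} R} (hM : IsIndecomposable M)
    (h : ¬ Nonempty (M ≃ₗ[R] N)) : K0.coeff N hN hP (K0.mk M) = 0 := by
  have := hN.isLocalRing_end
  rw [K0.coeff, K0.lift_mk,
    summandMultiplicity_eq_zero N fun h' => h (hM.nonempty_equiv hN.1 h')]; rfl

/-- Isomorphism of finitely generated modules. -/
def isoSetoid (R : Type u) [Ring R] : Setoid (FGModuleCat.{u} R) where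
  r M N := Nonempty (M ≃ₗ[R] N)
  iseqv := ⟨fun M => ⟨LinearEquiv.refl R M⟩, fun ⟨e⟩ => ⟨e.symm⟩, fun ⟨e⟩ ⟨e'⟩ => ⟨e.trans e'⟩⟩

/-- `K₀` is free on the isomorphism classes of non-projective indecomposable modules
(Krull-Remak-Schmidt); in particular it is torsion free. -/
theorem K0.eq_zero_of_smul_eq_zero {x : K0 R} {c : ℤ} (hc : c ≠ 0) (hx : c • x = 0) : x = 0 := by
  -- `rep` chooses a module in each isomorphism class
  let rep : FGModuleCat.{u} R → FGModuleCat.{u} R := fun M =>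
    (Quotient.mk (isoSetoid R) M).out
  have hrep : ∀ M, Nonempty (rep M ≃ₗ[R] M) := fun M => Quotient.mk_out (s := isoSetoid R) M
  have hrep' : ∀ {M N : FGModuleCat.{u} R}, Nonempty (M ≃ₗ[R] N) → rep M = rep N := by
    intro M N h
    have : Quotient.mk (isoSetoid R) M = Quotient.mk (isoSetoid R) N := Quotient.sound h
    show Quotient.out _ = Quotient.out _
    rw [this]
  let ι := {N : FGModuleCat.{u} R // IsIndecomposable N ∧ ¬ Module.Projective R N ∧ rep N = N}
  have hspan : x ∈ Submodule.span ℤ (Set.range fun i : ι => K0.mk i.1) := by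
    have h1 : AddSubgroup.closure {x : K0 R | ∃ N, IsIndecomposable N ∧ x = K0.mk N} ≤
        (Submodule.span ℤ (Set.range fun i : ι => K0.mk i.1)).toAddSubgroup := by
      rw [AddSubgroup.closure_le]
      rintro _ ⟨N, hN, rfl⟩
      by_cases hP : Module.Projective R N
      · rw [K0.mk_projective hP]; exact zero_mem _
      obtain ⟨e⟩ := hrep N
      rw [K0.mk_congr e.symm]
      refine Submodule.subset_span ⟨⟨rep N, ⟨?_, ?_⟩, ?_, hrep' ⟨e⟩⟩, rfl⟩
      · have := hN.1
        exact e.toEquiv.nontrivial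
      · exact fun X Y ⟨f⟩ => hN.2 X Y ⟨e.symm.trans f⟩
      · exact fun h => hP (Module.Projective.of_equiv e)
    exact h1 (by rw [K0.closure_indecomposable]; exact AddSubgroup.mem_top x)
  obtain ⟨a, rfl⟩ := (Finsupp.mem_span_range_iff_exists_finsupp).1 hspan
  have ha : ∀ i : ι, a i = 0 := by
    intro i
    have h1 := congrArg (K0.coeff i.1 i.2.1 i.2.2.1) hx
    rw [map_zsmul, Finsupp.sum, map_sum, map_zero, Finset.sum_eq_single i] at h1
    · rw [map_zsmul, K0.coeff_self] at h1
      simpa [hc] using h1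
    · intro j _ hj
      rw [map_zsmul, K0.coeff_of_not_equiv _ _ _ j.2.1, smul_zero]
      exact fun h => hj (Subtype.ext (by rw [← j.2.2.2, ← i.2.2.2, hrep' h]))
    · intro hi
      rw [Finsupp.notMem_support_iff.1 hi, zero_smul, map_zero]
  rw [show a = 0 from Finsupp.ext ha, Finsupp.sum_zero_index]

end TorsionFree

/-! ### Projective covers and simple modules of rings with a vertex system -/

/-- A surjection with superfluous kernel onto a projective module is an isomorphism. -/
theorem injective_of_projective {R P Q : Type u} [Ring R] [AddCommGroup P] [AddCommGroup Q]
    [Module R P] [Module R Q] [Module.Projective R Q] (f : P →ₗ[R] Q) (hf : Function.Surjective f)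
    (h : ∀ U : Submodule R P, U ⊔ LinearMap.ker f = ⊤ → U = ⊤) : Function.Injective f := by
  obtain ⟨s, hs⟩ := LinearMap.exists_rightInverse_of_surjective f (LinearMap.range_eq_top.2 hf)
  have hs' : ∀ q, f (s q) = q := fun q => LinearMap.congr_fun hs q
  have h1 : LinearMap.range s = ⊤ := by
    refine h _ (eq_top_iff.2 fun x _ => ?_)
    rw [← add_sub_cancel (s (f x)) x]
    exact add_mem (Submodule.mem_sup_left ⟨f x, rfl⟩)
      (Submodule.mem_sup_right (by rw [LinearMap.mem_ker, map_sub, hs', sub_self]))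
  intro x y hxy
  obtain ⟨a, rfl⟩ := LinearMap.range_eq_top.1 h1 x
  obtain ⟨b, rfl⟩ := LinearMap.range_eq_top.1 h1 y
  rw [hs', hs'] at hxy
  rw [hxy]

/-- A complete set of idempotents `idem v` of a ring `R` together with characters `char v : R → k`
dual to them, such that the common kernel of the characters is nilpotent. For a bound quiver algebra
these are the idempotents of the vertices and the coefficients of the trivial paths. -/
structure VertexSystem (k R V : Type u) [Field k] [Ring R] [Fintype V] where
  idem : V → R
  char : V → R →+* k
  idem_mul_self : ∀ v, idem v * idem v = idem v
  sum_idem : ∑ v, idem v = 1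
  char_surjective : ∀ v, Function.Surjective (char v)
  char_idem_self : ∀ v, char v (idem v) = 1
  char_idem_of_ne : ∀ v w, w ≠ v → char w (idem v) = 0
  nilpotent : ∃ m : ℕ, (fun I : Ideal R => I * ⨅ v, RingHom.ker (char v))^[m] ⊤ = ⊥

namespace VertexSystem

variable {k R V : Type u} [Field k] [Ring R] [Fintype V] (S : VertexSystem k R V)

/-- The radical of `R`, as the common kernel of the characters. -/
def rad : Ideal R := ⨅ v, RingHom.ker (S.char v)

theorem mem_rad {r : R} : r ∈ S.rad ↔ ∀ v, S.char v r = 0 := by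
  simp [rad, RingHom.mem_ker]

/-- Nakayama's lemma. -/
theorem eq_top_of_sup_rad_smul {M : Type*} [AddCommGroup M] [Module R M] {N : Submodule R M}
    (h : N ⊔ S.rad • ⊤ = ⊤) : N = ⊤ := by
  obtain ⟨m, hm⟩ := S.nilpotent
  have key : ∀ i : ℕ, N ⊔ (fun I : Ideal R => I * S.rad)^[i] ⊤ • (⊤ : Submodule R M) = ⊤ := by
    intro i
    induction i with
    | zero => rw [Function.iterate_zero_apply, Submodule.top_smul, sup_top_eq]
    | succ i ih =>
      rw [Function.iterate_succ_apply']
      generalize (fun I : Ideal R => I * S.rad)^[i] ⊤ = I at ih ⊢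
      rw [eq_top_iff]
      calc ⊤ = N ⊔ I • (N ⊔ S.rad • ⊤) := by rw [h, ih]
        _ ≤ N ⊔ (I * S.rad) • ⊤ := by
          rw [Submodule.smul_sup, Submodule.mul_smul]
          exact sup_le le_sup_left (sup_le (Submodule.smul_le_right.trans le_sup_left) le_sup_right)
  have := key m
  rwa [show (fun I : Ideal R => I * S.rad)^[m] ⊤ = ⊥ from hm, Submodule.bot_smul,
    sup_bot_eq] at this

theorem mem_rad_of_mul_idem {r : R} {v : V} (h : r * S.idem v = r) (h0 : S.char v r = 0) :
    r ∈ S.rad := by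
  refine S.mem_rad.2 fun w => ?_
  by_cases hw : w = v
  · rw [hw, h0]
  · rw [← h, map_mul, S.char_idem_of_ne v w hw, mul_zero]

/-- A finite family of elements supported at the vertices `v i` that generates `M`. -/
def Generates {M : Type*} [AddCommGroup M] [Module R M] {n : ℕ} (v : Fin n → V) (m : Fin n → M) :
    Prop :=
  (∀ i, S.idem (v i) • m i = m i) ∧ Submodule.span R (Set.range m) = ⊤

theorem exists_generates (M : Type*) [AddCommGroup M] [Module R M] [Module.Finite R M] :
    ∃ (n : ℕ) (v : Fin n → V) (m : Fin n → M), S.Generates v m := by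
  obtain ⟨n, s, hs⟩ := Submodule.fg_iff_exists_fin_generating_family.1
    (Module.Finite.fg_top (R := R) (M := M))
  let e := (Fintype.equivFin (Fin n × V)).symm
  refine ⟨_, fun i => (e i).2, fun i => S.idem (e i).2 • s (e i).1, fun i => ?_, ?_⟩
  · rw [smul_smul, S.idem_mul_self]
  · rw [eq_top_iff, ← hs, Submodule.span_le]
    rintro _ ⟨j, rfl⟩
    rw [← one_smul R (s j), ← S.sum_idem, Finset.sum_smul]
    refine Submodule.sum_mem _ fun v _ => Submodule.subset_span ⟨e.symm (j, v), ?_⟩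
    simp

/-- The relations between the members of a generating family all have coefficients in the
radical. -/
def MinimallyGenerates {M : Type*} [AddCommGroup M] [Module R M] {n : ℕ} (v : Fin n → V)
    (m : Fin n → M) : Prop :=
  S.Generates v m ∧ ∀ r : Fin n → R, (∀ i, r i * S.idem (v i) = r i) → ∑ i, r i • m i = 0 →
    ∀ i, r i ∈ S.rad

/-- By Nakayama's lemma, a generating family of least size is minimal. -/
theorem exists_minimallyGenerates (M : Type*) [AddCommGroup M] [Module R M] [Module.Finite R M] :
    ∃ (n : ℕ) (v : Fin n → V) (m : Fin n → M), S.MinimallyGenerates v m := by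
  classical
  have hex := S.exists_generates M
  obtain ⟨v, m, hm⟩ := Nat.find_spec hex
  have hmin := fun l => Nat.find_min hex (m := l)
  generalize Nat.find hex = n at v m hmin
  refine ⟨n, v, m, hm, fun r hr h0 i => ?_⟩
  by_contra hi
  obtain ⟨n, rfl⟩ : ∃ l, n = l + 1 := ⟨n - 1, by have := i.2; omega⟩
  refine hmin n (by omega) ⟨v ∘ i.succAbove, m ∘ i.succAbove, fun j => hm.1 _, ?_⟩
  set N := Submodule.span R (Set.range (m ∘ i.succAbove)) with hN
  have hmem : ∀ j, m (i.succAbove j) ∈ N := fun j => Submodule.subset_span ⟨j, rfl⟩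
  refine S.eq_top_of_sup_rad_smul (eq_top_iff.2 (hm.2.ge.trans ?_))
  rw [Submodule.span_le]
  rintro _ ⟨j, rfl⟩
  rcases Fin.eq_self_or_eq_succAbove i j with rfl | ⟨j, rfl⟩
  · have hc : S.char (v j) (r j) ≠ 0 := fun hc => hi (S.mem_rad_of_mul_idem (hr j) hc)
    obtain ⟨t, ht⟩ := S.char_surjective (v j) (S.char (v j) (r j))⁻¹
    have h1 : S.idem (v j) - S.idem (v j) * t * r j ∈ S.rad := by
      refine S.mem_rad.2 fun w => ?_
      by_cases hw : w = v j
      · rw [hw, map_sub, map_mul, map_mul, S.char_idem_self, ht, one_mul, inv_mul_cancel₀ hc,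
          sub_self]
      · rw [map_sub, map_mul, map_mul, S.char_idem_of_ne _ _ hw, zero_mul, zero_mul, sub_self]
    have h2 : r j • m j ∈ N := by
      rw [Fin.sum_univ_succAbove _ j] at h0
      rw [eq_neg_of_add_eq_zero_left h0]
      exact N.neg_mem (N.sum_mem fun l _ => N.smul_mem _ (hmem l))
    have h3 : m j = (S.idem (v j) - S.idem (v j) * t * r j) • m j +
        (S.idem (v j) * t) • (r j • m j) := by
      rw [sub_smul, hm.1, smul_smul, sub_add_cancel]
    rw [h3]
    exact add_mem (Submodule.mem_sup_right (Submodule.smul_mem_smul h1 trivial))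
      (Submodule.mem_sup_left (N.smul_mem _ h2))
  · exact Submodule.mem_sup_left (hmem j)

/-- The left ideal `R (idem v)`. -/
def idemIdeal (v : V) : Submodule R R where
  carrier := {r | r * S.idem v = r}
  zero_mem' := zero_mul _
  add_mem' {a b} ha hb := by
    show (a + b) * S.idem v = a + b
    rw [add_mul, show a * S.idem v = a from ha, show b * S.idem v = b from hb]
  smul_mem' c a ha := by
    show c • a * S.idem v = c • a
    rw [smul_eq_mul, mul_assoc, show a * S.idem v = a from ha]

variable [IsNoetherianRing R]

/-- The projective module `R (idem v)`. -/
def proj (v : V) : FGModuleCat.{u} R := FGModuleCat.of R (S.idemIdeal v)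

/-- The underlying element of `R`. -/
def projVal (v : V) : S.proj v →ₗ[R] R := (S.idemIdeal v).subtype

theorem projVal_injective (v : V) : Function.Injective (S.projVal v) := Subtype.val_injective

/-- An element of `R (idem v)` from an element of `R`. -/
def projMk (v : V) (r : R) (hr : r * S.idem v = r) : S.proj v := (⟨r, hr⟩ : S.idemIdeal v)

theorem projVal_projMk (v : V) (r : R) (hr : r * S.idem v = r) :
    S.projVal v (S.projMk v r hr) = r := rfl

theorem projVal_mul (v : V) (x : S.proj v) : S.projVal v x * S.idem v = S.projVal v x := x.2

/-- The generator `idem v` of `R (idem v)`. -/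
def gen (v : V) : S.proj v := S.projMk v (S.idem v) (S.idem_mul_self v)

theorem projVal_gen (v : V) : S.projVal v (S.gen v) = S.idem v := rfl

theorem projVal_smul_gen (v : V) (x : S.proj v) : S.projVal v x • S.gen v = x :=
  S.projVal_injective v (by rw [map_smul, projVal_gen, smul_eq_mul, projVal_mul])

/-- The projective module `∏ i, R (idem (v i))`. -/
def cover {n : ℕ} (v : Fin n → V) : FGModuleCat.{u} R := FGModuleCat.of R (∀ i, S.proj (v i))

instance projective_cover {n : ℕ} (v : Fin n → V) : Module.Projective R (S.cover v) := by
  refine Module.Projective.of_split (M := Fin n → R)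
    (LinearMap.pi fun i => S.projVal (v i) ∘ₗ LinearMap.proj i)
    (LinearMap.pi fun i => LinearMap.toSpanSingleton R _ (S.gen (v i)) ∘ₗ LinearMap.proj i) ?_
  refine LinearMap.ext fun x => funext fun i => S.projVal_smul_gen (v i) (x i)

/-- The homomorphism from `∏ i, R (idem (v i))` given by elements supported at the `v i`. -/
def coverHom {M : Type*} [AddCommGroup M] [Module R M] {n : ℕ} (v : Fin n → V) (m : Fin n → M) :
    S.cover v →ₗ[R] M :=
  ∑ i, LinearMap.toSpanSingleton R M (m i) ∘ₗ S.projVal (v i) ∘ₗ LinearMap.proj i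

theorem coverHom_apply {M : Type*} [AddCommGroup M] [Module R M] {n : ℕ} (v : Fin n → V)
    (m : Fin n → M) (x : S.cover v) : S.coverHom v m x = ∑ i, S.projVal (v i) (x i) • m i := by
  rw [coverHom, LinearMap.sum_apply]; rfl

theorem coverHom_surjective {M : Type*} [AddCommGroup M] [Module R M] {n : ℕ} {v : Fin n → V}
    {m : Fin n → M} (h : S.Generates v m) : Function.Surjective (S.coverHom v m) := by
  intro y
  obtain ⟨c, rfl⟩ := (Submodule.mem_span_range_iff_exists_fun R).1
    (h.2 ▸ Submodule.mem_top (x := y))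
  refine ⟨(fun i => c i • S.gen (v i) : ∀ i, S.proj (v i)), ?_⟩
  refine (S.coverHom_apply v m _).trans (Finset.sum_congr rfl fun i _ => ?_)
  rw [map_smul, projVal_gen, smul_eq_mul, mul_smul, h.1]

theorem mem_rad_of_coverHom_eq_zero {M : Type*} [AddCommGroup M] [Module R M] {n : ℕ}
    {v : Fin n → V} {m : Fin n → M} (h : S.MinimallyGenerates v m) {x : S.cover v}
    (hx : S.coverHom v m x = 0) (i : Fin n) : S.projVal (v i) (x i) ∈ S.rad :=
  h.2 (fun i => S.projVal (v i) (x i)) (fun i => S.projVal_mul (v i) (x i))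
    (by rw [← coverHom_apply, hx]) i

theorem mem_rad_smul_top {n : ℕ} {v : Fin n → V} {x : S.cover v}
    (hx : ∀ i, S.projVal (v i) (x i) ∈ S.rad) : x ∈ S.rad • (⊤ : Submodule R (S.cover v)) := by
  have h : x = ∑ i, S.projVal (v i) (x i) •
      (LinearMap.single R (fun i => S.proj (v i)) i (S.gen (v i)) : ∀ i, S.proj (v i)) := by
    refine (Finset.univ_sum_single (M := fun i => S.proj (v i)) x).symm.trans
      (Finset.sum_congr rfl fun i _ => ?_)
    rw [← map_smul, projVal_smul_gen]
    rfl
  rw [h]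
  exact Submodule.sum_mem _ fun i _ => Submodule.smul_mem_smul (hx i) trivial

/-- A homomorphism from `∏ i, R (idem (v i))` whose kernel has coordinates in the radical is a
projective cover of its image. -/
theorem isSyzygy_of_ker_le_rad {M : FGModuleCat.{u} R} {n : ℕ} {v : Fin n → V}
    (f : S.cover v →ₗ[R] M) (hf : Function.Surjective f)
    (h : ∀ x, f x = 0 → ∀ i, S.projVal (v i) (x i) ∈ S.rad) : IsSyzygy M (kerFG f) :=
  ⟨S.cover v, f, S.projective_cover v, hf, fun _ hU => S.eq_top_of_sup_rad_smul <| by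
    refine eq_top_iff.2 (hU.ge.trans ?_)
    exact sup_le_sup_left (fun x hx => S.mem_rad_smul_top (h x hx)) _, ⟨LinearEquiv.refl _ _⟩⟩

/-- Every finitely generated projective module is a product of modules `R (idem v)`. -/
theorem exists_equiv_cover (Q : FGModuleCat.{u} R) (hQ : Module.Projective R Q) :
    ∃ (n : ℕ) (v : Fin n → V), Nonempty (Q ≃ₗ[R] S.cover v) := by
  obtain ⟨n, v, m, h⟩ := S.exists_minimallyGenerates Q
  refine ⟨n, v, ⟨(LinearEquiv.ofBijective (S.coverHom v m)
    ⟨injective_of_projective _ (S.coverHom_surjective h.1) fun U hU =>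
      S.eq_top_of_sup_rad_smul ?_, S.coverHom_surjective h.1⟩).symm⟩⟩
  refine eq_top_iff.2 (hU.ge.trans ?_)
  exact sup_le_sup_left
    (fun x hx => S.mem_rad_smul_top (S.mem_rad_of_coverHom_eq_zero h hx)) _

end VertexSystem

/-- A projective module is its own projective cover. -/
theorem IsSyzygy.subsingleton_of_projective {R : Type u} [Ring R] {M N : FGModuleCat.{u} R}
    (h : IsSyzygy M N) (hM : Module.Projective R M) : Subsingleton N := by
  obtain ⟨P, f, -, hf, hU, ⟨e⟩⟩ := h
  have : Subsingleton (LinearMap.ker f) := by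
    rw [Submodule.subsingleton_iff_eq_bot, LinearMap.ker_eq_bot]
    exact injective_of_projective f hf hU
  exact e.toEquiv.subsingleton

namespace VertexSystem

variable {k R V : Type u} [Field k] [Ring R] [Fintype V] (S : VertexSystem k R V)

/-- The simple module at the vertex `v`: the field `k` on which `R` acts through `char v`. -/
def Simple (_ : VertexSystem k R V) (_ : V) : Type u := k

instance (v : V) : AddCommGroup (S.Simple v) := inferInstanceAs (AddCommGroup k)
instance (v : V) : Module R (S.Simple v) := Module.compHom k (S.char v)

/-- The underlying element of `k`. -/
def simpleVal (v : V) : S.Simple v ≃+ k := AddEquiv.refl k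

theorem simpleVal_smul (v : V) (r : R) (x : S.Simple v) :
    S.simpleVal v (r • x) = S.char v r * S.simpleVal v x := rfl

instance (v : V) : IsSimpleModule R (S.Simple v) := by
  have : Nontrivial (S.Simple v) := inferInstanceAs (Nontrivial k)
  refine isSimpleModule_iff_toSpanSingleton_surjective.2 ⟨inferInstance, fun x hx y => ?_⟩
  obtain ⟨r, hr⟩ := S.char_surjective v (S.simpleVal v y * (S.simpleVal v x)⁻¹)
  have hx' : S.simpleVal v x ≠ 0 := (map_ne_zero_iff _ (S.simpleVal v).injective).2 hx
  refine ⟨r, (S.simpleVal v).injective ?_⟩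
  rw [LinearMap.toSpanSingleton_apply, simpleVal_smul, hr, mul_assoc, inv_mul_cancel₀ hx', mul_one]

theorem rad_smul_eq_zero_of_isSimpleModule {T : Type*} [AddCommGroup T] [Module R T]
    [IsSimpleModule R T] {r : R} (hr : r ∈ S.rad) (t : T) : r • t = 0 := by
  rcases eq_bot_or_eq_top (S.rad • (⊤ : Submodule R T)) with h | h
  · have : r • t ∈ S.rad • (⊤ : Submodule R T) := Submodule.smul_mem_smul hr trivial
    rwa [h, Submodule.mem_bot] at this
  · have h1 : (⊥ : Submodule R T) = ⊤ := S.eq_top_of_sup_rad_smul (by rw [h, bot_sup_eq])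
    have := (IsSimpleModule.nontrivial R T)
    exact absurd h1 bot_ne_top

theorem exists_equiv_simple (T : Type u) [AddCommGroup T] [Module R T] [IsSimpleModule R T] :
    ∃ v, Nonempty (T ≃ₗ[R] S.Simple v) := by
  have hT := IsSimpleModule.nontrivial R T
  obtain ⟨t, ht⟩ := exists_ne (0 : T)
  obtain ⟨v, hv⟩ : ∃ v, S.idem v • t ≠ 0 := by
    by_contra hcon
    push Not at hcon
    refine ht ?_
    rw [← one_smul R t, ← S.sum_idem, Finset.sum_smul]
    exact Finset.sum_eq_zero fun v _ => hcon v
  refine ⟨v, ?_⟩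
  let f : R →ₗ[R] S.Simple v :=
    { toFun := fun r => (S.simpleVal v).symm (S.char v r)
      map_add' := fun r s => map_add (S.char v) r s
      map_smul' := fun r s => map_mul (S.char v) r s }
  let g : R →ₗ[R] T := LinearMap.toSpanSingleton R T (S.idem v • t)
  have hf : Function.Surjective f := S.char_surjective v
  have hg : Function.Surjective g :=
    (isSimpleModule_iff_toSpanSingleton_surjective.1 inferInstance).2 _ hv
  have hle : LinearMap.ker f ≤ LinearMap.ker g := by
    intro r hr
    rw [LinearMap.mem_ker]
    show r • S.idem v • t = 0
    rw [smul_smul]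
    refine S.rad_smul_eq_zero_of_isSimpleModule (S.mem_rad_of_mul_idem (v := v) ?_ ?_) t
    · rw [mul_assoc, S.idem_mul_self]
    · rw [map_mul, show S.char v r = 0 from hr, zero_mul]
  have hker : LinearMap.ker f = LinearMap.ker g := by
    have hc : IsCoatom (LinearMap.ker f) := by
      rw [← isSimpleModule_iff_isCoatom]
      exact IsSimpleModule.congr (f.quotKerEquivOfSurjective hf)
    rcases hc.le_iff.1 hle with h | h
    · have h0 : g 1 = 0 := by rw [← LinearMap.mem_ker, h]; trivial
      exact absurd (by simpa [g] using h0) hv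
    · exact h.symm
  exact ⟨(g.quotKerEquivOfSurjective hg).symm.trans ((Submodule.quotEquivOfEq _ _ hker.symm).trans
    (f.quotKerEquivOfSurjective hf))⟩

/-- The vertices, enumerated. -/
noncomputable def enum (_ : VertexSystem k R V) : Fin (Fintype.card V) ≃ V :=
  (Fintype.equivFin V).symm

instance (v : V) : Module.Finite R (S.Simple v) := inferInstance

/-- The sum of the simple modules at all vertices. -/
noncomputable def sumSimple : FGModuleCat.{u} R := FGModuleCat.of R (∀ i, S.Simple (S.enum i))

theorem isSumOfSimples_sumSimple : IsSumOfSimples S.sumSimple := by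
  refine ⟨_, fun i => FGModuleCat.of R (S.Simple (S.enum i)), fun i =>
    inferInstanceAs (IsSimpleModule R (S.Simple _)), fun i j ⟨e⟩ => ?_, fun T hT => ?_,
    ⟨LinearEquiv.refl _ _⟩⟩
  · by_contra hij
    have e' : S.Simple (S.enum i) ≃ₗ[R] S.Simple (S.enum j) := e
    set x := (S.simpleVal (S.enum i)).symm 1 with hx
    have h1 : S.idem (S.enum i) • x = x := (S.simpleVal _).injective <| by
      rw [simpleVal_smul, S.char_idem_self, one_mul]
    have h2 : S.idem (S.enum i) • e' x = 0 := (S.simpleVal _).injective <| by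
      rw [simpleVal_smul, S.char_idem_of_ne _ _ fun h => hij (S.enum.injective h).symm, zero_mul,
        map_zero]
    rw [← map_smul, h1, map_eq_zero_iff e' e'.injective, hx,
      map_eq_zero_iff _ (S.simpleVal _).symm.injective] at h2
    exact one_ne_zero h2
  · obtain ⟨v, ⟨e⟩⟩ := S.exists_equiv_simple T
    refine ⟨S.enum.symm v, ?_⟩
    have h : v = S.enum (S.enum.symm v) := by simp
    exact ⟨e.trans (h ▸ LinearEquiv.refl R (S.Simple v) : S.Simple v ≃ₗ[R] S.Simple _)⟩

theorem rad_smul_sumSimple {r : R} (hr : r ∈ S.rad) (x : S.sumSimple) : r • x = 0 :=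
  funext fun i => S.rad_smul_eq_zero_of_isSimpleModule hr ((x : ∀ i, S.Simple (S.enum i)) i)

theorem exists_idem_smul_sumSimple_ne_zero (v : V) : ∃ x : S.sumSimple, S.idem v • x ≠ 0 := by
  refine ⟨(fun _ => (1 : k) : ∀ i, S.Simple (S.enum i)), fun h => ?_⟩
  have h1 : S.char (S.enum (S.enum.symm v)) (S.idem v) * (1 : k) = 0 :=
    congrFun (show (_ : ∀ i, S.Simple (S.enum i)) = 0 from h) (S.enum.symm v)
  rw [Equiv.apply_symm_apply, S.char_idem_self, mul_one] at h1
  exact one_ne_zero h1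

end VertexSystem

/-! ### Corners: restriction and extension by zero -/

/-- A ring `RA` which is both a quotient of `R`, via `proj`, and the corner `e R e` of `R` at the
idempotent `e = incl 1`, via `incl`, where `proj` is `r ↦ e r e`. -/
structure Corner (R RA : Type u) [Ring R] [Ring RA] where
  proj : R →+* RA
  incl : RA →ₙ+* R
  proj_incl : ∀ a, proj (incl a) = a
  incl_proj : ∀ r, incl (proj r) = incl 1 * r * incl 1

namespace Corner

variable {R RA : Type u} [Ring R] [Ring RA] (c : Corner R RA)

/-- The idempotent of the corner. -/
def e : R := c.incl 1

theorem e_mul_incl (a : RA) : c.e * c.incl a = c.incl a := by rw [e, ← map_mul, one_mul]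

theorem incl_mul_e (a : RA) : c.incl a * c.e = c.incl a := by rw [e, ← map_mul, mul_one]

theorem e_mul_e : c.e * c.e = c.e := c.e_mul_incl 1

theorem proj_e : c.proj c.e = 1 := c.proj_incl 1

section Infl

/-- Extension by zero of a module over the corner: the module `X` on which `R` acts through the
quotient map `proj`. -/
def Infl (_ : Corner R RA) (X : Type u) : Type u := X

variable {X Y : Type u} [AddCommGroup X] [AddCommGroup Y] [Module RA X] [Module RA Y]

instance : AddCommGroup (c.Infl X) := inferInstanceAs (AddCommGroup X)
instance : Module R (c.Infl X) := Module.compHom X c.proj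

/-- The underlying element of an extension by zero. -/
def inflVal : c.Infl X ≃+ X := AddEquiv.refl X

theorem inflVal_smul (r : R) (x : c.Infl X) : c.inflVal (r • x) = c.proj r • c.inflVal x := rfl

theorem e_smul_infl (x : c.Infl X) : c.e • x = x :=
  c.inflVal.injective (by rw [inflVal_smul, proj_e, one_smul])

theorem incl_smul_infl (a : RA) (x : c.Infl X) :
    c.inflVal (c.incl a • x) = a • c.inflVal x := by
  rw [inflVal_smul, proj_incl]

instance [Module.Finite RA X] : Module.Finite R (c.Infl X) := by
  obtain ⟨n, s, hs⟩ := Submodule.fg_iff_exists_fin_generating_family.1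
    (Module.Finite.fg_top (R := RA) (M := X))
  refine ⟨Submodule.fg_iff_exists_fin_generating_family.2 ⟨n, c.inflVal.symm ∘ s, ?_⟩⟩
  refine eq_top_iff.2 fun x _ => ?_
  obtain ⟨a, ha⟩ := (Submodule.mem_span_range_iff_exists_fun RA).1
    (hs ▸ Submodule.mem_top (x := c.inflVal x))
  refine (Submodule.mem_span_range_iff_exists_fun R).2 ⟨fun i => c.incl (a i),
    c.inflVal.injective ?_⟩
  rw [map_sum, ← ha]
  exact Finset.sum_congr rfl fun i _ => c.incl_smul_infl (a i) _

/-- Extension by zero of an isomorphism. -/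
def inflCongr (f : X ≃ₗ[RA] Y) : c.Infl X ≃ₗ[R] c.Infl Y where
  toFun x := c.inflVal.symm (f (c.inflVal x))
  invFun y := c.inflVal.symm (f.symm (c.inflVal y))
  map_add' x y := map_add f (c.inflVal x) (c.inflVal y)
  map_smul' r x := map_smul f (c.proj r) (c.inflVal x)
  left_inv x := f.left_inv (c.inflVal x)
  right_inv y := f.right_inv (c.inflVal y)

/-- Extension by zero commutes with products. -/
def inflProd : c.Infl (X × Y) ≃ₗ[R] c.Infl X × c.Infl Y where
  toFun x := (c.inflVal.symm (c.inflVal x).1, c.inflVal.symm (c.inflVal x).2)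
  invFun y := c.inflVal.symm (c.inflVal y.1, c.inflVal y.2)
  map_add' _ _ := rfl
  map_smul' _ _ := rfl
  left_inv _ := rfl
  right_inv _ := rfl

/-- Extension by zero, as an operation on finitely generated modules. -/
def infl (X : FGModuleCat.{u} RA) : FGModuleCat.{u} R := FGModuleCat.of R (c.Infl X)

end Infl

section Res

variable {M N : Type u} [AddCommGroup M] [AddCommGroup N] [Module R M] [Module R N]

/-- The elements of `M` fixed by `e`. -/
def fixed (M : Type u) [AddCommGroup M] [Module R M] : AddSubgroup M where
  carrier := {x | c.e • x = x}
  zero_mem' := smul_zero _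
  add_mem' {x y} hx hy := by
    show c.e • (x + y) = x + y
    rw [smul_add, show c.e • x = x from hx, show c.e • y = y from hy]
  neg_mem' {x} hx := by
    show c.e • -x = -x
    rw [smul_neg, show c.e • x = x from hx]

theorem e_smul_mem_fixed (x : M) : c.e • x ∈ c.fixed M := by
  show c.e • c.e • x = c.e • x
  rw [smul_smul, e_mul_e]

/-- The restriction `e M` of a module `M` to the corner. -/
def Res (M : Type u) [AddCommGroup M] [Module R M] : Type u := c.fixed M

instance : AddCommGroup (c.Res M) := inferInstanceAs (AddCommGroup (c.fixed M))

/-- The inclusion `e M ⊆ M`. -/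
def resVal : c.Res M →+ M := (c.fixed M).subtype

theorem resVal_injective : Function.Injective (c.resVal (M := M)) := Subtype.val_injective

theorem e_smul_resVal (x : c.Res M) : c.e • c.resVal x = c.resVal x := x.2

/-- An element of `M` fixed by `e`, as an element of `e M`. -/
def resMk (x : M) (hx : c.e • x = x) : c.Res M := ⟨x, hx⟩

theorem resVal_resMk (x : M) (hx : c.e • x = x) : c.resVal (c.resMk x hx) = x := rfl

instance : SMul RA (c.Res M) :=
  ⟨fun a x => c.resMk (c.incl a • c.resVal x) (by rw [smul_smul, e_mul_incl])⟩

theorem resVal_smul (a : RA) (x : c.Res M) : c.resVal (a • x) = c.incl a • c.resVal x := rfl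

instance : Module RA (c.Res M) where
  one_smul x := c.resVal_injective (c.e_smul_resVal x)
  mul_smul a b x := c.resVal_injective (by simp only [resVal_smul, map_mul, mul_smul])
  smul_zero a := c.resVal_injective (by rw [resVal_smul, map_zero, smul_zero])
  smul_add a x y := c.resVal_injective (by simp only [resVal_smul, map_add, smul_add])
  add_smul a b x := c.resVal_injective (by simp only [resVal_smul, map_add, add_smul])
  zero_smul x := c.resVal_injective (by simp only [resVal_smul, map_zero, zero_smul])

/-- A submodule of `e M` is determined by the submodule of `M` it generates, as `W = e (R W)`. -/
instance [IsNoetherian R M] : IsNoetherian RA (c.Res M) := by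
  have key : ∀ (W : Submodule RA (c.Res M)) (y : M), y ∈ Submodule.span R (c.resVal '' W) →
      ∀ r : R, ∃ w ∈ W, c.resVal w = c.e • r • y := by
    intro W y hy
    induction hy using Submodule.span_induction with
    | mem y hy =>
      obtain ⟨w, hw, rfl⟩ := hy
      refine fun r => ⟨c.proj r • w, W.smul_mem _ hw, ?_⟩
      rw [resVal_smul, incl_proj, mul_smul, mul_smul]
      exact congrArg (fun t => c.e • r • t) (c.e_smul_resVal w)
    | zero => exact fun r => ⟨0, W.zero_mem, by simp⟩
    | add x y _ _ hx hy =>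
      intro r
      obtain ⟨w, hw, h⟩ := hx r
      obtain ⟨w', hw', h'⟩ := hy r
      exact ⟨w + w', W.add_mem hw hw', by rw [map_add, h, h', smul_add, smul_add]⟩
    | smul s y _ hy => exact fun r => by rw [smul_smul r]; exact hy (r * s)
  have hmono : StrictMono fun W : Submodule RA (c.Res M) =>
      Submodule.span R (c.resVal '' (W : Set (c.Res M))) := by
    refine Monotone.strictMono_of_injective
      (fun W W' h => Submodule.span_mono (Set.image_mono h)) fun W W' h => ?_
    have : ∀ W W' : Submodule RA (c.Res M), Submodule.span R (c.resVal '' (W : Set (c.Res M))) =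
        Submodule.span R (c.resVal '' (W' : Set (c.Res M))) → W ≤ W' := by
      intro W W' h x hx
      obtain ⟨w, hw, hwx⟩ := key W' (c.resVal x) (h ▸ Submodule.subset_span ⟨x, hx, rfl⟩) 1
      rw [one_smul, e_smul_resVal] at hwx
      rwa [← c.resVal_injective hwx]
    exact le_antisymm (this W W' h) (this W' W h.symm)
  have hwf : WellFoundedGT (Submodule R M) := inferInstance
  exact isNoetherian_iff'.2 hmono.wellFoundedGT

/-- The restriction of a homomorphism. -/
def resMap (f : M →ₗ[R] N) : c.Res M →ₗ[RA] c.Res N where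
  toFun x := c.resMk (f (c.resVal x)) (by rw [← map_smul, e_smul_resVal])
  map_add' x y := c.resVal_injective (by
    rw [resVal_resMk, map_add, map_add, map_add, resVal_resMk, resVal_resMk])
  map_smul' a x := c.resVal_injective (by
    rw [resVal_resMk, RingHom.id_apply, resVal_smul, resVal_smul, map_smul, resVal_resMk])

theorem resVal_resMap (f : M →ₗ[R] N) (x : c.Res M) :
    c.resVal (c.resMap f x) = f (c.resVal x) := rfl

/-- The restriction of an isomorphism. -/
def resCongr (f : M ≃ₗ[R] N) : c.Res M ≃ₗ[RA] c.Res N :=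
  LinearEquiv.ofLinearMap (c.resMap f.toLinearMap) (c.resMap f.symm.toLinearMap)
    (LinearMap.ext fun x => c.resVal_injective (f.right_inv (c.resVal x)))
    (LinearMap.ext fun x => c.resVal_injective (f.left_inv (c.resVal x)))

/-- Restriction commutes with products. -/
def resProd : c.Res (M × N) ≃ₗ[RA] c.Res M × c.Res N :=
  LinearEquiv.ofLinearMap
    (LinearMap.prod (c.resMap (LinearMap.fst R M N)) (c.resMap (LinearMap.snd R M N)))
    (LinearMap.coprod (c.resMap (LinearMap.inl R M N)) (c.resMap (LinearMap.inr R M N)))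
    (LinearMap.ext fun x => Prod.ext
      (c.resVal_injective (by simp [resVal_resMap]))
      (c.resVal_injective (by simp [resVal_resMap])))
    (LinearMap.ext fun x => c.resVal_injective (by
      simp [resVal_resMap]))

/-- The restriction of an extension by zero. -/
def resInfl (X : Type u) [AddCommGroup X] [Module RA X] : c.Res (c.Infl X) ≃ₗ[RA] X where
  toFun x := c.inflVal (c.resVal x)
  invFun x := c.resMk (c.inflVal.symm x) (c.e_smul_infl _)
  map_add' _ _ := rfl
  map_smul' a x := c.incl_smul_infl a (c.resVal x)
  left_inv _ := rfl
  right_inv _ := rfl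

variable [IsNoetherianRing R]

/-- Restriction to the corner, as an operation on finitely generated modules. -/
def res (M : FGModuleCat.{u} R) : FGModuleCat.{u} RA := FGModuleCat.of RA (c.Res M)

theorem isSummand_res {M N : FGModuleCat.{u} R} (h : IsSummand M N) :
    IsSummand (c.res M) (c.res N) := by
  obtain ⟨L, ⟨f⟩⟩ := h
  exact ⟨c.res L, ⟨(c.resCongr f).trans c.resProd⟩⟩

theorem mk_res_prod {M M' M'' : FGModuleCat.{u} R} (h : Nonempty (M ≃ₗ[R] M' × M'')) :
    K0.mk (c.res M) = K0.mk (c.res M') + K0.mk (c.res M'') := by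
  obtain ⟨f⟩ := h
  exact K0.mk_prod ⟨(c.resCongr f).trans c.resProd⟩

end Res

theorem mk_infl_prod {X X' X'' : FGModuleCat.{u} RA} (h : Nonempty (X ≃ₗ[RA] X' × X'')) :
    K0.mk (c.infl X) = K0.mk (c.infl X') + K0.mk (c.infl X'') := by
  obtain ⟨f⟩ := h
  exact K0.mk_prod ⟨(c.inflCongr f).trans c.inflProd⟩

end Corner

/-! ### Syzygies over a square ring -/

/-- A ring `R` with complementary corners `RA` and `RB` such that the off-diagonal parts of `R`
annihilate the radical of every left module. The vertices of `R` are those of `RA`, embedded by `i`,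
and those of `RB`, embedded by `j`, with the same idempotents and characters. -/
structure IsSquareRing {k R RA RB V VA VB : Type u} [Field k] [Ring R] [Ring RA] [Ring RB]
    [Fintype V] [Fintype VA] [Fintype VB] (c : Corner R RA) (d : Corner R RB)
    (S : VertexSystem k R V) (SA : VertexSystem k RA VA) (SB : VertexSystem k RB VB)
    (i : VA → V) (j : VB → V) : Prop where
  e_add_e : c.e + d.e = 1
  incl_idem_left : ∀ v, c.incl (SA.idem v) = S.idem (i v)
  incl_idem_right : ∀ w, d.incl (SB.idem w) = S.idem (j w)
  char_incl_left : ∀ v a, S.char (i v) (c.incl a) = SA.char v a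
  char_incl_right : ∀ w b, S.char (j w) (d.incl b) = SB.char w b
  vertex : ∀ v, (∃ v', i v' = v) ∨ ∃ w, j w = v
  left_right : ∀ r, ∀ s ∈ S.rad, c.e * r * d.e * s = 0
  right_left : ∀ r, ∀ s ∈ S.rad, d.e * r * c.e * s = 0

/-- A generating family of a semisimple module contains elements at every vertex of its support. -/
theorem VertexSystem.exists_eq_of_generates {k R V : Type u} [Field k] [Ring R] [Fintype V]
    (S : VertexSystem k R V) {M : Type*} [AddCommGroup M] [Module R M] {n : ℕ} {v : Fin n → V}
    {m : Fin n → M} (hm : S.Generates v m) (hM : ∀ r ∈ S.rad, ∀ x : M, r • x = 0) (w : V)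
    (hw : ∃ x : M, S.idem w • x ≠ 0) : ∃ l, v l = w := by
  by_contra hcon
  push Not at hcon
  obtain ⟨x, hx⟩ := hw
  obtain ⟨a, rfl⟩ := (Submodule.mem_span_range_iff_exists_fun R).1
    (hm.2 ▸ Submodule.mem_top (x := x))
  refine hx ?_
  rw [Finset.smul_sum]
  refine Finset.sum_eq_zero fun l _ => ?_
  rw [← hm.1 l, smul_smul, smul_smul]
  refine hM _ (S.mem_rad_of_mul_idem (v := v l) ?_ ?_) _
  · rw [mul_assoc, S.idem_mul_self]
  · rw [map_mul, map_mul, S.char_idem_of_ne _ _ (hcon l), zero_mul, zero_mul]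

namespace IsSquareRing

variable {k R RA RB V VA VB : Type u} [Field k] [Ring R] [Ring RA] [Ring RB]
  [Fintype V] [Fintype VA] [Fintype VB] {c : Corner R RA} {d : Corner R RB}
  {S : VertexSystem k R V} {SA : VertexSystem k RA VA} {SB : VertexSystem k RB VB}
  {i : VA → V} {j : VB → V}

theorem symm (h : IsSquareRing c d S SA SB i j) : IsSquareRing d c S SB SA j i where
  e_add_e := by rw [add_comm, h.e_add_e]
  incl_idem_left := h.incl_idem_right
  incl_idem_right := h.incl_idem_left
  char_incl_left := h.char_incl_right
  char_incl_right := h.char_incl_left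
  vertex v := (h.vertex v).symm
  left_right := h.right_left
  right_left := h.left_right

theorem idem_mul_e (h : IsSquareRing c d S SA SB i j) (v : VA) :
    S.idem (i v) * c.e = S.idem (i v) := by
  rw [← h.incl_idem_left, c.incl_mul_e]

theorem e_mul_e_right (h : IsSquareRing c d S SA SB i j) : c.e * d.e = 0 := by
  rw [eq_sub_of_add_eq' h.e_add_e, mul_sub, mul_one, c.e_mul_e, sub_self]

theorem e_smul_add (h : IsSquareRing c d S SA SB i j) {M : Type u} [AddCommGroup M] [Module R M]
    (x : M) : c.e • x + d.e • x = x := by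
  rw [← add_smul, h.e_add_e, one_smul]

theorem e_smul_e_smul (h : IsSquareRing c d S SA SB i j) {M : Type u} [AddCommGroup M]
    [Module R M] (x : M) : c.e • d.e • x = 0 := by
  rw [smul_smul, h.e_mul_e_right, zero_smul]

theorem e_smul_infl_eq_zero (h : IsSquareRing c d S SA SB i j) {X : Type u} [AddCommGroup X]
    [Module RA X]
    (x : c.Infl X) : d.e • x = 0 := by
  have := h.e_smul_add x
  rwa [c.e_smul_infl, add_eq_left] at this

theorem subsingleton_res_infl (h : IsSquareRing c d S SA SB i j) (X : Type u) [AddCommGroup X]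
    [Module RB X] : Subsingleton (c.Res (d.Infl X)) :=
  ⟨fun x y => c.resVal_injective (by
    rw [← c.e_smul_resVal, ← c.e_smul_resVal y, h.symm.e_smul_infl_eq_zero,
      h.symm.e_smul_infl_eq_zero])⟩

/-- A module on which the off-diagonal parts of `R` act as zero is the direct sum of its
restrictions. -/
def splitEquiv (h : IsSquareRing c d S SA SB i j) (M : Type u) [AddCommGroup M] [Module R M]
    (h₁ : ∀ (r : R) (x : M), c.e • r • d.e • x = 0)
    (h₂ : ∀ (r : R) (x : M), d.e • r • c.e • x = 0) :
    M ≃ₗ[R] c.Infl (c.Res M) × d.Infl (d.Res M) where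
  toFun x := (c.inflVal.symm (c.resMk (c.e • x) (c.e_smul_mem_fixed x)),
    d.inflVal.symm (d.resMk (d.e • x) (d.e_smul_mem_fixed x)))
  invFun y := c.resVal (c.inflVal y.1) + d.resVal (d.inflVal y.2)
  map_add' x y := Prod.ext (c.resVal_injective (smul_add c.e x y))
    (d.resVal_injective (smul_add d.e x y))
  map_smul' r x := by
    refine Prod.ext (c.resVal_injective ?_) (d.resVal_injective ?_)
    · show c.e • r • x = c.incl (c.proj r) • c.e • x
      conv_lhs => rw [← h.e_smul_add x]
      rw [smul_add, smul_add, h₁, add_zero, c.incl_proj, smul_smul, smul_smul, smul_smul,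
        mul_assoc _ (c.incl 1), show c.incl 1 * c.e = c.e from c.e_mul_e]
      rfl
    · show d.e • r • x = d.incl (d.proj r) • d.e • x
      conv_lhs => rw [← h.e_smul_add x]
      rw [smul_add, smul_add, h₂, zero_add, d.incl_proj, smul_smul, smul_smul, smul_smul,
        mul_assoc _ (d.incl 1), show d.incl 1 * d.e = d.e from d.e_mul_e]
      rfl
  left_inv x := h.e_smul_add x
  right_inv y := by
    refine Prod.ext (c.resVal_injective ?_) (d.resVal_injective ?_)
    · show c.e • (c.resVal (c.inflVal y.1) + d.resVal (d.inflVal y.2)) = c.resVal (c.inflVal y.1)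
      rw [smul_add, c.e_smul_resVal, ← d.e_smul_resVal, h.e_smul_e_smul, add_zero]
    · show d.e • (c.resVal (c.inflVal y.1) + d.resVal (d.inflVal y.2)) = d.resVal (d.inflVal y.2)
      rw [smul_add, d.e_smul_resVal, ← c.e_smul_resVal, h.symm.e_smul_e_smul, zero_add]

theorem e_smul_e_smul_of_mem_rad (h : IsSquareRing c d S SA SB i j) {M : Type u} [AddCommGroup M]
    [Module R M] {x : M} (hx : x ∈ S.rad • (⊤ : Submodule R M)) (r : R) :
    c.e • r • d.e • x = 0 := by
  induction hx using Submodule.smul_induction_on' with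
  | smul s hs y _ =>
    rw [smul_smul, smul_smul, smul_smul, h.left_right r s hs, zero_smul]
  | add x _ y _ hx hy => rw [smul_add, smul_add, smul_add, hx, hy, add_zero]

/-- A submodule of the radical of a module is the direct sum of its restrictions. -/
def splitEquivOfLeRad (h : IsSquareRing c d S SA SB i j) {M : Type u} [AddCommGroup M] [Module R M]
    {U : Submodule R M} (hU : U ≤ S.rad • ⊤) : U ≃ₗ[R] c.Infl (c.Res U) × d.Infl (d.Res U) :=
  h.splitEquiv U (fun r x => Subtype.ext (h.e_smul_e_smul_of_mem_rad (hU x.2) r))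
    (fun r x => Subtype.ext (h.symm.e_smul_e_smul_of_mem_rad (hU x.2) r))

theorem exists_vertex_of_minimallyGenerates (h : IsSquareRing c d S SA SB i j) {X : Type u}
    [AddCommGroup X] [Module RA X] {n : ℕ} {v : Fin n → V} {m : Fin n → c.Infl X}
    (hm : S.MinimallyGenerates v m) (l : Fin n) : ∃ w, i w = v l := by
  refine (h.vertex (v l)).resolve_right ?_
  rintro ⟨w, hw⟩
  have h0 : m l = 0 := by
    rw [← hm.1.1 l, ← hw, ← h.symm.idem_mul_e, mul_smul, h.e_smul_infl_eq_zero, smul_zero]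
  classical
  have h1 := hm.2 (Pi.single l (S.idem (v l))) (fun l' => ?_) ?_ l
  · rw [Pi.single_eq_same] at h1
    have := S.mem_rad.1 h1 (v l)
    rw [S.char_idem_self] at this
    exact one_ne_zero this
  · by_cases hl : l' = l
    · subst hl; rw [Pi.single_eq_same, S.idem_mul_self]
    · rw [Pi.single_eq_of_ne hl, zero_mul]
  · refine Finset.sum_eq_zero fun l' _ => ?_
    by_cases hl : l' = l
    · subst hl; rw [h0, smul_zero]
    · rw [Pi.single_eq_of_ne hl, zero_smul]

/-- A minimal generating family over `R` of an `RA`-module is minimal over `RA`, so that the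
projective covers over `R` and over `RA` have the same vertices. -/
theorem minimallyGenerates_inflVal (h : IsSquareRing c d S SA SB i j) {X : Type u}
    [AddCommGroup X] [Module RA X] {n : ℕ} {w : Fin n → VA} {m : Fin n → c.Infl X}
    (hm : S.MinimallyGenerates (i ∘ w) m) : SA.MinimallyGenerates w (fun l => c.inflVal (m l)) := by
  refine ⟨⟨fun l => ?_, eq_top_iff.2 fun x _ => ?_⟩, fun a ha h0 l => ?_⟩
  · rw [← c.incl_smul_infl, h.incl_idem_left]
    exact congrArg c.inflVal (hm.1.1 l)
  · obtain ⟨r, hr⟩ := (Submodule.mem_span_range_iff_exists_fun R).1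
      (hm.1.2 ▸ Submodule.mem_top (x := c.inflVal.symm x))
    refine (Submodule.mem_span_range_iff_exists_fun RA).2 ⟨fun l => c.proj (r l), ?_⟩
    rw [← c.inflVal.apply_symm_apply x, ← hr, map_sum]
    exact Finset.sum_congr rfl fun l _ => (c.inflVal_smul _ _).symm
  · refine SA.mem_rad_of_mul_idem (ha l) ?_
    rw [← h.char_incl_left]
    refine S.mem_rad.1 (hm.2 (fun l => c.incl (a l)) (fun l => ?_) ?_ l) _
    · rw [Function.comp_apply, ← h.incl_idem_left, ← map_mul, ha]
    · refine c.inflVal.injective ?_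
      rw [map_sum, map_zero, ← h0]
      exact Finset.sum_congr rfl fun l _ => c.incl_smul_infl _ _

section Noetherian

variable [IsNoetherianRing R]

/-- The syzygies of an `R`-module are direct sums of an `RA`-module and an `RB`-module. -/
theorem exists_omegaBar_eq (h : IsSquareRing c d S SA SB i j) (M : FGModuleCat.{u} R) :
    ∃ (X : FGModuleCat.{u} RA) (Y : FGModuleCat.{u} RB),
      omegaBar R (K0.mk M) = K0.mk (c.infl X) + K0.mk (d.infl Y) := by
  obtain ⟨n, v, m, hm⟩ := S.exists_minimallyGenerates M
  have hsyz := S.isSyzygy_of_ker_le_rad (S.coverHom v m) (S.coverHom_surjective hm.1)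
    fun x => S.mem_rad_of_coverHom_eq_zero hm
  refine ⟨c.res (kerFG (S.coverHom v m)), d.res (kerFG (S.coverHom v m)), ?_⟩
  rw [omegaBar_of_isSyzygy hsyz]
  exact K0.mk_prod ⟨h.splitEquivOfLeRad (U := LinearMap.ker (S.coverHom v m))
    fun x hx => S.mem_rad_smul_top (S.mem_rad_of_coverHom_eq_zero hm hx)⟩

variable [IsNoetherianRing RA]

/-- The restriction to a corner of a projective module at a vertex of that corner. -/
def resProjEquiv (h : IsSquareRing c d S SA SB i j) (v : VA) :
    c.Res (S.proj (i v)) ≃ₗ[RA] SA.proj v where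
  toFun x := SA.projMk v (c.proj (S.projVal _ (c.resVal x))) (by
    rw [← c.proj_incl (SA.idem v), ← map_mul, h.incl_idem_left, S.projVal_mul])
  invFun y := c.resMk (S.projMk (i v) (c.incl (SA.projVal v y)) (by
      rw [← h.incl_idem_left, ← map_mul, SA.projVal_mul]))
    (S.projVal_injective _ (c.e_mul_incl _))
  map_add' x y := SA.projVal_injective v (by simp only [SA.projVal_projMk, map_add])
  map_smul' a x := SA.projVal_injective v (by
    simp only [SA.projVal_projMk, c.resVal_smul, map_smul, smul_eq_mul, map_mul, c.proj_incl,
      RingHom.id_apply])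
  left_inv x := c.resVal_injective (S.projVal_injective _ (by
    rw [c.resVal_resMk, S.projVal_projMk, SA.projVal_projMk]
    have h1 : c.e * S.projVal _ (c.resVal x) = S.projVal _ (c.resVal x) := by
      rw [← smul_eq_mul, ← map_smul, c.e_smul_resVal]
    rw [c.incl_proj, show c.incl 1 = c.e from rfl, h1, ← S.projVal_mul, mul_assoc, h.idem_mul_e]))
  right_inv y := SA.projVal_injective v (c.proj_incl (SA.projVal v y))

theorem projective_res_proj (h : IsSquareRing c d S SA SB i j) (v : VA) :
    Module.Projective RA (c.res (S.proj (i v))) := by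
  refine Module.Projective.of_split (M := RA) (SA.projVal v ∘ₗ (h.resProjEquiv v).toLinearMap)
    ((h.resProjEquiv v).symm.toLinearMap ∘ₗ LinearMap.toSpanSingleton RA _ (SA.gen v)) ?_
  refine LinearMap.ext fun x => ?_
  show (h.resProjEquiv v).symm (SA.projVal v (h.resProjEquiv v x) • SA.gen v) = x
  exact (congrArg (h.resProjEquiv v).symm (SA.projVal_smul_gen v _)).trans
    ((h.resProjEquiv v).symm_apply_apply x)

/-- The restriction to a corner of a projective module at vertices of that corner. -/
def resCoverEquiv (h : IsSquareRing c d S SA SB i j) {n : ℕ} (w : Fin n → VA) :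
    c.Res (S.cover (i ∘ w)) ≃ₗ[RA] SA.cover w :=
  LinearEquiv.ofLinearMap
    (LinearMap.pi fun l => (h.resProjEquiv (w l)).toLinearMap ∘ₗ c.resMap
      (LinearMap.proj l : (∀ l, S.proj ((i ∘ w) l)) →ₗ[R] S.proj ((i ∘ w) l)))
    { toFun := fun y => c.resMk
        (fun l => c.resVal ((h.resProjEquiv (w l)).symm ((y : ∀ l, SA.proj (w l)) l)) :
          ∀ l, S.proj ((i ∘ w) l)) (funext fun l => c.e_smul_resVal _)
      map_add' := fun x y => c.resVal_injective (funext fun l => by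
        show c.resVal ((h.resProjEquiv (w l)).symm
          ((x : ∀ l, SA.proj (w l)) l + (y : ∀ l, SA.proj (w l)) l)) = _
        rw [map_add, map_add]; rfl)
      map_smul' := fun a x => c.resVal_injective (funext fun l => by
        show c.resVal ((h.resProjEquiv (w l)).symm (a • (x : ∀ l, SA.proj (w l)) l)) = _
        rw [map_smul]; rfl) }
    (LinearMap.ext fun y => funext fun l => (h.resProjEquiv (w l)).right_inv _)
    (LinearMap.ext fun x => c.resVal_injective (funext fun l =>
      congrArg c.resVal ((h.resProjEquiv (w l)).left_inv _)))

/-- The syzygy over `R` of an `RA`-module `X` is the direct sum of the syzygy over `RA` and of the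
restriction to `RB` of the projective cover of `X` over `R`. -/
theorem exists_isSyzygy_infl (h : IsSquareRing c d S SA SB i j) (X : FGModuleCat.{u} RA) :
    ∃ (n : ℕ) (w : Fin n → VA) (m : Fin n → X) (N : FGModuleCat.{u} RA) (U : FGModuleCat.{u} R),
      SA.Generates w m ∧ IsSyzygy X N ∧ IsSyzygy (c.infl X) U ∧
        Nonempty (U ≃ₗ[R] c.Infl N × d.Infl (d.Res (S.cover (i ∘ w)))) := by
  obtain ⟨n, v, m, hm⟩ := S.exists_minimallyGenerates (c.Infl X)
  choose w hw using h.exists_vertex_of_minimallyGenerates hm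
  obtain rfl : i ∘ w = v := funext hw
  have hm' := h.minimallyGenerates_inflVal hm
  set m' : Fin n → X := fun l => c.inflVal (m l) with hm'_def
  let f : S.cover (i ∘ w) →ₗ[R] c.infl X := S.coverHom (i ∘ w) m
  let g : SA.cover w →ₗ[RA] X := SA.coverHom w m'
  have hfg : ∀ x, g (h.resCoverEquiv w x) = c.inflVal (f (c.resVal x)) := by
    intro x
    refine (SA.coverHom_apply w m' _).trans (Eq.trans ?_
      ((congrArg c.inflVal (S.coverHom_apply (i ∘ w) m _)).trans (map_sum c.inflVal _ _)).symm)
    rfl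
  refine ⟨n, w, m', kerFG g, kerFG f, hm'.1,
    SA.isSyzygy_of_ker_le_rad g (SA.coverHom_surjective hm'.1)
      fun x => SA.mem_rad_of_coverHom_eq_zero hm',
    S.isSyzygy_of_ker_le_rad f (S.coverHom_surjective hm.1)
      fun x => S.mem_rad_of_coverHom_eq_zero hm, ?_⟩
  let e₁ : c.Res (LinearMap.ker f) →ₗ[RA] LinearMap.ker g :=
    LinearMap.codRestrict _ ((h.resCoverEquiv w).toLinearMap ∘ₗ c.resMap (LinearMap.ker f).subtype)
      fun x => by
        rw [LinearMap.mem_ker]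
        refine (hfg _).trans ?_
        rw [c.resVal_resMap]
        exact (congrArg c.inflVal (c.resVal x).2).trans (map_zero _)
  have he₁ : Function.Bijective e₁ := by
    constructor
    · intro x y hxy
      have h1 := (h.resCoverEquiv w).injective (congrArg Subtype.val hxy)
      exact c.resVal_injective (Subtype.ext (congrArg c.resVal h1))
    · intro y
      have h1 : f (c.resVal ((h.resCoverEquiv w).symm y.1)) = 0 := by
        refine c.inflVal.injective ?_
        refine ((hfg _).symm.trans (congrArg g ((h.resCoverEquiv w).apply_symm_apply y.1))).trans ?_
        exact y.2
      refine ⟨c.resMk ⟨c.resVal ((h.resCoverEquiv w).symm y.1), h1⟩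
        (Subtype.ext (c.e_smul_resVal _)), Subtype.ext ?_⟩
      exact (h.resCoverEquiv w).apply_symm_apply y.1
  have he₂ : Function.Bijective (d.resMap (LinearMap.ker f).subtype) := by
    constructor
    · intro x y hxy
      exact d.resVal_injective (Subtype.ext (congrArg d.resVal hxy))
    · intro y
      have h1 : f (d.resVal y) = 0 := by
        rw [← d.e_smul_resVal, map_smul]
        exact h.e_smul_infl_eq_zero (X := X) _
      exact ⟨d.resMk ⟨d.resVal y, h1⟩ (Subtype.ext (d.e_smul_resVal _)), rfl⟩
  exact ⟨(h.splitEquivOfLeRad (U := LinearMap.ker f) fun x hx =>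
    S.mem_rad_smul_top (S.mem_rad_of_coverHom_eq_zero hm hx)).trans
      ((c.inflCongr (LinearEquiv.ofBijective e₁ he₁)).prodCongr
        (d.inflCongr (LinearEquiv.ofBijective _ he₂)))⟩

end Noetherian

end IsSquareRing

/-! ### Endomorphisms and finitely generated subgroups of abelian groups -/

section FinitelyGenerated

variable {G : Type*} [AddCommGroup G]

theorem AddSubgroup.FG.of_le_of_commGroup {H K : AddSubgroup G} (hK : K.FG) (h : H ≤ K) : H.FG := by
  have h1 : (AddSubgroup.toIntSubmodule K).FG := (Submodule.fg_iff_addSubgroup_fg _).2 hK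
  exact (Submodule.fg_iff_addSubgroup_fg (AddSubgroup.toIntSubmodule H)).1
    (h1.of_le (S := AddSubgroup.toIntSubmodule H) h)

theorem AddSubgroup.FG.map_of_commGroup {G' : Type*} [AddCommGroup G'] {H : AddSubgroup G}
    (hH : H.FG) (f : G →+ G') : (H.map f).FG := by
  have h1 : (AddSubgroup.toIntSubmodule H).FG := (Submodule.fg_iff_addSubgroup_fg _).2 hH
  exact (Submodule.fg_iff_addSubgroup_fg _).1 (h1.map f.toIntLinearMap)

theorem AddSubgroup.FG.of_map_mk {H F : AddSubgroup G} (hF : F.FG)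
    (hH : (H.map (QuotientAddGroup.mk' F)).FG) : H.FG := by
  let q : G →ₗ[ℤ] G ⧸ F := (QuotientAddGroup.mk' F).toIntLinearMap
  refine (Submodule.fg_iff_addSubgroup_fg (AddSubgroup.toIntSubmodule H)).1
    (Submodule.fg_of_fg_map_of_fg_inf_ker q ?_ ?_)
  · rw [Submodule.fg_iff_addSubgroup_fg]
    exact hH
  · rw [Submodule.fg_iff_addSubgroup_fg]
    refine hF.of_le_of_commGroup fun x hx => ?_
    exact (QuotientAddGroup.eq_zero_iff x).1 hx.2

/-- If `E` is generated by a finitely generated subgroup and by `f E`, then it is finitely generated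
as soon as some `f ^ s (E)` is. -/
theorem AddSubgroup.FG.of_iterate_map {f : G →+ G} (s : ℕ) {E E₀ : AddSubgroup G} (h₀ : E₀.FG)
    (h : E ≤ E₀ ⊔ E.map f) (hs : ((AddSubgroup.map f)^[s] E).FG) : E.FG := by
  induction s generalizing E E₀ with
  | zero => exact hs
  | succ s ih =>
    have h1 : (E.map f).FG := by
      refine ih (E₀ := E₀.map f) (h₀.map_of_commGroup f) ?_ hs
      rw [← AddSubgroup.map_sup]
      exact AddSubgroup.map_mono h
    exact (h₀.sup h1).of_le_of_commGroup h

theorem QuotientAddGroup.mk'_eq_zero_iff {F : AddSubgroup G} {x : G} :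
    QuotientAddGroup.mk' F x = 0 ↔ x ∈ F :=
  QuotientAddGroup.eq_zero_iff x

theorem iterate_map_mono (f : G →+ G) (s : ℕ) {E F : AddSubgroup G} (h : E ≤ F) :
    (AddSubgroup.map f)^[s] E ≤ (AddSubgroup.map f)^[s] F :=
  (Monotone.iterate (fun _ _ h => AddSubgroup.map_mono h) s) h

theorem iterate_mem_of_map_le {f : G →+ G} {E : AddSubgroup G} (hE : ∀ x ∈ E, f x ∈ E) (s : ℕ)
    {x : G} (hx : x ∈ E) : f^[s] x ∈ E := by
  induction s with
  | zero => exact hx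
  | succ s ih => rw [Function.iterate_succ_apply']; exact hE _ ih

open Polynomial in
/-- Let `f` be injective on the image of its `n`-th power, and let `E` be a finitely generated
`f`-stable subgroup. If some iterate of `z` lies in `E`, then so does a nonzero multiple of the
`n`-th iterate: by the Cayley-Hamilton theorem `f` is invertible on `E` up to torsion after finitely
many steps. -/
theorem exists_zsmul_iterate_mem {f : G →+ G} {E : AddSubgroup G} (hfg : E.FG)
    (hE : ∀ x ∈ E, f x ∈ E) (n : ℕ) (hn : ∀ m, n ≤ m → ∀ x, f^[m + 1] x = 0 → f^[m] x = 0)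
    {m : ℕ} {z : G} (hz : f^[m] z ∈ E) : ∃ a : ℤ, a ≠ 0 ∧ a • f^[n] z ∈ E := by
  have hfin : Module.Finite ℤ E :=
    Module.Finite.iff_addGroup_fg.2 ((AddGroup.fg_iff_addSubgroup_fg E).2 hfg)
  let τ : Module.End ℤ G := f.toIntLinearMap
  have hτ : ∀ (m : ℕ) (x : G), (τ ^ m) x = f^[m] x := fun m x => Module.End.pow_apply τ m x
  let τE : Module.End ℤ E := ((f.comp E.subtype).codRestrict E fun x => hE x x.2).toIntLinearMap
  have hn' : ∀ (N : ℕ) (x : G), f^[N] x = 0 → f^[n] x = 0 := by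
    intro N x hx
    rcases le_total N n with h | h
    · obtain ⟨t, rfl⟩ := Nat.exists_eq_add_of_le' h
      rw [Function.iterate_add_apply, hx, iterate_map_zero]
    · induction N, h using Nat.le_induction with
      | base => exact hx
      | succ N hN ih => exact ih (hn N hN x hx)
  obtain ⟨p, hp, hp0⟩ := LinearMap.exists_monic_and_aeval_eq_zero ℤ τE
  have hpE : ∀ (r : ℤ[X]) (x : E), (aeval τ r) (x : G) = ((aeval τE r) x : E) := by
    intro r x
    induction r using Polynomial.induction_on' with
    | add r s hr hs =>
      rw [map_add, map_add, LinearMap.add_apply, LinearMap.add_apply, hr, hs]; rfl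
    | monomial t a =>
      have : ∀ t : ℕ, (τ ^ t) (x : G) = ((τE ^ t) x : E) := by
        intro t
        induction t with
        | zero => rfl
        | succ t ih =>
          rw [pow_succ', pow_succ']
          exact congrArg f ih
      rw [aeval_monomial, aeval_monomial, Module.End.mul_apply, Module.End.mul_apply, this,
        Module.algebraMap_end_apply, Module.algebraMap_end_apply]
      rfl
  obtain ⟨q, hpq, hq⟩ : ∃ (q : ℤ[X]), p = X ^ p.natTrailingDegree * q ∧ q.coeff 0 ≠ 0 := by
    obtain ⟨q, hq⟩ := (X_pow_dvd_iff (f := p) (n := p.natTrailingDegree)).2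
      fun d hd => coeff_eq_zero_of_lt_natTrailingDegree hd
    refine ⟨q, hq, ?_⟩
    have h1 : p.coeff p.natTrailingDegree ≠ 0 := by
      have := trailingCoeff_nonzero_iff_nonzero.2 hp.ne_zero
      exact this
    have h2 := congrArg (fun r => coeff r (p.natTrailingDegree + 0)) hq
    simp only [coeff_X_pow_mul', le_refl, if_true, add_zero,
      Nat.sub_self] at h2
    rwa [← h2]
  set a := q.coeff 0 with ha
  -- `q` annihilates the `n`-th iterate of `z`
  have h1 : f^[n] ((aeval τ q) z) = 0 := by
    refine hn' (p.natTrailingDegree + m) _ ?_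
    rw [← hτ, ← Module.End.mul_apply, ← aeval_X (R := ℤ) τ, ← map_pow, aeval_X, ← map_mul,
      show X ^ (p.natTrailingDegree + m) * q = p * X ^ m by
        conv_rhs => rw [hpq]
        ring, map_mul, map_pow, aeval_X, Module.End.mul_apply, hτ]
    have := hpE p ⟨_, hz⟩
    rw [hp0] at this
    exact this
  let σ : Module.End ℤ G := aeval τ (-q.divX)
  have h2 : a • f^[n] z = (σ * τ) (f^[n] z) := by
    have h3 : (aeval τ q) (f^[n] z) = 0 := by
      rw [← hτ, ← Module.End.mul_apply, ← aeval_X (R := ℤ) τ, ← map_pow, aeval_X, ← map_mul,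
        mul_comm, map_mul, map_pow, aeval_X, Module.End.mul_apply, hτ, h1]
    rw [← divX_mul_X_add q, map_add, map_mul, aeval_X, aeval_C, LinearMap.add_apply,
      Module.algebraMap_end_apply] at h3
    rw [eq_neg_of_add_eq_zero_right h3]
    show _ = (aeval τ (-q.divX) * τ) _
    rw [map_neg, neg_mul, LinearMap.neg_apply]
  have hcomm : Commute σ τ := by
    show σ * τ = τ * σ
    rw [show τ = aeval τ (X : ℤ[X]) from (aeval_X τ).symm, ← map_mul, ← map_mul, mul_comm]
  have h4 : ∀ t : ℕ, a ^ t • f^[n] z = ((σ * τ) ^ t) (f^[n] z) := by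
    intro t
    induction t with
    | zero => simp
    | succ t ih =>
      rw [pow_succ', mul_smul, ih, ← map_zsmul, h2, pow_succ, Module.End.mul_apply ((σ * τ) ^ t)]
  refine ⟨a ^ m, pow_ne_zero _ hq, ?_⟩
  rw [h4 m, hcomm.mul_pow, Module.End.mul_apply, hτ, ← Function.iterate_add_apply, add_comm,
    Function.iterate_add_apply, ← map_pow, hpE _ ⟨_, iterate_mem_of_map_le hE n hz⟩]
  exact Subtype.mem _

end FinitelyGenerated

/-! ### The orbits and the bound for the `φ`-dimension of a square ring -/

namespace IsSquareRing

variable {k R RA RB V VA VB : Type u} [Field k] [Ring R] [Ring RA] [Ring RB]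
  [Fintype V] [Fintype VA] [Fintype VB] {c : Corner R RA} {d : Corner R RB}
  {S : VertexSystem k R V} {SA : VertexSystem k RA VA} {SB : VertexSystem k RB VB}
  {i : VA → V} {j : VB → V} [IsNoetherianRing R] [IsNoetherianRing RA]

/-- A syzygy over `RA` of an `RA`-module, namely the one that `exists_isSyzygy_infl` compares with
the syzygy over `R`. -/
noncomputable def syz (h : IsSquareRing c d S SA SB i j) (X : FGModuleCat.{u} RA) :
    FGModuleCat.{u} RA :=
  (h.exists_isSyzygy_infl X).choose_spec.choose_spec.choose_spec.choose

theorem isSyzygy_syz (h : IsSquareRing c d S SA SB i j) (X : FGModuleCat.{u} RA) :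
    IsSyzygy X (h.syz X) :=
  (h.exists_isSyzygy_infl X).choose_spec.choose_spec.choose_spec.choose_spec.choose_spec.2.1

theorem isIterSyzygy_syz (h : IsSquareRing c d S SA SB i j) (X : FGModuleCat.{u} RA) (t : ℕ) :
    IsIterSyzygy t X (h.syz^[t] X) := by
  induction t with
  | zero => exact ⟨LinearEquiv.refl _ _⟩
  | succ t ih =>
    rw [Function.iterate_succ_apply']
    exact ⟨_, ih, h.isSyzygy_syz _⟩

theorem omegaBar_mk_syz (h : IsSquareRing c d S SA SB i j) (X : FGModuleCat.{u} RA) :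
    omegaBar RA (K0.mk X) = K0.mk (h.syz X) :=
  omegaBar_of_isSyzygy (h.isSyzygy_syz X)

theorem iterate_omegaBar_mk_syz (h : IsSquareRing c d S SA SB i j) (X : FGModuleCat.{u} RA)
    (t : ℕ) : (omegaBar RA)^[t] (K0.mk X) = K0.mk (h.syz^[t] X) := by
  induction t with
  | zero => rfl
  | succ t ih =>
    rw [Function.iterate_succ_apply', Function.iterate_succ_apply', ih, h.omegaBar_mk_syz]

/-- The classes in `K₀(R)` of the iterated syzygies over `RA` of the restrictions to `RA` of the
indecomposable projective `R`-modules at the vertices of `RB`. -/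
noncomputable def orbitClass (h : IsSquareRing c d S SA SB i j) (p : VB × ℕ) : K0 R :=
  K0.mk (c.infl (h.syz^[p.2] (c.res (S.proj (j p.1)))))

/-- The subgroup of `K₀(RA)` generated by the iterated syzygies of the restrictions to `RA` of the
indecomposable projective `R`-modules at the vertices of `RB`. -/
noncomputable def cornerOrbit (_ : IsSquareRing c d S SA SB i j) : AddSubgroup (K0 RA) :=
  AddSubgroup.closure (Set.range fun p : VB × ℕ =>
    (omegaBar RA)^[p.2] (K0.mk (c.res (S.proj (j p.1)))))

theorem mem_cornerOrbit (h : IsSquareRing c d S SA SB i j) (w : VB) (t : ℕ) :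
    (omegaBar RA)^[t] (K0.mk (c.res (S.proj (j w)))) ∈ h.cornerOrbit :=
  AddSubgroup.subset_closure ⟨(w, t), rfl⟩

theorem mk_res_mem_cornerOrbit (h : IsSquareRing c d S SA SB i j) (w : VB) :
    K0.mk (c.res (S.proj (j w))) ∈ h.cornerOrbit :=
  h.mem_cornerOrbit w 0

theorem omegaBar_mem_cornerOrbit (h : IsSquareRing c d S SA SB i j) :
    ∀ x ∈ h.cornerOrbit, omegaBar RA x ∈ h.cornerOrbit := by
  have h1 : h.cornerOrbit ≤ h.cornerOrbit.comap (omegaBar RA) := by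
    refine (AddSubgroup.closure_le _).2 ?_
    rintro _ ⟨⟨w, t⟩, rfl⟩
    have := h.mem_cornerOrbit w (t + 1)
    rwa [Function.iterate_succ_apply'] at this
  exact h1

variable [IsNoetherianRing RB]

/-- The subgroup of `K₀(R)` generated by the orbits of both corners. -/
noncomputable def orbitSpan (h : IsSquareRing c d S SA SB i j) : AddSubgroup (K0 R) :=
  AddSubgroup.closure (Set.range h.orbitClass ∪ Set.range h.symm.orbitClass)

theorem orbitSpan_symm (h : IsSquareRing c d S SA SB i j) : h.symm.orbitSpan = h.orbitSpan := by
  rw [orbitSpan, orbitSpan, Set.union_comm]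

theorem orbitClass_mem (h : IsSquareRing c d S SA SB i j) (p : VB × ℕ) :
    h.orbitClass p ∈ h.orbitSpan :=
  AddSubgroup.subset_closure (Or.inl ⟨p, rfl⟩)

/-- The subgroup of `K₀(R)` generated by the starting points of the orbits of both corners. -/
noncomputable def orbitStart (h : IsSquareRing c d S SA SB i j) : AddSubgroup (K0 R) :=
  AddSubgroup.closure (Set.range (fun w => h.orbitClass (w, 0)) ∪
    Set.range fun v => h.symm.orbitClass (v, 0))

theorem orbitStart_symm (h : IsSquareRing c d S SA SB i j) : h.symm.orbitStart = h.orbitStart := by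
  rw [orbitStart, orbitStart, Set.union_comm]

theorem orbitStart_le (h : IsSquareRing c d S SA SB i j) : h.orbitStart ≤ h.orbitSpan :=
  AddSubgroup.closure_mono (Set.union_subset_union
    (Set.range_subset_iff.2 fun _ => ⟨_, rfl⟩) (Set.range_subset_iff.2 fun _ => ⟨_, rfl⟩))

theorem fg_orbitStart (h : IsSquareRing c d S SA SB i j) : h.orbitStart.FG :=
  (AddSubgroup.fg_iff _).2 ⟨_, rfl, (Set.finite_range _).union (Set.finite_range _)⟩

omit [IsNoetherianRing RA] in
theorem mk_infl_res_cover (h : IsSquareRing c d S SA SB i j) {n : ℕ} (w : Fin n → VA) :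
    K0.mk (d.infl (d.res (S.cover (i ∘ w)))) = ∑ l, h.symm.orbitClass (w l, 0) := by
  refine map_pi_of_additive (fun M => K0.mk (d.infl (d.res M))) ?_ fun l => S.proj ((i ∘ w) l)
  rintro M M' M'' ⟨f⟩
  exact d.mk_infl_prod ⟨(d.resCongr f).trans d.resProd⟩

/-- On `RA`-modules, the syzygy over `R` agrees with the syzygy over `RA` up to the restrictions of
indecomposable projective modules. -/
theorem omegaBar_mk_infl_sub_mem (h : IsSquareRing c d S SA SB i j) (X : FGModuleCat.{u} RA) :
    omegaBar R (K0.mk (c.infl X)) - K0.mk (c.infl (h.syz X)) ∈ h.orbitStart := by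
  have hspec := (h.exists_isSyzygy_infl X).choose_spec.choose_spec.choose_spec.choose_spec
  obtain ⟨-, -, hU, ⟨f⟩⟩ := hspec.choose_spec
  have h1 : omegaBar R (K0.mk (c.infl X)) = K0.mk (c.infl (h.syz X)) +
      K0.mk (d.infl (d.res (S.cover (i ∘ (h.exists_isSyzygy_infl X).choose_spec.choose)))) :=
    (omegaBar_of_isSyzygy hU).trans (K0.mk_prod ⟨f⟩)
  rw [h1, add_sub_cancel_left, h.mk_infl_res_cover]
  exact sum_mem fun l _ => AddSubgroup.subset_closure (Or.inr ⟨_, rfl⟩)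

theorem omegaBar_orbitClass_sub_mem (h : IsSquareRing c d S SA SB i j) (w : VB) (t : ℕ) :
    omegaBar R (h.orbitClass (w, t)) - h.orbitClass (w, t + 1) ∈ h.orbitStart := by
  rw [orbitClass, orbitClass, Function.iterate_succ_apply']
  exact h.omegaBar_mk_infl_sub_mem _

theorem omegaBar_mem_orbitSpan (h : IsSquareRing c d S SA SB i j) {x : K0 R}
    (hx : x ∈ h.orbitSpan) : omegaBar R x ∈ h.orbitSpan := by
  have h1 : h.orbitSpan ≤ h.orbitSpan.comap (omegaBar R) := by
    refine (AddSubgroup.closure_le _).2 ?_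
    rintro _ (⟨⟨w, t⟩, rfl⟩ | ⟨⟨w, t⟩, rfl⟩)
    · have := add_mem (h.orbitStart_le (h.omegaBar_orbitClass_sub_mem w t))
        (h.orbitClass_mem (w, t + 1))
      rwa [sub_add_cancel] at this
    · have := add_mem (h.symm.orbitStart_le (h.symm.omegaBar_orbitClass_sub_mem w t))
        (h.symm.orbitClass_mem (w, t + 1))
      rwa [sub_add_cancel, h.orbitSpan_symm] at this
  exact h1 hx

/-- The span of the orbits is generated by its image under `Ω̄` and by finitely many elements, which
makes it finitely generated as soon as one of its iterated images is. -/
theorem orbitSpan_le (h : IsSquareRing c d S SA SB i j) :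
    h.orbitSpan ≤ h.orbitStart ⊔ h.orbitSpan.map (omegaBar R) := by
  refine (AddSubgroup.closure_le _).2 ?_
  rintro _ (⟨⟨w, t⟩, rfl⟩ | ⟨⟨w, t⟩, rfl⟩)
  · rcases t with - | t
    · exact AddSubgroup.mem_sup_left (AddSubgroup.subset_closure (Or.inl ⟨w, rfl⟩))
    · rw [← sub_sub_cancel (omegaBar R (h.orbitClass (w, t))) (h.orbitClass (w, t + 1)),
        sub_eq_neg_add]
      exact add_mem (AddSubgroup.mem_sup_left (neg_mem (h.omegaBar_orbitClass_sub_mem w t)))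
        (AddSubgroup.mem_sup_right ⟨_, h.orbitClass_mem _, rfl⟩)
  · rcases t with - | t
    · exact AddSubgroup.mem_sup_left (AddSubgroup.subset_closure (Or.inr ⟨w, rfl⟩))
    · rw [← sub_sub_cancel (omegaBar R (h.symm.orbitClass (w, t))) (h.symm.orbitClass (w, t + 1)),
        sub_eq_neg_add]
      refine add_mem (AddSubgroup.mem_sup_left (neg_mem ?_))
        (AddSubgroup.mem_sup_right ⟨_, ?_, rfl⟩)
      · rw [← h.orbitStart_symm]; exact h.symm.omegaBar_orbitClass_sub_mem w t
      · rw [← h.orbitSpan_symm]; exact h.symm.orbitClass_mem _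

/-- The span of the orbits is finitely generated if it lies in a syzygy finite subgroup. -/
theorem fg_orbitSpan (h : IsSquareRing c d S SA SB i j) {O : AddSubgroup (K0 R)}
    (hle : h.orbitSpan ≤ O) (hO : SyzygyFinite O) : h.orbitSpan.FG := by
  obtain ⟨s, hs⟩ := hO
  exact AddSubgroup.FG.of_iterate_map s h.fg_orbitStart h.orbitSpan_le
    (hs.of_le_of_commGroup (iterate_map_mono _ s hle))

omit [IsNoetherianRing RB] in
theorem mk_res_mem_of_projective (h : IsSquareRing c d S SA SB i j) {F : AddSubgroup (K0 RA)}
    (hF : ∀ w, K0.mk (c.res (S.proj (j w))) ∈ F) (Q : FGModuleCat.{u} R)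
    (hQ : Module.Projective R Q) : K0.mk (c.res Q) ∈ F := by
  obtain ⟨n, v, ⟨f⟩⟩ := S.exists_equiv_cover Q hQ
  have h1 : K0.mk (c.res Q) = ∑ l, K0.mk (c.res (S.proj (v l))) := by
    refine (K0.mk_congr (M := c.res Q) (N := c.res (S.cover v)) (c.resCongr f)).trans ?_
    exact map_pi_of_additive (fun M => K0.mk (c.res M)) (fun M M' M'' f => c.mk_res_prod f)
      fun l => S.proj (v l)
  rw [h1]
  refine sum_mem fun l _ => ?_
  rcases h.vertex (v l) with ⟨w, hw⟩ | ⟨w, hw⟩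
  · rw [← hw, K0.mk_projective (h.projective_res_proj w)]; exact zero_mem _
  · rw [← hw]; exact hF w

/-- Restriction to a corner is well defined on `K₀` modulo the restrictions of the projective
modules, that is, modulo a subgroup `F` containing the classes of those. -/
noncomputable def resHom (h : IsSquareRing c d S SA SB i j) (F : AddSubgroup (K0 RA))
    (hF : ∀ w, K0.mk (c.res (S.proj (j w))) ∈ F) : K0 R →+ K0 RA ⧸ F :=
  K0.lift (fun M => QuotientAddGroup.mk' F (K0.mk (c.res M)))
    (fun M M' M'' f => by rw [c.mk_res_prod f, map_add])
    (fun Q hQ => QuotientAddGroup.mk'_eq_zero_iff.2 (h.mk_res_mem_of_projective hF Q hQ))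

omit [IsNoetherianRing RB] in
theorem resHom_infl (h : IsSquareRing c d S SA SB i j) (F : AddSubgroup (K0 RA))
    (hF : ∀ w, K0.mk (c.res (S.proj (j w))) ∈ F) (X : FGModuleCat.{u} RA) :
    h.resHom F hF (K0.mk (c.infl X)) = QuotientAddGroup.mk' F (K0.mk X) := by
  rw [resHom, K0.lift_mk]
  exact congrArg _ (K0.mk_congr (M := c.res (c.infl X)) (N := X) (c.resInfl X))

omit [IsNoetherianRing RB] in
theorem resHom_infl_right (h : IsSquareRing c d S SA SB i j) (F : AddSubgroup (K0 RA))
    (hF : ∀ w, K0.mk (c.res (S.proj (j w))) ∈ F) (Y : FGModuleCat.{u} RB) :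
    h.resHom F hF (K0.mk (d.infl Y)) = 0 := by
  rw [resHom, K0.lift_mk]
  have : Subsingleton (c.res (d.infl Y)) := h.subsingleton_res_infl Y
  rw [K0.mk_of_subsingleton (c.res (d.infl Y)), map_zero]

/-- The orbit in `K₀(RA)` is finitely generated: modulo the finitely many classes of restricted
projective modules, it is covered by the image of `orbitSpan` under restriction. -/
theorem fg_cornerOrbit (h : IsSquareRing c d S SA SB i j) (hfg : h.orbitSpan.FG) :
    h.cornerOrbit.FG := by
  let F : AddSubgroup (K0 RA) :=
    AddSubgroup.closure (Set.range fun w => K0.mk (c.res (S.proj (j w))))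
  have hF : ∀ w, K0.mk (c.res (S.proj (j w))) ∈ F := fun w => AddSubgroup.subset_closure ⟨w, rfl⟩
  have hFfg : F.FG := (AddSubgroup.fg_iff _).2 ⟨_, rfl, Set.finite_range _⟩
  refine AddSubgroup.FG.of_map_mk hFfg
    ((hfg.map_of_commGroup (h.resHom F hF)).of_le_of_commGroup ?_)
  rw [cornerOrbit, AddMonoidHom.map_closure, AddSubgroup.closure_le]
  rintro _ ⟨_, ⟨⟨w, t⟩, rfl⟩, rfl⟩
  refine ⟨_, h.orbitClass_mem (w, t), ?_⟩
  rw [orbitClass, h.resHom_infl, ← h.iterate_omegaBar_mk_syz]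

/-- Restriction maps the span of the orbits of both corners to the orbit of the one corner. -/
theorem resHom_cornerOrbit_eq_zero (h : IsSquareRing c d S SA SB i j) {x : K0 R}
    (hx : x ∈ h.orbitSpan) : h.resHom h.cornerOrbit h.mk_res_mem_cornerOrbit x = 0 := by
  have h1 : h.orbitSpan ≤ (h.resHom h.cornerOrbit h.mk_res_mem_cornerOrbit).ker := by
    refine (AddSubgroup.closure_le _).2 ?_
    rintro _ (⟨⟨w, t⟩, rfl⟩ | ⟨⟨w, t⟩, rfl⟩)
    · show h.resHom _ _ _ = 0
      rw [orbitClass, h.resHom_infl, ← h.iterate_omegaBar_mk_syz]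
      exact QuotientAddGroup.mk'_eq_zero_iff.2 (h.mem_cornerOrbit w t)
    · exact h.resHom_infl_right _ _ _
  exact h1 hx

/-- The syzygy over `R` of `RA`-modules is well defined on `K₀(RA)` modulo the orbits. -/
noncomputable def omegaInfl (h : IsSquareRing c d S SA SB i j) : K0 RA →+ K0 R ⧸ h.orbitSpan :=
  K0.lift (fun X => QuotientAddGroup.mk' h.orbitSpan (omegaBar R (K0.mk (c.infl X))))
    (fun X X' X'' f => by rw [c.mk_infl_prod f, map_add, map_add])
    (fun Q hQ => QuotientAddGroup.mk'_eq_zero_iff.2 (by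
      have h0 := (h.isSyzygy_syz Q).subsingleton_of_projective hQ
      have : Subsingleton (c.infl (h.syz Q)) := h0
      have h1 := h.orbitStart_le (h.omegaBar_mk_infl_sub_mem Q)
      rwa [K0.mk_of_subsingleton (c.infl (h.syz Q)), sub_zero] at h1))

theorem omegaInfl_mk (h : IsSquareRing c d S SA SB i j) (X : FGModuleCat.{u} RA) :
    h.omegaInfl (K0.mk X) =
      QuotientAddGroup.mk' h.orbitSpan (omegaBar R (K0.mk (c.infl X))) := by
  rw [omegaInfl, K0.lift_mk]

/-- The syzygy over `R` maps the orbit in `K₀(RA)` to the orbits in `K₀(R)`. -/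
theorem omegaInfl_eq_zero (h : IsSquareRing c d S SA SB i j) {x : K0 RA}
    (hx : x ∈ h.cornerOrbit) : h.omegaInfl x = 0 := by
  have h1 : h.cornerOrbit ≤ h.omegaInfl.ker := by
    refine (AddSubgroup.closure_le _).2 ?_
    rintro _ ⟨⟨w, t⟩, rfl⟩
    show h.omegaInfl ((omegaBar RA)^[t] (K0.mk (c.res (S.proj (j w))))) = 0
    rw [h.iterate_omegaBar_mk_syz, h.omegaInfl_mk]
    exact QuotientAddGroup.mk'_eq_zero_iff.2 (h.omegaBar_mem_orbitSpan (h.orbitClass_mem (w, t)))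
  exact h1 hx

theorem iterate_omegaBar_sub_mem (h : IsSquareRing c d S SA SB i j) (X : FGModuleCat.{u} RA)
    (t : ℕ) :
    (omegaBar R)^[t] (K0.mk (c.infl X)) - K0.mk (c.infl (h.syz^[t] X)) ∈ h.orbitSpan := by
  induction t with
  | zero => simp
  | succ t ih =>
    have h1 := h.omegaBar_mem_orbitSpan ih
    have h2 := h.orbitStart_le (h.omegaBar_mk_infl_sub_mem (h.syz^[t] X))
    have h3 := add_mem h1 h2
    rwa [map_sub, sub_add_sub_cancel, ← Function.iterate_succ_apply' (omegaBar R),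
      ← Function.iterate_succ_apply' h.syz] at h3

/-- The contribution of one corner: if some iterated syzygy of the sum of `[X] - [X']` and of an
element coming from `RB` lies in the span of the orbits, then so does a nonzero multiple of the
`n + 1`-st iterated syzygy of `[X] - [X']` alone, for `φdim RA ≤ n`. -/
theorem exists_zsmul_mem_orbitSpan (h : IsSquareRing c d S SA SB i j) [IsArtinianRing RA]
    (hfg : h.orbitSpan.FG) {n : ℕ} (hn : phiDim RA ≤ n) {m : ℕ} (X X' : FGModuleCat.{u} RA)
    (Y Y' : FGModuleCat.{u} RB)
    (h0 : (omegaBar R)^[m] (K0.mk (c.infl X) - K0.mk (c.infl X') +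
      (K0.mk (d.infl Y) - K0.mk (d.infl Y'))) ∈ h.orbitSpan) :
    ∃ a : ℤ, a ≠ 0 ∧
      a • (omegaBar R)^[n + 1] (K0.mk (c.infl X) - K0.mk (c.infl X')) ∈ h.orbitSpan := by
  -- replace syzygies over `R` by syzygies over the corners, and restrict to `RA`
  have h1 := sub_mem h0 (add_mem
    (sub_mem (h.iterate_omegaBar_sub_mem X m) (h.iterate_omegaBar_sub_mem X' m))
    (sub_mem (h.orbitSpan_symm ▸ h.symm.iterate_omegaBar_sub_mem Y m)
      (h.orbitSpan_symm ▸ h.symm.iterate_omegaBar_sub_mem Y' m)))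
  have h2 := h.resHom_cornerOrbit_eq_zero h1
  simp only [iterate_map_add, iterate_map_sub] at h2
  rw [show ∀ a b p q s t u v : K0 R, a - b + (p - q) - ((a - s) - (b - t) + ((p - u) - (q - v))) =
    s - t + (u - v) from fun a b p q s t u v => by abel, map_add, map_sub, map_sub,
    h.resHom_infl_right, h.resHom_infl_right, sub_zero, add_zero, h.resHom_infl, h.resHom_infl,
    ← map_sub,
    ← h.iterate_omegaBar_mk_syz, ← h.iterate_omegaBar_mk_syz, ← iterate_map_sub] at h2
  have h3 := QuotientAddGroup.mk'_eq_zero_iff.1 h2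
  obtain ⟨a, ha, h4⟩ := exists_zsmul_iterate_mem (h.fg_cornerOrbit hfg)
    h.omegaBar_mem_cornerOrbit n ((phiDim_le_iff n).1 hn) h3
  refine ⟨a, ha, ?_⟩
  -- return to `R`; the use of `omegaInfl` costs the additional syzygy
  have h5 := h.omegaInfl_eq_zero h4
  rw [iterate_map_sub, h.iterate_omegaBar_mk_syz, h.iterate_omegaBar_mk_syz, map_zsmul, map_sub,
    h.omegaInfl_mk, h.omegaInfl_mk, ← map_sub, ← map_zsmul] at h5
  have h6 := QuotientAddGroup.mk'_eq_zero_iff.1 h5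
  have h7 := h.orbitSpan.zsmul_mem (h.omegaBar_mem_orbitSpan
    (sub_mem (h.iterate_omegaBar_sub_mem X n) (h.iterate_omegaBar_sub_mem X' n))) a
  have h8 := add_mem h7 h6
  rwa [← smul_add, ← map_sub, ← map_add,
    show ∀ a b s t : K0 R, a - s - (b - t) + (s - t) = a - b from fun a b s t => by abel,
    ← iterate_map_sub, ← Function.iterate_succ_apply' (omegaBar R)] at h8

/-- The bound for square rings. The class of any module decomposes over the two corners after one
syzygy; a nonzero multiple of each of the two parts reaches the span of the orbits after `n + 1`
further syzygies, where `η` governs injectivity. Torsion-freeness of `K₀` removes the multiples. -/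
theorem phiDim_le (h : IsSquareRing c d S SA SB i j) [IsArtinianRing R] [IsArtinianRing RA]
    [IsArtinianRing RB] (hfg : h.orbitSpan.FG) {n : ℕ} (hA : phiDim RA ≤ n) (hB : phiDim RB ≤ n) :
    phiDim R ≤ eta (omegaBar R) h.orbitSpan + n + 2 := by
  have hlt := eta_lt_top (omegaBar R) h.orbitSpan hfg fun x => h.omegaBar_mem_orbitSpan
  obtain ⟨r, hr⟩ := ENat.ne_top_iff_exists.1 hlt.ne
  have hr' := (eta_le_iff (omegaBar R) h.orbitSpan r).1 hr.symm.le
  rw [← hr]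
  refine le_trans ((phiDim_le_iff (r + n + 2)).2 fun m hm y hy => ?_) (by push_cast; exact le_rfl)
  obtain ⟨M, M', rfl⟩ := K0.exists_eq_sub y
  obtain ⟨X, Y, hM⟩ := h.exists_omegaBar_eq M
  obtain ⟨X', Y', hM'⟩ := h.exists_omegaBar_eq M'
  have hT : omegaBar R (K0.mk M - K0.mk M') = K0.mk (c.infl X) - K0.mk (c.infl X') +
      (K0.mk (d.infl Y) - K0.mk (d.infl Y')) := by
    rw [map_sub, hM, hM']; abel
  set y := K0.mk M - K0.mk M' with hy_def
  have h0 : (omegaBar R)^[m] (omegaBar R y) ∈ h.orbitSpan := by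
    rw [← Function.iterate_succ_apply (omegaBar R), hy]; exact zero_mem _
  obtain ⟨a, ha, h1⟩ := h.exists_zsmul_mem_orbitSpan hfg hA X X' Y Y' (hT ▸ h0)
  obtain ⟨b, hb, h2⟩ := h.symm.exists_zsmul_mem_orbitSpan (h.orbitSpan_symm ▸ hfg) hB Y Y' X X'
    (by rw [add_comm, ← hT, h.orbitSpan_symm]; exact h0)
  rw [h.orbitSpan_symm] at h2
  have h3 : (a * b) • (omegaBar R)^[n + 2] y ∈ h.orbitSpan := by
    have := add_mem (h.orbitSpan.zsmul_mem h1 b) (h.orbitSpan.zsmul_mem h2 a)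
    rwa [smul_smul, smul_smul, mul_comm b a, ← smul_add, ← iterate_map_add, ← hT,
      ← Function.iterate_succ_apply (omegaBar R)] at this
  -- the multiple of `y` lies in the orbits after `n + 2` steps, where `η` takes over
  obtain ⟨t, rfl⟩ := Nat.exists_eq_add_of_le' (show n + 2 ≤ m by omega)
  refine K0.eq_zero_of_smul_eq_zero (mul_ne_zero ha hb) ?_
  have h4 : ∀ s (x : K0 R), (omegaBar R)^[s] ((a * b) • x) = (a * b) • (omegaBar R)^[s] x :=
    fun s x => iterate_map_zsmul (omegaBar R) s x (a * b)
  rw [Function.iterate_add_apply, ← h4]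
  refine hr' t (by omega) _ h3 ?_
  rw [h4, ← Function.iterate_add_apply, show t + 1 + (n + 2) = t + (n + 2) + 1 by ring, hy,
    smul_zero]

end IsSquareRing

/-! ### Orbit classes are classes of summands of iterated syzygies -/

section Products

variable {R : Type u} [Ring R]

theorem IsSyzygy.prod {M M' N N' : FGModuleCat.{u} R} (h : IsSyzygy M N) (h' : IsSyzygy M' N') :
    IsSyzygy (FGModuleCat.of R (M × M')) (FGModuleCat.of R (N × N')) := by
  obtain ⟨P, f, hP, hf, hU, ⟨e⟩⟩ := h
  obtain ⟨P', f', hP', hf', hU', ⟨e'⟩⟩ := h'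
  refine ⟨FGModuleCat.of R (P × P'), f.prodMap f', inferInstanceAs (Module.Projective R (P × P')),
    Function.Surjective.prodMap hf hf', fun U hUt => ?_, ⟨(e.prodCongr e').trans
      { toFun := fun x => ⟨(x.1.1, x.2.1), Prod.ext x.1.2 x.2.2⟩
        invFun := fun y => (⟨y.1.1, congrArg Prod.fst (show (f y.1.1, f' y.1.2) = 0 from y.2)⟩,
          ⟨y.1.2, congrArg Prod.snd (show (f y.1.1, f' y.1.2) = 0 from y.2)⟩)
        map_add' := fun _ _ => rfl
        map_smul' := fun _ _ => rfl
        left_inv := fun _ => rfl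
        right_inv := fun _ => rfl }⟩⟩
  -- it suffices that `U` contains the kernels of `f` and `f'`, one after the other
  let i : P →ₗ[R] P × P' := LinearMap.inl R P P'
  let i' : P' →ₗ[R] P × P' := LinearMap.inr R P P'
  let V : Submodule R (P × P') := U ⊔ (LinearMap.ker f).map i
  have hker : U ⊔ ((LinearMap.ker f).map i ⊔ (LinearMap.ker f').map i') = ⊤ := by
    refine eq_top_iff.2 (hUt.ge.trans (sup_le_sup_left ?_ U))
    rintro ⟨x, x'⟩ hx
    have hx1 : f x = 0 := congrArg Prod.fst (show (f x, f' x') = 0 from hx)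
    have hx2 : f' x' = 0 := congrArg Prod.snd (show (f x, f' x') = 0 from hx)
    have : ((x, x') : P × P') = i x + i' x' := by simp [i, i']
    rw [this]
    exact Submodule.add_mem_sup ⟨x, hx1, rfl⟩ ⟨x', hx2, rfl⟩
  have key : ∀ {Q : Type u} [AddCommGroup Q] [Module R Q] (K : Submodule R Q)
      (hK : ∀ W : Submodule R Q, W ⊔ K = ⊤ → W = ⊤) (t : Q →ₗ[R] P × P')
      (W : Submodule R (P × P')), W ⊔ K.map t = ⊤ → W = ⊤ := by
    intro Q _ _ K hK t W hW
    have h1 : W.comap t = ⊤ := by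
      refine hK _ (eq_top_iff.2 fun x _ => ?_)
      obtain ⟨w, hw, _, ⟨y, hy, rfl⟩, hwy⟩ := Submodule.mem_sup.1
        (hW ▸ Submodule.mem_top (x := t x))
      rw [← sub_add_cancel x y]
      refine Submodule.add_mem_sup ?_ hy
      rw [Submodule.mem_comap, map_sub, ← hwy, add_sub_cancel_right]
      exact hw
    rw [← hW, eq_comm, sup_eq_left]
    exact Submodule.map_le_iff_le_comap.2 (h1 ▸ le_top)
  have hV : V = ⊤ := key _ hU' i' V (by rw [← hker, sup_assoc])
  exact key _ hU i U hV

theorem IsIterSyzygy.prod {M M' N N' : FGModuleCat.{u} R} {t : ℕ} (h : IsIterSyzygy t M N)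
    (h' : IsIterSyzygy t M' N') :
    IsIterSyzygy t (FGModuleCat.of R (M × M')) (FGModuleCat.of R (N × N')) := by
  induction t generalizing N N' with
  | zero =>
    obtain ⟨e⟩ := h
    obtain ⟨e'⟩ := h'
    exact ⟨e.prodCongr e'⟩
  | succ t ih =>
    obtain ⟨L, hL, hN⟩ := h
    obtain ⟨L', hL', hN'⟩ := h'
    exact ⟨_, ih hL hL', hN.prod hN'⟩

end Products

namespace IsSquareRing

variable {k R RA RB V VA VB : Type u} [Field k] [Ring R] [Ring RA] [Ring RB]
  [Fintype V] [Fintype VA] [Fintype VB] {c : Corner R RA} {d : Corner R RB}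
  {S : VertexSystem k R V} {SA : VertexSystem k RA VA} {SB : VertexSystem k RB VB}
  {i : VA → V} {j : VB → V} [IsNoetherianRing R] [IsNoetherianRing RA] [IsNoetherianRing RB]

/-- The module `e R (idem (j w))` is a direct summand of the restriction to `RA` of the syzygy over
`R` of the sum of the simple `RB`-modules, compatibly with syzygies over `RA`. -/
theorem exists_isIterSyzygy (h : IsSquareRing c d S SA SB i j) (w : VB) (t : ℕ) :
    ∃ (U : FGModuleCat.{u} R) (Z W : FGModuleCat.{u} RA), IsSyzygy (d.infl SB.sumSimple) U ∧
      Nonempty (Z ≃ₗ[RA] c.Res U) ∧ IsIterSyzygy t Z W ∧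
        IsSummand (h.syz^[t] (c.res (S.proj (j w)))) W := by
  obtain ⟨n, w', m, N, U, hm, -, hU, ⟨f⟩⟩ := h.symm.exists_isSyzygy_infl SB.sumSimple
  obtain ⟨l, rfl⟩ := SB.exists_eq_of_generates hm (fun r hr => SB.rad_smul_sumSimple hr) w
    (SB.exists_idem_smul_sumSimple_ne_zero w)
  have h1 : IsSummand (S.proj (j (w' l))) (S.cover (j ∘ w')) := by
    classical
    refine isSummand_of_leftInverse (LinearMap.single R (fun l => S.proj ((j ∘ w') l)) l)
      (LinearMap.proj l) fun x => ?_
    exact Pi.single_eq_same (M := fun l => S.proj ((j ∘ w') l)) l x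
  obtain ⟨L, ⟨f'⟩⟩ := c.isSummand_res h1
  have hsub := h.subsingleton_res_infl N
  have : Unique (c.Res (d.Infl N)) := ⟨⟨0⟩, fun x => Subsingleton.elim _ _⟩
  have f'' : c.Res U ≃ₗ[RA] c.Res (S.cover (j ∘ w')) :=
    ((c.resCongr f).trans c.resProd).trans (LinearEquiv.uniqueProd.trans (c.resInfl _))
  refine ⟨U, FGModuleCat.of RA (c.res (S.proj (j (w' l))) × L),
    FGModuleCat.of RA (h.syz^[t] (c.res (S.proj (j (w' l)))) × h.syz^[t] L), hU,
    ⟨f'.symm.trans f''.symm⟩, (h.isIterSyzygy_syz _ t).prod (h.isIterSyzygy_syz L t),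
    isSummand_left (LinearEquiv.refl _ _)⟩

end IsSquareRing

section Restriction

open MulOpposite

variable {T A C : Type u} [Ring T] [Ring A] [Ring C] {c : Corner Cᵐᵒᵖ Aᵐᵒᵖ} {π : T →+* A}
  {θ : T →+ C}

theorem Corner.isRestriction_of_equiv (hθ : ∀ a, c.incl (op (π a)) = op (θ a))
    {M : FGModuleCat.{u} Cᵐᵒᵖ} {N : FGModuleCat.{u} Aᵐᵒᵖ} (f : N ≃ₗ[Aᵐᵒᵖ] c.Res M) :
    IsRestriction π θ M N := by
  have he : op (θ 1) = c.e := by rw [← hθ, map_one]; rfl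
  refine ⟨c.resVal.comp f.toLinearMap.toAddMonoidHom, c.resVal_injective.comp f.injective, ?_,
    fun a n => ?_⟩
  · ext x
    rw [Set.mem_ofPred_eq, he]
    constructor
    · rintro ⟨y, rfl⟩; exact c.e_smul_resVal _
    · exact fun hx => ⟨f.symm (c.resMk x hx), congrArg c.resVal (f.apply_symm_apply _)⟩
  · rw [← hθ]
    exact congrArg c.resVal (map_smul f _ n)

theorem Corner.isExtensionByZero_infl (hθ : ∀ a, c.incl (op (π a)) = op (θ a))
    (N : FGModuleCat.{u} Aᵐᵒᵖ) : IsExtensionByZero π θ N (c.infl N) := by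
  refine ⟨c.isRestriction_of_equiv hθ (M := c.infl N) (c.resInfl N).symm, fun x => ?_⟩
  have he : op (θ 1) = c.e := by rw [← hθ, map_one]; rfl
  rw [he]
  exact c.e_smul_infl (X := N) x

/-- The hypotheses identify `c` and `d` with the corners given by `π`, `θ` and by `π'`, `θ'`. -/
theorem IsSquareRing.orbitClass_mem_orbitClasses {k V VA VB T' B : Type u} [Field k] [Ring T']
    [Ring B] [Fintype V] [Fintype VA] [Fintype VB] {d : Corner Cᵐᵒᵖ Bᵐᵒᵖ}
    {S : VertexSystem k Cᵐᵒᵖ V} {SA : VertexSystem k Aᵐᵒᵖ VA} {SB : VertexSystem k Bᵐᵒᵖ VB}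
    {i : VA → V} {j : VB → V} [IsNoetherianRing Cᵐᵒᵖ] [IsNoetherianRing Aᵐᵒᵖ]
    [IsNoetherianRing Bᵐᵒᵖ] (h : IsSquareRing c d S SA SB i j) {π' : T' →+* B} {θ' : T' →+ C}
    (hθ : ∀ a, c.incl (op (π a)) = op (θ a)) (hθ' : ∀ b, d.incl (op (π' b)) = op (θ' b))
    (p : VB × ℕ) : h.orbitClass p ∈ orbitClasses π θ π' θ' := by
  obtain ⟨U, Z, W, hU, ⟨f⟩, hW, hN⟩ := h.exists_isIterSyzygy p.1 p.2
  exact ⟨SB.sumSimple, d.infl SB.sumSimple, U, Z, W, _, _, p.2, SB.isSumOfSimples_sumSimple,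
    d.isExtensionByZero_infl hθ' _, hU, c.isRestriction_of_equiv hθ f, hW, hN,
    c.isExtensionByZero_infl hθ _, rfl⟩

end Restriction

/-! ### Paths in path algebras, and the vertex system of a bound quiver algebra -/

namespace PathAlgebra

open Quiver

variable {k : Type u} [Field k] {V : Type u} [Quiver.{u} V]

theorem ofPath_apply_self {x y : V} (p : Path x y) :
    ofPath k p x y = Finsupp.single p 1 := by
  classical
  unfold ofPath
  rw [Pi.single_eq_same, Pi.single_eq_same]

theorem ofPath_apply_of_ne {x y x' y' : V} (p : Path x y) (h : ¬(x' = x ∧ y' = y)) :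
    ofPath k p x' y' = 0 := by
  classical
  unfold ofPath
  by_cases hx : x' = x
  · subst hx
    rw [Pi.single_eq_same, Pi.single_eq_of_ne fun hy => h ⟨rfl, hy⟩]
  · rw [Pi.single_eq_of_ne hx]
    rfl

theorem length_eq_of_ofPath_apply_ne_zero {x y x' y' : V} {p : Path x y} {q : Path x' y'}
    (h : ofPath k p x' y' q ≠ 0) : q.length = p.length := by
  by_cases hxy : x' = x ∧ y' = y
  · obtain ⟨rfl, rfl⟩ := hxy
    rw [ofPath_apply_self] at h
    rw [(Finsupp.single_apply_ne_zero.1 h).1]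
  · exact absurd (by rw [ofPath_apply_of_ne p hxy]; rfl) h

theorem lengthGE_zero (f : PathAlgebra k V) : f.LengthGE 0 := fun _ _ _ _ => Nat.zero_le _

variable (k V) in
/-- The subspace spanned by the paths of length at least `n`. -/
def lengthGE (n : ℕ) : Submodule k (PathAlgebra k V) where
  carrier := {f | f.LengthGE n}
  zero_mem' x y p hp := absurd rfl hp
  add_mem' {f g} hf hg x y p hp := by
    by_contra hn
    refine hp ?_
    rw [add_apply, Finsupp.add_apply, not_not.1 (mt (hf x y p) hn), not_not.1 (mt (hg x y p) hn),
      add_zero]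
  smul_mem' c f hf x y p hp := by
    refine hf x y p fun h0 => hp ?_
    rw [smul_apply, Finsupp.smul_apply, h0, smul_zero]

theorem ofPath_mem_lengthGE {n : ℕ} {x y : V} {p : Path x y} (h : n ≤ p.length) :
    ofPath k p ∈ lengthGE k V n :=
  fun _ _ _ hq => (length_eq_of_ofPath_apply_ne_zero hq).symm ▸ h

variable [Fintype V]

/-- A subspace containing the paths that occur in `f` contains `f`. -/
theorem mem_of_ofPath_mem (W : Submodule k (PathAlgebra k V)) (f : PathAlgebra k V)
    (h : ∀ (x y : V) (p : Path x y), f x y p ≠ 0 → ofPath k p ∈ W) : f ∈ W := by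
  classical
  let s (x : V) : (∀ w : V, Path x w →₀ k) →ₗ[k] PathAlgebra k V :=
    LinearMap.single k (fun v : V => ∀ w : V, Path v w →₀ k) x
  let t (x y : V) : (Path x y →₀ k) →ₗ[k] (∀ w : V, Path x w →₀ k) :=
    LinearMap.single k (fun w : V => Path x w →₀ k) y
  have hf : f = ∑ x, s x (f x) := (Finset.univ_sum_single f).symm
  have hf' : ∀ x, f x = ∑ y, t x y (f x y) := fun x => (Finset.univ_sum_single (f x)).symm
  rw [hf]
  refine sum_mem fun x _ => ?_
  rw [hf', map_sum]
  refine sum_mem fun y _ => ?_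
  rw [← Finsupp.sum_single (f x y), Finsupp.sum, map_sum, map_sum]
  refine sum_mem fun p hp => ?_
  have h1 : s x (t x y (Finsupp.single p (f x y p))) = f x y p • ofPath k p := by
    have h2 : Finsupp.single p (f x y p) = f x y p • Finsupp.single p 1 := by simp
    rw [h2, map_smul, map_smul]
    unfold ofPath
    congr!
  rw [h1]
  exact W.smul_mem _ (h x y p (Finsupp.mem_support_iff.1 hp))

theorem linearMap_ext {M : Type*} [AddCommGroup M] [Module k M] {L L' : PathAlgebra k V →ₗ[k] M}
    (h : ∀ (x y : V) (p : Path x y), L (ofPath k p) = L' (ofPath k p)) : L = L' :=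
  LinearMap.ext fun f => mem_of_ofPath_mem (LinearMap.eqLocus L L') f fun x y p _ => h x y p

theorem ofPath_mul_ofPath {x y z : V} (p : Path x y) (q : Path y z) :
    ofPath k p * ofPath k q = ofPath k (p.comp q) := by
  refine ext' fun a b => ?_
  rw [mul_apply, Finset.sum_eq_single y]
  · by_cases h : a = x ∧ b = z
    · obtain ⟨rfl, rfl⟩ := h
      rw [ofPath_apply_self, ofPath_apply_self, ofPath_apply_self, conv_single, one_mul]
    · rw [ofPath_apply_of_ne _ h]
      by_cases ha : a = x
      · rw [ofPath_apply_of_ne q fun hb => h ⟨ha, hb.2⟩, map_zero]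
      · rw [ofPath_apply_of_ne p fun hb => ha hb.1, map_zero, LinearMap.zero_apply]
  · intro c _ hc
    rw [ofPath_apply_of_ne p fun hb => hc hb.2, map_zero, LinearMap.zero_apply]
  · simp

theorem ofPath_mul_ofPath_of_ne {x y y' z : V} (p : Path x y) (q : Path y' z) (h : y ≠ y') :
    ofPath k p * ofPath k q = 0 := by
  refine ext' fun a b => ?_
  rw [mul_apply, zero_apply]
  refine Finset.sum_eq_zero fun c _ => ?_
  by_cases hc : c = y
  · rw [ofPath_apply_of_ne q fun hb => h (hc.symm.trans hb.1), map_zero]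
  · rw [ofPath_apply_of_ne p fun hb => hc hb.2, map_zero, LinearMap.zero_apply]

theorem ofPath_cons {x y z : V} (p : Path x y) (a : y ⟶ z) :
    ofPath k (p.cons a) = ofPath k p * ofArrow k a :=
  (ofPath_mul_ofPath p a.toPath).symm

theorem one_eq_sum : (1 : PathAlgebra k V) = ∑ v : V, ofPath k (Path.nil : Path v v) := by
  classical
  refine (Finset.univ_sum_single (1 : PathAlgebra k V)).symm.trans
    (Finset.sum_congr rfl fun v _ => ?_)
  unfold ofPath
  congr!

/-- A linear map is multiplicative if it is so on paths. -/
theorem map_mul_of_ofPath {S : Type*} [Ring S] [Algebra k S] (L : PathAlgebra k V →ₗ[k] S)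
    (h : ∀ (x y : V) (p : Path x y) (x' y' : V) (q : Path x' y'),
      L (ofPath k p * ofPath k q) = L (ofPath k p) * L (ofPath k q)) (f g : PathAlgebra k V) :
    L (f * g) = L f * L g := by
  refine LinearMap.congr_fun (f := L ∘ₗ LinearMap.mulRight k g)
    (g := LinearMap.mulRight k (L g) ∘ₗ L) (linearMap_ext fun x y p => ?_) f
  exact LinearMap.congr_fun (f := L ∘ₗ LinearMap.mulLeft k (ofPath k p))
    (g := LinearMap.mulLeft k (L (ofPath k p)) ∘ₗ L) (linearMap_ext (h x y p)) g

theorem LengthGE.mul {m n : ℕ} {f g : PathAlgebra k V} (hf : f.LengthGE m) (hg : g.LengthGE n) :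
    (f * g).LengthGE (m + n) := by
  refine mem_of_ofPath_mem ((lengthGE k V (m + n)).comap (LinearMap.mulRight k g)) f
    fun x y p hp => ?_
  refine mem_of_ofPath_mem ((lengthGE k V (m + n)).comap (LinearMap.mulLeft k (ofPath k p))) g
    fun x' y' q hq => ?_
  rw [Submodule.mem_comap, LinearMap.mulLeft_apply]
  by_cases hy : y = x'
  · subst hy
    rw [ofPath_mul_ofPath]
    refine ofPath_mem_lengthGE ?_
    rw [Path.length_comp]
    exact add_le_add (hf _ _ _ hp) (hg _ _ _ hq)
  · rw [ofPath_mul_ofPath_of_ne p q hy]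
    exact zero_mem _

/-- The coefficient of the trivial path at `v`, as a linear form. -/
def nilForm (v : V) : PathAlgebra k V →ₗ[k] k where
  toFun f := f v v Path.nil
  map_add' _ _ := rfl
  map_smul' _ _ := rfl

theorem nilForm_ofPath_nil_self (v : V) : nilForm v (ofPath k (Path.nil : Path v v)) = 1 := by
  show ofPath k (Path.nil : Path v v) v v Path.nil = 1
  rw [ofPath_apply_self, Finsupp.single_eq_same]

theorem nilForm_ofPath_nil_of_ne {v w : V} (h : v ≠ w) :
    nilForm v (ofPath k (Path.nil : Path w w)) = 0 := by
  show ofPath k (Path.nil : Path w w) v v Path.nil = 0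
  rw [ofPath_apply_of_ne _ fun h' => h h'.1]
  rfl

theorem nilForm_ofPath_of_pos (v : V) {x y : V} {p : Path x y} (hp : p.length ≠ 0) :
    nilForm v (ofPath k p) = 0 := by
  by_contra h
  exact hp (length_eq_of_ofPath_apply_ne_zero (q := (Path.nil : Path v v)) h).symm

/-- The coefficient of the trivial path at `v`, as a ring homomorphism. -/
def nilCoeff (v : V) : PathAlgebra k V →+* k where
  __ := nilForm v
  map_zero' := map_zero (nilForm v)
  map_one' := by
    show nilForm v 1 = 1
    rw [one_eq_sum, map_sum, Finset.sum_eq_single v, nilForm_ofPath_nil_self]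
    · exact fun w _ hw => nilForm_ofPath_nil_of_ne hw.symm
    · simp
  map_mul' := map_mul_of_ofPath (nilForm v) fun x y p x' y' q => by
    by_cases hy : y = x'
    · subst hy
      rw [ofPath_mul_ofPath]
      by_cases hp : p.length = 0
      · obtain rfl := Path.eq_of_length_zero p hp
        obtain rfl := Path.eq_nil_of_length_zero p hp
        rw [Path.nil_comp]
        by_cases hq : q.length = 0
        · by_cases hv : v = x
          · subst hv
            rw [nilForm_ofPath_nil_self, one_mul]
          · obtain rfl := Path.eq_of_length_zero q hq
            obtain rfl := Path.eq_nil_of_length_zero q hq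
            rw [nilForm_ofPath_nil_of_ne hv, zero_mul]
        · rw [nilForm_ofPath_of_pos v hq, mul_zero]
      · rw [nilForm_ofPath_of_pos v hp, nilForm_ofPath_of_pos v, zero_mul]
        rw [Path.length_comp]
        exact fun h => hp (Nat.eq_zero_of_add_eq_zero_right h)
    · rw [ofPath_mul_ofPath_of_ne p q hy, map_zero]
      by_cases hp : p.length = 0
      · obtain rfl := Path.eq_of_length_zero p hp
        obtain rfl := Path.eq_nil_of_length_zero p hp
        by_cases hq : q.length = 0
        · obtain rfl := Path.eq_of_length_zero q hq
          obtain rfl := Path.eq_nil_of_length_zero q hq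
          by_cases hv : v = x
          · rw [nilForm_ofPath_nil_of_ne (hv.trans_ne hy), mul_zero]
          · rw [nilForm_ofPath_nil_of_ne hv, zero_mul]
        · rw [nilForm_ofPath_of_pos v hq, mul_zero]
      · rw [nilForm_ofPath_of_pos v hp, zero_mul]

theorem lengthGE_one_iff {f : PathAlgebra k V} : f.LengthGE 1 ↔ ∀ v, nilCoeff v f = 0 := by
  constructor
  · intro h v
    by_contra h0
    exact absurd (h v v Path.nil h0) (by simp)
  · intro h x y p hp
    by_contra hlt
    have h0 : p.length = 0 := by omega
    obtain rfl := Path.eq_of_length_zero p h0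
    obtain rfl := Path.eq_nil_of_length_zero p h0
    exact hp (h x)

theorem nilCoeff_eq_zero_of_mem {I : Ideal (PathAlgebra k V)} [hI : IsAdmissible I] (v : V)
    {f : PathAlgebra k V} (hf : f ∈ I) : nilCoeff v f = 0 := by
  by_contra h0
  exact absurd (hI.le_sq f hf v v Path.nil h0) (by simp)

section BoundQuiver

open MulOpposite

variable (I : Ideal (PathAlgebra k V)) [I.IsTwoSided] [IsAdmissible I]

/-- The character of a bound quiver algebra belonging to the vertex `v`. -/
noncomputable def quotientChar (v : V) : PathAlgebra k V ⧸ I →+* k :=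
  Ideal.Quotient.lift I (nilCoeff v) fun _ hf => nilCoeff_eq_zero_of_mem v hf

/-- The vertices of a bound quiver algebra, with the trivial paths as idempotents. -/
noncomputable def vertexSystem : VertexSystem k (PathAlgebra k V ⧸ I)ᵐᵒᵖ V where
  idem v := op (Ideal.Quotient.mk I (ofPath k (Path.nil : Path v v)))
  char v := (quotientChar I v).fromOpposite fun _ _ => mul_comm _ _
  idem_mul_self v := by
    rw [← op_mul, ← map_mul, ofPath_mul_ofPath, Path.comp_nil]
  sum_idem := by
    rw [← Finset.op_sum, ← map_sum, ← one_eq_sum, map_one, op_one]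
  char_surjective v a := ⟨op (Ideal.Quotient.mk I (algebraMap k _ a)), by
    show nilForm v (algebraMap k (PathAlgebra k V) a) = a
    rw [Algebra.algebraMap_eq_smul_one, map_smul, show nilForm v (1 : PathAlgebra k V) = 1 from
      map_one (nilCoeff v), smul_eq_mul, mul_one]⟩
  char_idem_self v := nilForm_ofPath_nil_self v
  char_idem_of_ne _ _ h := nilForm_ofPath_nil_of_ne h
  nilpotent := by
    obtain ⟨m, -, hm⟩ := IsAdmissible.pow_le (I := I)
    refine ⟨m, eq_bot_iff.2 ?_⟩
    suffices H : ∀ n : ℕ, ∀ r ∈ (fun J : Ideal (PathAlgebra k V ⧸ I)ᵐᵒᵖ => J * ⨅ v,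
        RingHom.ker ((quotientChar I v).fromOpposite fun _ _ => mul_comm _ _))^[n] ⊤,
        ∃ f : PathAlgebra k V, f.LengthGE n ∧ r = op (Ideal.Quotient.mk I f) by
      intro r hr
      obtain ⟨f, hf, rfl⟩ := H m r hr
      rw [Ideal.Quotient.eq_zero_iff_mem.2 (hm f hf)]
      exact zero_mem _
    intro n
    induction n with
    | zero =>
      intro r _
      obtain ⟨f, hf⟩ := Ideal.Quotient.mk_surjective r.unop
      exact ⟨f, lengthGE_zero f, by rw [hf, op_unop]⟩
    | succ n ih =>
      intro r hr
      rw [Function.iterate_succ_apply'] at hr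
      induction hr using Submodule.mul_induction_on' with
      | mem_mul_mem r hr s hs =>
        obtain ⟨f, hf, rfl⟩ := ih r hr
        obtain ⟨g, hg⟩ := Ideal.Quotient.mk_surjective s.unop
        obtain rfl : s = op (Ideal.Quotient.mk I g) := by rw [hg, op_unop]
        have hg' : g.LengthGE 1 := lengthGE_one_iff.2 fun v => Ideal.mem_iInf.1 hs v
        refine ⟨g * f, add_comm 1 n ▸ hg'.mul hf, ?_⟩
        rw [map_mul, op_mul]
      | add x _ y _ hx hy =>
        obtain ⟨f, hf, rfl⟩ := hx
        obtain ⟨g, hg, rfl⟩ := hy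
        exact ⟨f + g, (lengthGE k V (n + 1)).add_mem hf hg, by rw [map_add, op_add]⟩

theorem vertexSystem_char (v : V) (f : PathAlgebra k V) :
    (vertexSystem I).char v (op (Ideal.Quotient.mk I f)) = nilCoeff v f := rfl

theorem vertexSystem_idem (v : V) : (vertexSystem I).idem v =
    op (Ideal.Quotient.mk I (ofPath k (Path.nil : Path v v))) := rfl

theorem isArtinianRing_boundQuiverAlgebra [∀ x y : V, Finite (x ⟶ y)] :
    IsArtinianRing (PathAlgebra k V ⧸ I)ᵐᵒᵖ :=
  isArtinian_of_tower k inferInstance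

end BoundQuiver

end PathAlgebra

/-! ### Full subquivers as corners -/

/-- A ring `RA` that embeds onto a corner `e R e` such that `e R (1 - e) R e = 0` is also the
quotient of `R` by the map `r ↦ e r e`. -/
noncomputable def Corner.ofIncl {R RA : Type u} [Ring R] [Ring RA] (s : RA →ₙ+* R)
    (hs : Function.Injective s) (h1 : ∀ r, ∃ a, s a = s 1 * r * s 1)
    (h2 : ∀ r r', s 1 * r * (1 - s 1) * r' * s 1 = 0) : Corner R RA where
  proj :=
    { toFun := fun r => (h1 r).choose
      map_one' := hs (by rw [(h1 1).choose_spec, mul_one, ← map_mul, mul_one])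
      map_zero' := hs (by rw [(h1 0).choose_spec, mul_zero, zero_mul, map_zero])
      map_add' := fun r r' => hs (by
        rw [map_add, (h1 _).choose_spec, (h1 _).choose_spec, (h1 _).choose_spec, mul_add, add_mul])
      map_mul' := fun r r' => hs (by
        rw [map_mul, (h1 _).choose_spec, (h1 _).choose_spec, (h1 _).choose_spec]
        have h3 : s 1 * s 1 = s 1 := by rw [← map_mul, mul_one]
        have h4 := h2 r r'
        rw [mul_sub, mul_one, sub_mul, sub_mul, sub_eq_zero] at h4
        calc s 1 * (r * r') * s 1 = s 1 * r * r' * s 1 := by simp only [mul_assoc]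
          _ = s 1 * r * (s 1 * s 1) * r' * s 1 := by rw [h3, h4]
          _ = s 1 * r * s 1 * (s 1 * r' * s 1) := by simp only [mul_assoc]) }
  incl := s
  proj_incl a := hs ((h1 _).choose_spec.trans (by rw [← map_mul, ← map_mul, one_mul, mul_one]))
  incl_proj r := (h1 r).choose_spec

namespace PathAlgebra

open Quiver

section VertexSet

variable {k : Type u} [Field k] {V : Type u} [Quiver.{u} V] [Fintype V]

open Classical in
variable (k) in
/-- The sum of the trivial paths at the vertices of `U`. -/
noncomputable def setIdem (U : Set V) : PathAlgebra k V :=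
  ∑ v : V, if v ∈ U then ofPath k (Path.nil : Path v v) else 0

theorem setIdem_add_setIdem_compl (U : Set V) : setIdem k U + setIdem k Uᶜ = 1 := by
  classical
  rw [one_eq_sum, setIdem, setIdem, ← Finset.sum_add_distrib]
  refine Finset.sum_congr rfl fun v _ => ?_
  by_cases h : v ∈ U <;> simp [h]

open Classical in
theorem setIdem_mul_ofPath (U : Set V) {x y : V} (p : Path x y) :
    setIdem k U * ofPath k p = if x ∈ U then ofPath k p else 0 := by
  rw [setIdem, Finset.sum_mul, Finset.sum_eq_single x]
  · by_cases h : x ∈ U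
    · rw [if_pos h, if_pos h, ofPath_mul_ofPath, Path.nil_comp]
    · rw [if_neg h, if_neg h, zero_mul]
  · intro v _ hv
    split_ifs
    · exact ofPath_mul_ofPath_of_ne _ _ hv
    · exact zero_mul _
  · simp

open Classical in
theorem ofPath_mul_setIdem (U : Set V) {x y : V} (p : Path x y) :
    ofPath k p * setIdem k U = if y ∈ U then ofPath k p else 0 := by
  rw [setIdem, Finset.mul_sum, Finset.sum_eq_single y]
  · by_cases h : y ∈ U
    · rw [if_pos h, if_pos h, ofPath_mul_ofPath, Path.comp_nil]
    · rw [if_neg h, if_neg h, mul_zero]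
  · intro v _ hv
    split_ifs
    · exact ofPath_mul_ofPath_of_ne _ _ hv.symm
    · exact mul_zero _
  · simp

theorem setIdem_mul_self (U : Set V) : setIdem k U * setIdem k U = setIdem k U := by
  classical
  rw [setIdem.eq_def, Finset.mul_sum]
  refine Finset.sum_congr rfl fun v _ => ?_
  rw [← setIdem.eq_def]
  split_ifs with h
  · rw [setIdem_mul_ofPath, if_pos h]
  · rw [mul_zero]

theorem setIdem_mul_setIdem_compl (U : Set V) : setIdem k U * setIdem k Uᶜ = 0 := by
  classical
  rw [setIdem.eq_def k Uᶜ, Finset.mul_sum]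
  refine Finset.sum_eq_zero fun v _ => ?_
  split_ifs with h
  · rw [setIdem_mul_ofPath, if_neg h]
  · rw [mul_zero]

/-- Every path of positive length followed by an arrow between `U` and its complement lies in
`I`. -/
def KillsCrossings (U : Set V) (I : Ideal (PathAlgebra k V)) : Prop :=
  ∀ ⦃s t t' : V⦄ (q : Path s t) (x : t ⟶ t'), q.length ≠ 0 → ¬(t ∈ U ↔ t' ∈ U) →
    ofPath k (q.cons x) ∈ I

variable {U : Set V} {I : Ideal (PathAlgebra k V)}

theorem KillsCrossings.compl (h : KillsCrossings U I) : KillsCrossings Uᶜ I :=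
  fun _ _ _ q x hq hx => h q x hq fun hU => hx (not_congr hU)

variable [I.IsTwoSided]

/-- A path that crosses from `U` to its complement after its first arrow lies in `I`. -/
theorem KillsCrossings.comp_mem (h : KillsCrossings U I) {r s t : V} (p : Path r s)
    (hp : p.length ≠ 0) (q : Path s t) (hs : s ∈ U) (ht : t ∉ U) :
    ofPath k (p.comp q) ∈ I := by
  induction q with
  | nil => exact absurd hs ht
  | @cons t t' q x ih =>
    by_cases htU : t ∈ U
    · refine h (p.comp q) x ?_ fun hiff => ht (hiff.1 htU)
      rw [Path.length_comp]
      exact fun h0 => hp (Nat.eq_zero_of_add_eq_zero_right h0)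
    · rw [Path.comp_cons, ofPath_cons]
      exact I.mul_mem_right _ (ih htU)

theorem KillsCrossings.mul_mem (h : KillsCrossings U I) {f : PathAlgebra k V} (hf : f.LengthGE 1)
    (g : PathAlgebra k V) : f * (setIdem k U * g * setIdem k Uᶜ) ∈ I := by
  classical
  refine mem_of_ofPath_mem ((I.restrictScalars k).comap
    (LinearMap.mulRight k (setIdem k U * g * setIdem k Uᶜ))) f fun r s p hp => ?_
  refine mem_of_ofPath_mem ((I.restrictScalars k).comap
    (LinearMap.mulLeft k (ofPath k p) ∘ₗ LinearMap.mulRight k (setIdem k Uᶜ) ∘ₗ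
      LinearMap.mulLeft k (setIdem k U))) g fun s' t q _ => ?_
  show ofPath k p * (setIdem k U * ofPath k q * setIdem k Uᶜ) ∈ I
  rw [setIdem_mul_ofPath]
  split_ifs with hs
  · rw [ofPath_mul_setIdem]
    split_ifs with ht
    · by_cases hss : s = s'
      · subst hss
        rw [ofPath_mul_ofPath]
        exact h.comp_mem p (Nat.one_le_iff_ne_zero.1 (hf r s p hp)) q hs ht
      · rw [ofPath_mul_ofPath_of_ne p q hss]
        exact zero_mem _
    · rw [mul_zero]; exact zero_mem _
  · rw [zero_mul, mul_zero]; exact zero_mem _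

end VertexSet

section Subquiver

variable {k : Type u} [Field k] {W G : Type u} [Quiver.{u} W] [Quiver.{u} G] [Fintype W]
  [Fintype G]

/-- The map `ι` of path algebras is the inclusion of a full subquiver, given by `F`. -/
structure IsFullSubquiver (F : W ⥤q G) (ι : PathAlgebra k W →ₗ[k] PathAlgebra k G) : Prop where
  injective : Function.Injective F.obj
  full : ∀ {v w : W} (x : F.obj v ⟶ F.obj w), ∃ a : v ⟶ w, F.map a = x
  map_ofPath : ∀ {v w : W} (p : Path v w), ι (ofPath k p) = ofPath k (F.mapPath p)

namespace IsFullSubquiver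

variable {F : W ⥤q G} {ι : PathAlgebra k W →ₗ[k] PathAlgebra k G}

theorem map_mul (h : IsFullSubquiver F ι) (f g : PathAlgebra k W) : ι (f * g) = ι f * ι g :=
  map_mul_of_ofPath ι (fun x y p x' y' q => by
    by_cases hy : y = x'
    · subst hy
      rw [ofPath_mul_ofPath, h.map_ofPath, h.map_ofPath, h.map_ofPath, ofPath_mul_ofPath,
        Prefunctor.mapPath_comp]
    · rw [ofPath_mul_ofPath_of_ne p q hy, map_zero, h.map_ofPath, h.map_ofPath,
        ofPath_mul_ofPath_of_ne _ _ (h.injective.ne hy)]) f g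

theorem map_one (h : IsFullSubquiver F ι) : ι 1 = setIdem k (Set.range F.obj) := by
  classical
  rw [one_eq_sum, map_sum, setIdem]
  refine Finset.sum_of_injOn F.obj h.injective.injOn
    (fun _ _ => Finset.mem_coe.2 (Finset.mem_univ _))
    (fun w _ hw => if_neg fun ⟨v, hv⟩ => hw ⟨v, Finset.mem_coe.2 (Finset.mem_univ v), hv⟩)
    fun v _ => ?_
  rw [if_pos ⟨v, rfl⟩, h.map_ofPath, Prefunctor.mapPath_nil]

theorem nilCoeff_map (h : IsFullSubquiver F ι) (v : W) (f : PathAlgebra k W) :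
    nilCoeff (F.obj v) (ι f) = nilCoeff v f := by
  refine LinearMap.congr_fun (f := nilForm (F.obj v) ∘ₗ ι) (g := nilForm v)
    (linearMap_ext fun x y p => ?_) f
  rw [LinearMap.comp_apply, h.map_ofPath]
  cases p with
  | nil =>
    rw [Prefunctor.mapPath_nil]
    by_cases hv : v = x
    · subst hv
      rw [nilForm_ofPath_nil_self, nilForm_ofPath_nil_self]
    · rw [nilForm_ofPath_nil_of_ne hv, nilForm_ofPath_nil_of_ne (h.injective.ne hv)]
  | cons p a => rw [nilForm_ofPath_of_pos _ (by simp), nilForm_ofPath_of_pos _ (by simp)]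

variable {I : Ideal (PathAlgebra k G)} [I.IsTwoSided]

/-- Modulo `I`, a path between vertices of the subquiver does not leave the subquiver. -/
theorem ofPath_mem_or (h : IsFullSubquiver F ι) (hI : KillsCrossings (Set.range F.obj) I)
    {v : W} {t : G} (p : Path (F.obj v) t) (ht : t ∈ Set.range F.obj) :
    ofPath k p ∈ I ∨ ∃ (w : W) (q : Path v w), F.obj w = t ∧ ofPath k p = ι (ofPath k q) := by
  induction p with
  | nil => exact Or.inr ⟨v, Path.nil, rfl, (h.map_ofPath Path.nil).symm⟩
  | @cons t t' p x ih =>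
    by_cases htU : t ∈ Set.range F.obj
    · obtain hp | ⟨w, q, rfl, hq⟩ := ih htU
      · rw [ofPath_cons]
        exact Or.inl (I.mul_mem_right _ hp)
      · obtain ⟨w', rfl⟩ := ht
        obtain ⟨a, rfl⟩ := h.full x
        refine Or.inr ⟨w', q.cons a, rfl, ?_⟩
        rw [h.map_ofPath, Prefunctor.mapPath_cons, ofPath_cons, ofPath_cons, hq, h.map_ofPath]
    · refine Or.inl (hI p x (fun h0 => htU ?_) fun hiff => htU (hiff.2 ht))
      exact ⟨v, Path.eq_of_length_zero p h0⟩

theorem exists_sub_mem (h : IsFullSubquiver F ι)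
    (hI : KillsCrossings (Set.range F.obj) I) (f : PathAlgebra k G) :
    ∃ g, ι 1 * f * ι 1 - ι g ∈ I := by
  classical
  suffices H : ι 1 * f * ι 1 ∈ I.restrictScalars k ⊔ LinearMap.range ι by
    obtain ⟨a, ha, b, ⟨g, rfl⟩, hab⟩ := Submodule.mem_sup.1 H
    exact ⟨g, by rw [← hab, add_sub_cancel_right]; exact ha⟩
  refine mem_of_ofPath_mem ((I.restrictScalars k ⊔ LinearMap.range ι).comap
    (LinearMap.mulRight k (ι 1) ∘ₗ LinearMap.mulLeft k (ι 1))) f fun s t p _ => ?_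
  show ι 1 * ofPath k p * ι 1 ∈ I.restrictScalars k ⊔ LinearMap.range ι
  rw [h.map_one, setIdem_mul_ofPath]
  split_ifs with hs
  · rw [ofPath_mul_setIdem]
    split_ifs with ht
    · obtain ⟨v, rfl⟩ := hs
      obtain hp | ⟨w, q, -, hq⟩ := h.ofPath_mem_or hI p ht
      · exact Submodule.mem_sup_left hp
      · exact Submodule.mem_sup_right ⟨_, hq.symm⟩
    · exact zero_mem _
  · rw [zero_mul]; exact zero_mem _

end IsFullSubquiver

section Corner

open MulOpposite

variable {F : W ⥤q G} {ι : PathAlgebra k W →ₗ[k] PathAlgebra k G}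
  {I : Ideal (PathAlgebra k G)} [I.IsTwoSided] {J : Ideal (PathAlgebra k W)} [J.IsTwoSided]

/-- The (non-unital) homomorphism of quotients of path algebras induced by the inclusion of a full
subquiver. -/
noncomputable def IsFullSubquiver.quotientMap (h : IsFullSubquiver F ι)
    (hJ : ∀ f, ι f ∈ I ↔ f ∈ J) : PathAlgebra k W ⧸ J →ₙ+* PathAlgebra k G ⧸ I :=
  have key : ∀ (a : PathAlgebra k W ⧸ J) (f : PathAlgebra k W), Ideal.Quotient.mk J f = a →
      Ideal.Quotient.mk I (ι (Function.surjInv Ideal.Quotient.mk_surjective a)) =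
        Ideal.Quotient.mk I (ι f) := fun a f hf => by
    rw [Ideal.Quotient.eq, ← map_sub, hJ, ← Ideal.Quotient.eq, hf]
    exact Function.surjInv_eq _ a
  { toFun := fun a => Ideal.Quotient.mk I (ι (Function.surjInv Ideal.Quotient.mk_surjective a))
    map_mul' := fun a b => by
      obtain ⟨f, rfl⟩ := Ideal.Quotient.mk_surjective a
      obtain ⟨g, rfl⟩ := Ideal.Quotient.mk_surjective b
      rw [key _ f rfl, key _ g rfl, key _ (f * g) (_root_.map_mul _ _ _), h.map_mul,
        _root_.map_mul]
    map_zero' := by rw [key _ 0 (map_zero _), map_zero, map_zero]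
    map_add' := fun a b => by
      obtain ⟨f, rfl⟩ := Ideal.Quotient.mk_surjective a
      obtain ⟨g, rfl⟩ := Ideal.Quotient.mk_surjective b
      rw [key _ f rfl, key _ g rfl, key _ (f + g) (map_add _ _ _), map_add, map_add] }

theorem IsFullSubquiver.quotientMap_mk (h : IsFullSubquiver F ι) (hJ : ∀ f, ι f ∈ I ↔ f ∈ J)
    (f : PathAlgebra k W) : h.quotientMap hJ (Ideal.Quotient.mk J f) =
      Ideal.Quotient.mk I (ι f) := by
  refine Ideal.Quotient.eq.2 ?_
  rw [← map_sub, hJ, ← Ideal.Quotient.eq]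
  exact Function.surjInv_eq _ _

theorem IsFullSubquiver.quotientMap_one (h : IsFullSubquiver F ι) (hJ : ∀ f, ι f ∈ I ↔ f ∈ J) :
    h.quotientMap hJ 1 = Ideal.Quotient.mk I (setIdem k (Set.range F.obj)) := by
  rw [← _root_.map_one (Ideal.Quotient.mk J), quotientMap_mk, h.map_one]

theorem KillsCrossings.mk_mul_eq_zero [IsAdmissible I] {U : Set G} (hI : KillsCrossings U I)
    (r s : (PathAlgebra k G ⧸ I)ᵐᵒᵖ) (hs : s ∈ (vertexSystem I).rad) :
    op (Ideal.Quotient.mk I (setIdem k Uᶜ)) * r * op (Ideal.Quotient.mk I (setIdem k U)) * s =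
      0 := by
  obtain ⟨f, hf⟩ := Ideal.Quotient.mk_surjective s.unop
  obtain ⟨g, hg⟩ := Ideal.Quotient.mk_surjective r.unop
  obtain rfl : s = op (Ideal.Quotient.mk I f) := by rw [hf, op_unop]
  obtain rfl : r = op (Ideal.Quotient.mk I g) := by rw [hg, op_unop]
  have hf1 : f.LengthGE 1 := lengthGE_one_iff.2 fun v => (vertexSystem I).mem_rad.1 hs v
  rw [← op_mul, ← op_mul, ← op_mul, ← _root_.map_mul, ← _root_.map_mul, ← _root_.map_mul,
    ← mul_assoc (setIdem k U), Ideal.Quotient.eq_zero_iff_mem.2 (hI.mul_mem hf1 g), op_zero]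

variable [IsAdmissible I]

/-- The quotient algebra of the path algebra of a full subquiver, as a corner. -/
noncomputable def IsFullSubquiver.corner (h : IsFullSubquiver F ι) (hJ : ∀ f, ι f ∈ I ↔ f ∈ J)
    (hI : KillsCrossings (Set.range F.obj) I) :
    Corner (PathAlgebra k G ⧸ I)ᵐᵒᵖ (PathAlgebra k W ⧸ J)ᵐᵒᵖ :=
  Corner.ofIncl (NonUnitalRingHom.op (h.quotientMap hJ))
    (by
      refine (injective_iff_map_eq_zero _).2 fun a ha => ?_
      obtain ⟨f, hf⟩ := Ideal.Quotient.mk_surjective a.unop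
      obtain rfl : a = op (Ideal.Quotient.mk J f) := by rw [hf, op_unop]
      have ha' : h.quotientMap hJ (Ideal.Quotient.mk J f) = 0 := congrArg unop ha
      rw [h.quotientMap_mk, Ideal.Quotient.eq_zero_iff_mem, hJ,
        ← Ideal.Quotient.eq_zero_iff_mem] at ha'
      rw [ha', op_zero])
    (fun r => by
      obtain ⟨f, hf⟩ := Ideal.Quotient.mk_surjective r.unop
      obtain rfl : r = op (Ideal.Quotient.mk I f) := by rw [hf, op_unop]
      obtain ⟨g, hg⟩ := h.exists_sub_mem hI f
      refine ⟨op (Ideal.Quotient.mk J g), ?_⟩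
      have h1 : h.quotientMap hJ (Ideal.Quotient.mk J g) = h.quotientMap hJ 1 *
          (Ideal.Quotient.mk I f * h.quotientMap hJ 1) := by
        rw [h.quotientMap_one, h.quotientMap_mk, ← h.map_one, ← _root_.map_mul, ← _root_.map_mul,
          ← mul_assoc]
        exact (Ideal.Quotient.eq.2 hg).symm
      exact congrArg op h1)
    (fun r r' => by
      have h1 : NonUnitalRingHom.op (h.quotientMap hJ) 1 =
        op (Ideal.Quotient.mk I (setIdem k (Set.range F.obj))) :=
        congrArg op (h.quotientMap_one hJ)
      have h2 : 1 - op (Ideal.Quotient.mk I (setIdem k (Set.range F.obj))) =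
          op (Ideal.Quotient.mk I (setIdem k (Set.range F.obj)ᶜ)) := by
        rw [sub_eq_iff_eq_add, ← op_add, ← map_add, add_comm, setIdem_add_setIdem_compl,
          _root_.map_one, op_one]
      have h3 : op (Ideal.Quotient.mk I (setIdem k (Set.range F.obj)ᶜ)) * r' *
          op (Ideal.Quotient.mk I (setIdem k (Set.range F.obj))) ∈ (vertexSystem I).rad := by
        refine (vertexSystem I).mem_rad.2 fun v => ?_
        rw [_root_.map_mul, mul_comm, _root_.map_mul, ← mul_assoc, vertexSystem_char,
          vertexSystem_char, ← _root_.map_mul, setIdem_mul_setIdem_compl, map_zero, zero_mul]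
      have h4 := hI.compl.mk_mul_eq_zero r _ h3
      rw [compl_compl] at h4
      rw [h1, h2, ← h4]
      simp only [mul_assoc]
      have h5 : op (Ideal.Quotient.mk I (setIdem k (Set.range F.obj)ᶜ)) *
          (op (Ideal.Quotient.mk I (setIdem k (Set.range F.obj)ᶜ)) *
          (r' * op (Ideal.Quotient.mk I (setIdem k (Set.range F.obj))))) =
          op (Ideal.Quotient.mk I (setIdem k (Set.range F.obj)ᶜ)) *
          (r' * op (Ideal.Quotient.mk I (setIdem k (Set.range F.obj)))) := by
        rw [← mul_assoc, ← op_mul, ← _root_.map_mul, setIdem_mul_self]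
      rw [h5])

theorem IsFullSubquiver.corner_incl (h : IsFullSubquiver F ι) (hJ : ∀ f, ι f ∈ I ↔ f ∈ J)
    (hI : KillsCrossings (Set.range F.obj) I) (f : PathAlgebra k W) :
    (h.corner hJ hI).incl (op (Ideal.Quotient.mk J f)) = op (Ideal.Quotient.mk I (ι f)) :=
  congrArg op (h.quotientMap_mk hJ f)

theorem IsFullSubquiver.corner_e (h : IsFullSubquiver F ι) (hJ : ∀ f, ι f ∈ I ↔ f ∈ J)
    (hI : KillsCrossings (Set.range F.obj) I) :
    (h.corner hJ hI).e = op (Ideal.Quotient.mk I (setIdem k (Set.range F.obj))) :=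
  congrArg op (h.quotientMap_one hJ)

/-- Two full subquivers that partition the vertices, between which all paths of length at least two
vanish that end with a crossing, make a bound quiver algebra a square ring. -/
theorem IsFullSubquiver.isSquareRing {W' : Type u} [Quiver.{u} W'] [Fintype W']
    {F' : W' ⥤q G} {ι' : PathAlgebra k W' →ₗ[k] PathAlgebra k G} {J' : Ideal (PathAlgebra k W')}
    [J'.IsTwoSided] [IsAdmissible J] [IsAdmissible J']
    (h : IsFullSubquiver F ι) (hJ : ∀ f, ι f ∈ I ↔ f ∈ J)
    (hI : KillsCrossings (Set.range F.obj) I)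
    (h' : IsFullSubquiver F' ι') (hJ' : ∀ f, ι' f ∈ I ↔ f ∈ J')
    (hI' : KillsCrossings (Set.range F'.obj) I) (hc : Set.range F'.obj = (Set.range F.obj)ᶜ) :
    IsSquareRing (h.corner hJ hI) (h'.corner hJ' hI') (vertexSystem I) (vertexSystem J)
      (vertexSystem J') F.obj F'.obj where
  e_add_e := by
    rw [h.corner_e, h'.corner_e, hc, ← op_add, ← map_add, setIdem_add_setIdem_compl,
      _root_.map_one, op_one]
  incl_idem_left v := by
    rw [vertexSystem_idem, vertexSystem_idem, h.corner_incl, h.map_ofPath, Prefunctor.mapPath_nil]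
  incl_idem_right v := by
    rw [vertexSystem_idem, vertexSystem_idem, h'.corner_incl, h'.map_ofPath,
      Prefunctor.mapPath_nil]
  char_incl_left v a := by
    obtain ⟨f, hf⟩ := Ideal.Quotient.mk_surjective a.unop
    obtain rfl : a = op (Ideal.Quotient.mk J f) := by rw [hf, op_unop]
    rw [h.corner_incl, vertexSystem_char, vertexSystem_char, h.nilCoeff_map]
  char_incl_right v a := by
    obtain ⟨f, hf⟩ := Ideal.Quotient.mk_surjective a.unop
    obtain rfl : a = op (Ideal.Quotient.mk J' f) := by rw [hf, op_unop]
    rw [h'.corner_incl, vertexSystem_char, vertexSystem_char, h'.nilCoeff_map]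
  vertex v := by
    by_cases hv : v ∈ Set.range F.obj
    · exact Or.inl hv
    · exact Or.inr (hc.symm.subset hv)
  left_right r s hs := by
    rw [h.corner_e, h'.corner_e, ← hI'.mk_mul_eq_zero r s hs, hc, compl_compl]
  right_left r s hs := by
    rw [h.corner_e, h'.corner_e, hc]
    exact hI.mk_mul_eq_zero r s hs

end Corner

end Subquiver

end PathAlgebra

/-! ### The glued quiver -/

section Glue

open Quiver PathAlgebra

variable {k : Type u} [Field k] {VA VB : Type u} [Quiver.{u} VA] [Quiver.{u} VB]
  {X : VA → VB → Type u} {Y : VB → VA → Type u}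

namespace Glue

theorem inclA_ofPath {v w : VA} (p : Path v w) :
    inclA X Y k (ofPath k p) = ofPath k ((quiverA X Y).mapPath p) := by
  refine ext' fun s t => ?_
  by_cases h : s = inA v ∧ t = inA w
  · obtain ⟨rfl, rfl⟩ := h
    refine Eq.trans ?_ (ofPath_apply_self (k := k) (pathA X Y p)).symm
    show Finsupp.mapDomain (pathA X Y) (ofPath k p v w) = _
    rw [ofPath_apply_self, Finsupp.mapDomain_single]
  · refine Eq.trans ?_ (ofPath_apply_of_ne (k := k) (pathA X Y p) h).symm
    cases s with
    | inB _ => cases t <;> rfl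
    | inA v' =>
      cases t with
      | inB _ => rfl
      | inA w' =>
        show Finsupp.mapDomain (pathA X Y) (ofPath k p v' w') = _
        rw [ofPath_apply_of_ne p fun h' => h ⟨congrArg inA h'.1, congrArg inA h'.2⟩,
          Finsupp.mapDomain_zero]

theorem inclB_ofPath {v w : VB} (p : Path v w) :
    inclB X Y k (ofPath k p) = ofPath k ((quiverB X Y).mapPath p) := by
  refine ext' fun s t => ?_
  by_cases h : s = inB v ∧ t = inB w
  · obtain ⟨rfl, rfl⟩ := h
    refine Eq.trans ?_ (ofPath_apply_self (k := k) (pathB X Y p)).symm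
    show Finsupp.mapDomain (pathB X Y) (ofPath k p v w) = _
    rw [ofPath_apply_self, Finsupp.mapDomain_single]
  · refine Eq.trans ?_ (ofPath_apply_of_ne (k := k) (pathB X Y p) h).symm
    cases s with
    | inA _ => cases t <;> rfl
    | inB v' =>
      cases t with
      | inA _ => rfl
      | inB w' =>
        show Finsupp.mapDomain (pathB X Y) (ofPath k p v' w') = _
        rw [ofPath_apply_of_ne p fun h' => h ⟨congrArg inB h'.1, congrArg inB h'.2⟩,
          Finsupp.mapDomain_zero]

theorem range_quiverB_obj :
    Set.range (quiverB X Y).obj = (Set.range (quiverA X Y).obj)ᶜ := by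
  ext s
  cases s with
  | inA v => exact iff_of_false (by rintro ⟨w, hw⟩; cases hw) (not_not.2 ⟨v, rfl⟩)
  | inB w => exact iff_of_true ⟨w, rfl⟩ (by rintro ⟨v, hv⟩; cases hv)

variable [Fintype VA] [Fintype VB]

theorem isFullSubquiver_quiverA : IsFullSubquiver (quiverA X Y) (inclA X Y k) :=
  ⟨fun _ _ h => by cases h; rfl, fun x => ⟨x, rfl⟩, inclA_ofPath⟩

theorem isFullSubquiver_quiverB : IsFullSubquiver (quiverB X Y) (inclB X Y k) :=
  ⟨fun _ _ h => by cases h; rfl, fun x => ⟨x, rfl⟩, inclB_ofPath⟩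

end Glue

open Glue

variable [Fintype VA] [Fintype VB] {IA : Ideal (PathAlgebra k VA)} {IB : Ideal (PathAlgebra k VB)}
  {IC : Ideal (PathAlgebra k (Glue X Y))}

/-- The four kinds of products in `IsSquareIdeal` are exactly the paths of length two that end with
a connecting arrow. -/
theorem IsSquareIdeal.killsCrossings [IC.IsTwoSided] (hC : IsSquareIdeal IA IB IC) :
    KillsCrossings (Set.range (quiverA X Y).obj) IC := by
  have hA : ∀ v : VA, (inA v : Glue X Y) ∈ Set.range (quiverA X Y).obj := fun v => ⟨v, rfl⟩
  have hB : ∀ w : VB, (inB w : Glue X Y) ∉ Set.range (quiverA X Y).obj := fun w => by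
    rintro ⟨v, hv⟩; cases hv
  intro s t t' q x hq hx
  cases q with
  | nil => exact absurd rfl hq
  | @cons r _ q y =>
    rw [ofPath_cons, ofPath_cons, mul_assoc]
    refine IC.mul_mem_left _ ?_
    match r, t, t', y, x, hx with
    | inA _, inA _, inA _, _, _, hx => exact absurd (iff_of_true (hA _) (hA _)) hx
    | inB _, inA _, inA _, _, _, hx => exact absurd (iff_of_true (hA _) (hA _)) hx
    | inA _, inB _, inB _, _, _, hx => exact absurd (iff_of_false (hB _) (hB _)) hx
    | inB _, inB _, inB _, _, _, hx => exact absurd (iff_of_false (hB _) (hB _)) hx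
    | inA _, inA _, inB _, y, x, _ => exact hC.arrow_alpha y x
    | inB _, inA _, inB _, y, x, _ => exact hC.beta_alpha y x
    | inA _, inB _, inA _, y, x, _ => exact hC.alpha_beta y x
    | inB _, inB _, inA _, y, x, _ => exact hC.arrow_beta y x

end Glue

theorem theorem3p3 {k : Type u} [Field k]
    {VA VB : Type u} [Quiver.{u} VA] [Quiver.{u} VB] [Fintype VA] [Fintype VB]
    [∀ v v' : VA, Finite (v ⟶ v')] [∀ w w' : VB, Finite (w ⟶ w')]
    {X : VA → VB → Type u} {Y : VB → VA → Type u}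
    [∀ v w, Finite (X v w)] [∀ w v, Finite (Y w v)]
    (IA : Ideal (PathAlgebra k VA)) [IA.IsTwoSided] [IsAdmissible IA]
    (IB : Ideal (PathAlgebra k VB)) [IB.IsTwoSided] [IsAdmissible IB]
    (IC : Ideal (PathAlgebra k (Glue X Y))) [IC.IsTwoSided] [IsAdmissible IC]
    (hC : IsSquareIdeal IA IB IC)
    (hO : SyzygyFinite (orbitSubgroup IA IB IC))
    (hA : phiDim (PathAlgebra k VA ⧸ IA)ᵐᵒᵖ < ⊤)
    (hB : phiDim (PathAlgebra k VB ⧸ IB)ᵐᵒᵖ < ⊤) :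
    phiDim (PathAlgebra k (Glue X Y) ⧸ IC)ᵐᵒᵖ < ⊤ ∧
    phiDim (PathAlgebra k (Glue X Y) ⧸ IC)ᵐᵒᵖ ≤
      (⨆ (D : AddSubgroup (K0 (PathAlgebra k (Glue X Y) ⧸ IC)ᵐᵒᵖ))
          (_ : D ≤ orbitSubgroup IA IB IC ∧ D.FG),
        eta (omegaBar (PathAlgebra k (Glue X Y) ⧸ IC)ᵐᵒᵖ) D) +
      max (phiDim (PathAlgebra k VA ⧸ IA)ᵐᵒᵖ) (phiDim (PathAlgebra k VB ⧸ IB)ᵐᵒᵖ) + 2 := by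
  have hkA := hC.killsCrossings
  have hkB : PathAlgebra.KillsCrossings (Set.range (Glue.quiverB X Y).obj) IC := by
    rw [Glue.range_quiverB_obj]; exact hkA.compl
  have h := Glue.isFullSubquiver_quiverA.isSquareRing hC.mem_A hkA Glue.isFullSubquiver_quiverB
    hC.mem_B hkB Glue.range_quiverB_obj
  have := PathAlgebra.isArtinianRing_boundQuiverAlgebra IA
  have := PathAlgebra.isArtinianRing_boundQuiverAlgebra IB
  have := PathAlgebra.isArtinianRing_boundQuiverAlgebra IC
  have hθA := Glue.isFullSubquiver_quiverA.corner_incl hC.mem_A hkA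
  have hθB := Glue.isFullSubquiver_quiverB.corner_incl hC.mem_B hkB
  have hle : h.orbitSpan ≤ orbitSubgroup IA IB IC := by
    refine AddSubgroup.closure_mono (Set.union_subset_union ?_ ?_)
    · rintro _ ⟨p, rfl⟩
      exact h.orbitClass_mem_orbitClasses (θ := cornerA IC) (θ' := cornerB IC) hθA hθB p
    · rintro _ ⟨p, rfl⟩
      exact h.symm.orbitClass_mem_orbitClasses (θ := cornerB IC) (θ' := cornerA IC) hθB hθA p
  have hfg := h.fg_orbitSpan hle hO
  obtain ⟨n, hn⟩ := ENat.ne_top_iff_exists.1 (max_lt hA hB).ne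
  have hle' := h.phiDim_le hfg (hn ▸ le_max_left _ _) (hn ▸ le_max_right _ _)
  refine ⟨hle'.trans_lt ?_, ?_⟩
  · have := eta_lt_top (omegaBar (PathAlgebra k (Glue X Y) ⧸ IC)ᵐᵒᵖ) h.orbitSpan hfg
      fun x hx => h.omegaBar_mem_orbitSpan hx
    exact ENat.add_lt_top.2 ⟨ENat.add_lt_top.2 ⟨this, ENat.natCast_lt_top n⟩, ENat.natCast_lt_top 2⟩
  · refine hle'.trans ?_
    rw [hn]
    gcongr
    exact le_iSup₂ (f := fun D (_ : D ≤ orbitSubgroup IA IB IC ∧ D.FG) =>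
      eta (omegaBar (PathAlgebra k (Glue X Y) ⧸ IC)ᵐᵒᵖ) D) h.orbitSpan ⟨hle, hfg⟩
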